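/- Let $\mathcal A$ be an abelian category which is bicomplete (products and coproducts indexed by sets exist) and has enough projectives and enough injectives. For an abelian category $\mathcal B$ and $*\in\{b,+,-,\varnothing\}$ let $\mathscr K^*(\mathcal B)$ be the homotopy category of $*$-bounded complexes over $\mathcal B$, let $\mathscr D^*(\mathcal B)$ be the full subcategory of the derived category $\mathscr D(\mathcal B)$ of complexes with $*$-bounded cohomology, and let $Q_{\mathcal B}:\mathscr K^*(\mathcal B)\to\mathscr D^*(\mathcal B)$ be the localization functor. Let $\mathcal X,\mathcal Y\subseteq\mathcal A$ be abelian subcategories (full additive subcategories closed under isomorphisms, kernels and cokernels), with exact inclusions $i:\mathcal X\to\mathcal A$ and $j:\mathcal Y\to\mathcal A$ and induced functors $\mathscr D^*(i)$, $\mathscr D^*(j)$. Assume that $(\mathcal X,\mathcal Y)$ is a derived decomposition of $\mathcal A$, that is: (D1) $\mathscr D^b(i):\mathscr D^b(\mathcal X)\to\mathscr D^b(\mathcal A)$ and $\mathscr D^b(j):\mathscr D^b(\mathcal Y)\to\mathscr D^b(\mathcal A)$ are fully faithful; (D2) $\operatorname{Hom}_{\mathscr D^b(\mathcal A)}(X,Y[n])=0$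 for all $X\in\mathcal X$, $Y\in\mathcal Y$ and $n\in\mathbb Z$; (D3) for each $M\in\mathscr D^b(\mathcal A)$ there are $U\in\mathscr D^b(\mathcal X)$, $V\in\mathscr D^b(\mathcal Y)$ and a distinguished triangle $\mathscr D^b(i)(U)\to M\to\mathscr D^b(j)(V)\to\mathscr D^b(i)(U)[1]$ in $\mathscr D^b(\mathcal A)$. Then $i$ has a right adjoint and $j$ has a left adjoint. Moreover, for every right adjoint $r:\mathcal A\to\mathcal X$ of $i$, every left adjoint $\ell:\mathcal A\to\mathcal Y$ of $j$ and every $*\in\{b,+,-,\varnothing\}$, the right derived functor $\mathbb R^*(r):\mathscr D^*(\mathcal A)\to\mathscr D^*(\mathcal X)$ and the left derived functor $\mathbb L^*(\ell):\mathscr D^*(\mathcal A)\to\mathscr D^*(\mathcal Y)$ exist, and $$\mathscr D^*(\mathcal X)\;\underset{\mathbb R^*(r)}{\overset{\mathscr D^*(i)}{\rightleftarrows}}\;\mathscr D^*(\mathcal A)\;\underset{\mathscr D^*(j)}{\overset{\mathbb L^*(\ell)}{\rightleftarrows}}\;\mathscr D^*(\mathcal Y)$$ is a lower half recollement. Here $\mathbb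 R^*(r)$ is a shift-compatible functor with a shift-compatible natural transformation $Q_{\mathcal X}\circ\mathscr K^*(r)\to\mathbb R^*(r)\circ Q_{\mathcal A}$ that is universal (a left Kan extension along $Q_{\mathcal A}$), and $\mathbb L^*(\ell)$ is defined dually. That the diagram is a lower half recollement means: (1) the four functors are triangle functors, and $\mathscr D^*(i)$ and $\mathscr D^*(j)$ are fully faithful; (2) $(\mathscr D^*(i),\mathbb R^*(r))$ and $(\mathbb L^*(\ell),\mathscr D^*(j))$ are adjoint pairs; (3) $\mathbb L^*(\ell)\,\mathscr D^*(i)=0$ and $\mathbb R^*(r)\,\mathscr D^*(j)=0$; (4) for each $D\in\mathscr D^*(\mathcal A)$ there is a distinguished triangle $$\mathscr D^*(i)\mathbb R^*(r)(D)\to D\to\mathscr D^*(j)\mathbb L^*(\ell)(D)\to\mathscr D^*(i)\mathbb R^*(r)(D)[1]$$ whose first morphism is the counit and whose second morphism is the unit of these adjunctions. -/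

import Mathlib

open CategoryTheory Category Limits Pretriangulated

universe w w₁ w₂ v v₁ v₂ u u₁ u₂

noncomputable section

namespace DerivedDecomposition

/-- A full subcategory (closed under isomorphisms) `P` of an abelian category is an abelian
subcategory if it is an additive subcategory closed under kernels and cokernels; equivalently,
it is an abelian category and the inclusion functor is exact. -/
class IsAbelianSubcategory {A : Type u} [Category.{v} A] [Abelian A]
    (P : ObjectProperty A) : Prop extends
    P.ContainsZero, P.IsClosedUnderIsomorphisms, P.IsClosedUnderFiniteProducts,
    P.IsClosedUnderKernels, P.IsClosedUnderCokernels

section Inclusion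

variable {A : Type u} [Category.{v} A] [Abelian A] (P : ObjectProperty A)
  [IsAbelianSubcategory P]

instance preservesFiniteLimits_inclusion : PreservesFiniteLimits P.ι := by
  have := fun {X Y : P.FullSubcategory} (f : X ⟶ Y) => P.preservesKernels_ι f
  exact Functor.preservesFiniteLimits_of_preservesKernels P.ι

instance preservesFiniteColimits_inclusion : PreservesFiniteColimits P.ι := by
  have := fun {X Y : P.FullSubcategory} (f : X ⟶ Y) => P.preservesCokernels_ι f
  exact Functor.preservesFiniteColimits_of_preservesCokernels P.ι

end Inclusion

/-- The four boundedness conditions `b`, `+`, `-`, `∅` on complexes. -/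
inductive Bound : Type
  | bounded
  | boundedBelow
  | boundedAbove
  | unbounded

section Derived

variable (A : Type u) [Category.{v} A] [Abelian A]

/-- The objects of the derived category of `A` whose cohomology satisfies the boundedness
condition `s` (equivalently, which are isomorphic to a complex satisfying `s`). -/
def dProp [HasDerivedCategory.{w} A] : Bound → ObjectProperty (DerivedCategory A)
  | .bounded => (DerivedCategory.TStructure.t (C := A)).bounded
  | .boundedBelow => (DerivedCategory.TStructure.t (C := A)).plus
  | .boundedAbove => (DerivedCategory.TStructure.t (C := A)).minus
  | .unbounded => ⊤

instance [HasDerivedCategory.{w} A] (s : Bound) : (dProp A s).IsTriangulated := by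
  cases s <;> dsimp only [dProp] <;> first | infer_instance | skip
  exact
    { exists_zero := ⟨_, isZero_zero _, trivial⟩
      isStableUnderShiftBy := fun _ => ⟨fun _ _ => trivial⟩
      ext₂' := fun T _ _ _ => ObjectProperty.le_isoClosure _ _ trivial }

instance [HasDerivedCategory.{w} A] (s : Bound) : (dProp A s).IsClosedUnderIsomorphisms := by
  cases s <;> dsimp only [dProp] <;> infer_instance

/-- The `s`-bounded derived category of `A`, as a full triangulated subcategory of the
derived category of `A`. -/
abbrev DStar [HasDerivedCategory.{w} A] (s : Bound) := (dProp A s).FullSubcategory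

/-- The functor sending an object of `A` to the corresponding complex concentrated in
degree `0`. -/
def singleStar [HasDerivedCategory.{w} A] (s : Bound) : A ⥤ DStar A s :=
  (dProp A s).lift (DerivedCategory.singleFunctor A 0) (fun M => by
    have h₁ : (DerivedCategory.TStructure.t (C := A)).plus
      ((DerivedCategory.singleFunctor A 0).obj M) := ⟨0, inferInstance⟩
    have h₂ : (DerivedCategory.TStructure.t (C := A)).minus
      ((DerivedCategory.singleFunctor A 0).obj M) := ⟨0, inferInstance⟩
    cases s
    exacts [⟨h₁, h₂⟩, h₁, h₂, trivial])

/-- The boundedness condition `s` on the terms of a cochain complex. -/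
def cProp : Bound → CochainComplex A ℤ → Prop
  | .bounded, K => (∃ n : ℤ, K.IsStrictlyGE n) ∧ ∃ n : ℤ, K.IsStrictlyLE n
  | .boundedBelow, K => ∃ n : ℤ, K.IsStrictlyGE n
  | .boundedAbove, K => ∃ n : ℤ, K.IsStrictlyLE n
  | .unbounded, _ => True

/-- The objects of the homotopy category of `A` which, as complexes, satisfy the
boundedness condition `s`. -/
def kProp (s : Bound) : ObjectProperty (HomotopyCategory A (ComplexShape.up ℤ)) :=
  fun K => cProp A s K.as

instance (s : Bound) : (kProp A s).IsStableUnderShift ℤ where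
  isStableUnderShiftBy a := ⟨fun K hK => by
    obtain ⟨K : CochainComplex _ _, rfl⟩ := K.quotient_obj_surjective
    have hge : (∃ n : ℤ, K.IsStrictlyGE n) →
        ∃ n : ℤ, ((shiftFunctor (CochainComplex A ℤ) a).obj K).IsStrictlyGE n := by
      rintro ⟨n, _⟩
      exact ⟨n - a, K.isStrictlyGE_shift n a (n - a) (by lia)⟩
    have hle : (∃ n : ℤ, K.IsStrictlyLE n) →
        ∃ n : ℤ, ((shiftFunctor (CochainComplex A ℤ) a).obj K).IsStrictlyLE n := by
      rintro ⟨n, _⟩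
      exact ⟨n - a, K.isStrictlyLE_shift n a (n - a) (by lia)⟩
    rw [ObjectProperty.prop_shift_iff, HomotopyCategory.shift_quotient_obj]
    cases s
    exacts [⟨hge hK.1, hle hK.2⟩, hge hK, hle hK, trivial]⟩

/-- The `s`-bounded homotopy category of complexes over `A`. -/
abbrev KStar (s : Bound) := (kProp A s).FullSubcategory

/-- The localization functor from the `s`-bounded homotopy category to the `s`-bounded
derived category. -/
def qStar [HasDerivedCategory.{w} A] (s : Bound) : KStar A s ⥤ DStar A s :=
  (dProp A s).lift ((kProp A s).ι ⋙ DerivedCategory.Qh) (by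
    rintro ⟨K, hK⟩
    obtain ⟨K : CochainComplex _ _, rfl⟩ := K.quotient_obj_surjective
    have e := (DerivedCategory.quotientCompQhIso A).app K
    have hge : (∃ n : ℤ, K.IsStrictlyGE n) → (DerivedCategory.TStructure.t (C := A)).plus
        (DerivedCategory.Qh.obj ((HomotopyCategory.quotient A (ComplexShape.up ℤ)).obj K)) := by
      rintro ⟨n, h⟩
      exact ⟨n, ⟨⟨K, e, h⟩⟩⟩
    have hle : (∃ n : ℤ, K.IsStrictlyLE n) → (DerivedCategory.TStructure.t (C := A)).minus
        (DerivedCategory.Qh.obj ((HomotopyCategory.quotient A (ComplexShape.up ℤ)).obj K)) := by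
      rintro ⟨n, h⟩
      exact ⟨n, ⟨⟨K, e, h⟩⟩⟩
    cases s
    exacts [⟨hge hK.1, hle hK.2⟩, hge hK, hle hK, trivial])

instance [HasDerivedCategory.{w} A] (s : Bound) : (qStar A s).CommShift ℤ := by
  dsimp only [qStar]
  infer_instance

end Derived

section Functors

variable {A : Type u₁} [Category.{v₁} A] [Abelian A]
  {B : Type u₂} [Category.{v₂} B] [Abelian B] (F : A ⥤ B) [F.Additive]

/-- The functor between `s`-bounded homotopy categories induced by an additive functor,
applying the functor termwise. -/
def mapKStar (s : Bound) : KStar A s ⥤ KStar B s :=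
  (kProp B s).lift ((kProp A s).ι ⋙ F.mapHomotopyCategory (ComplexShape.up ℤ)) (by
    rintro ⟨K, hK⟩
    obtain ⟨K : CochainComplex _ _, rfl⟩ := K.quotient_obj_surjective
    have hge : (∃ n : ℤ, K.IsStrictlyGE n) → ∃ n : ℤ, CochainComplex.IsStrictlyGE
        ((F.mapHomologicalComplex (ComplexShape.up ℤ)).obj K) n := by
      rintro ⟨n, _⟩
      exact ⟨n, inferInstance⟩
    have hle : (∃ n : ℤ, K.IsStrictlyLE n) → ∃ n : ℤ, CochainComplex.IsStrictlyLE
        ((F.mapHomologicalComplex (ComplexShape.up ℤ)).obj K) n := by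
      rintro ⟨n, _⟩
      exact ⟨n, inferInstance⟩
    cases s
    exacts [⟨hge hK.1, hle hK.2⟩, hge hK, hle hK, trivial])

instance (s : Bound) : (mapKStar F s).CommShift ℤ := by
  dsimp only [mapKStar]
  infer_instance

variable [HasDerivedCategory.{w₁} A] [HasDerivedCategory.{w₂} B]

/-- The functor between `s`-bounded derived categories induced by an exact functor. -/
def mapDStar [PreservesFiniteLimits F] [PreservesFiniteColimits F] (s : Bound) :
    DStar A s ⥤ DStar B s :=
  (dProp B s).lift ((dProp A s).ι ⋙ F.mapDerivedCategory) (by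
    rintro ⟨M, hM⟩
    have hge : (DerivedCategory.TStructure.t (C := A)).plus M →
        (DerivedCategory.TStructure.t (C := B)).plus (F.mapDerivedCategory.obj M) := by
      rintro ⟨n, ⟨K, e, _⟩⟩
      exact ⟨n, ⟨⟨(F.mapHomologicalComplex (ComplexShape.up ℤ)).obj K,
        F.mapDerivedCategory.mapIso e ≪≫ F.mapDerivedCategoryFactors.app K, inferInstance⟩⟩⟩
    have hle : (DerivedCategory.TStructure.t (C := A)).minus M →
        (DerivedCategory.TStructure.t (C := B)).minus (F.mapDerivedCategory.obj M) := by
      rintro ⟨n, ⟨K, e, _⟩⟩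
      exact ⟨n, ⟨⟨(F.mapHomologicalComplex (ComplexShape.up ℤ)).obj K,
        F.mapDerivedCategory.mapIso e ≪≫ F.mapDerivedCategoryFactors.app K, inferInstance⟩⟩⟩
    cases s
    exacts [⟨hge hM.1, hle hM.2⟩, hge hM, hle hM, trivial])

instance [PreservesFiniteLimits F] [PreservesFiniteColimits F] (s : Bound) :
    (mapDStar F s).CommShift ℤ := by
  dsimp only [mapDStar]
  infer_instance

/-- `R` is the (total) right derived functor of the additive functor `F` on `s`-bounded
derived categories: for some natural transformation `α : Q_B ∘ K(F) ⟶ R ∘ Q_A` compatible with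
the shifts, the pair `(R, α)` is initial among all such pairs, i.e. it is a left Kan extension
of `Q_B ∘ K(F)` along the localization functor `Q_A`. -/
def IsRightDerived (s : Bound) (R : DStar A s ⥤ DStar B s) [R.CommShift ℤ] : Prop :=
  ∃ α : mapKStar F s ⋙ qStar B s ⟶ qStar A s ⋙ R,
    NatTrans.CommShift α ℤ ∧ R.IsLeftKanExtension α

/-- `L` is the (total) left derived functor of the additive functor `F` on `s`-bounded
derived categories: for some natural transformation `β : L ∘ Q_A ⟶ Q_B ∘ K(F)` compatible with
the shifts, the pair `(L, β)` is terminal among all such pairs, i.e. it is a right Kan extension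
of `Q_B ∘ K(F)` along the localization functor `Q_A`. -/
def IsLeftDerived (s : Bound) (L : DStar A s ⥤ DStar B s) [L.CommShift ℤ] : Prop :=
  ∃ β : qStar A s ⋙ L ⟶ mapKStar F s ⋙ qStar B s,
    NatTrans.CommShift β ℤ ∧ L.IsRightKanExtension β

end Functors

/-- A pair `(X, Y)` of abelian subcategories of `A` is a `D^s`-decomposition of `A`.
The derived decompositions are the `D^b`-decompositions. -/
structure IsDDecomposition {A : Type u} [Category.{v} A] [Abelian A] [HasDerivedCategory.{w} A]
    (X Y : ObjectProperty A) [IsAbelianSubcategory X] [IsAbelianSubcategory Y]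
    [HasDerivedCategory.{w₁} X.FullSubcategory] [HasDerivedCategory.{w₂} Y.FullSubcategory]
    (s : Bound) : Prop where
  full_left : (mapDStar X.ι s).Full
  faithful_left : (mapDStar X.ι s).Faithful
  full_right : (mapDStar Y.ι s).Full
  faithful_right : (mapDStar Y.ι s).Faithful
  hom_eq_zero (M N : A) (_ : X M) (_ : Y N) (n : ℤ)
    (f : (singleStar A s).obj M ⟶ ((singleStar A s).obj N)⟦n⟧) : f = 0
  exists_triangle (M : DStar A s) :
    ∃ (U : DStar X.FullSubcategory s) (V : DStar Y.FullSubcategory s)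
      (f : (mapDStar X.ι s).obj U ⟶ M) (g : M ⟶ (mapDStar Y.ι s).obj V)
      (h : (mapDStar Y.ι s).obj V ⟶ ((mapDStar X.ι s).obj U)⟦(1 : ℤ)⟧),
      Triangle.mk f g h ∈ distTriang (DStar A s)

/-- A lower half recollement of triangulated categories `𝒳 ⇄ 𝒟 ⇄ 𝒴`: the triangle functors
`i` and `j` identify `𝒳` and `𝒴` with full subcategories of `𝒟`, `R` is right adjoint to `i`,
`L` is left adjoint to `j`, one has `L i = 0` and `R j = 0`, and for each object `D`, the
counit of `(i, R)` and the unit of `(L, j)` fit into a distinguished triangle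
`i R D ⟶ D ⟶ j L D ⟶ (i R D)[1]`. -/
structure LowerHalfRecollement
    {𝒳 𝒟 𝒴 : Type*} [Category* 𝒳] [Category* 𝒟] [Category* 𝒴]
    [HasZeroObject 𝒳] [HasShift 𝒳 ℤ] [Preadditive 𝒳]
    [∀ n : ℤ, (shiftFunctor 𝒳 n).Additive] [Pretriangulated 𝒳]
    [HasZeroObject 𝒟] [HasShift 𝒟 ℤ] [Preadditive 𝒟]
    [∀ n : ℤ, (shiftFunctor 𝒟 n).Additive] [Pretriangulated 𝒟]
    [HasZeroObject 𝒴] [HasShift 𝒴 ℤ] [Preadditive 𝒴]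
    [∀ n : ℤ, (shiftFunctor 𝒴 n).Additive] [Pretriangulated 𝒴]
    (i : 𝒳 ⥤ 𝒟) (R : 𝒟 ⥤ 𝒳) (L : 𝒟 ⥤ 𝒴) (j : 𝒴 ⥤ 𝒟)
    [i.CommShift ℤ] [R.CommShift ℤ] [L.CommShift ℤ] [j.CommShift ℤ] where
  triangulated_i : i.IsTriangulated
  triangulated_R : R.IsTriangulated
  triangulated_L : L.IsTriangulated
  triangulated_j : j.IsTriangulated
  full_i : i.Full
  faithful_i : i.Faithful
  full_j : j.Full
  faithful_j : j.Faithful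
  adjRight : i ⊣ R
  adjLeft : L ⊣ j
  isZero_L_i (M : 𝒳) : IsZero (L.obj (i.obj M))
  isZero_R_j (N : 𝒴) : IsZero (R.obj (j.obj N))
  exists_triangle (D : 𝒟) :
    ∃ h : j.obj (L.obj D) ⟶ (i.obj (R.obj D))⟦(1 : ℤ)⟧,
      Triangle.mk (adjRight.counit.app D) (adjLeft.unit.app D) h ∈ distTriang 𝒟

end DerivedDecomposition

end

open DerivedDecomposition

/-! The bounded decomposition is first read off on objects of `A`. In a triangle `U → M → V → U[1]`
with `U` from `X` and `V` from `Y`, the connecting map identifies `H^n(V)` with `H^{n+1}(U)`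
wherever `H^n(M)` and `H^{n+1}(M)` vanish. Such an object lies in both `X` and `Y`, hence is zero by
orthogonality. So if `M` lives in `[a,b]`, then `U` lives in `[a,b+1]` and `V` in `[a-1,b]`
(`isZero_homology`). For `M` in `A` it follows that `H^0(U)` is the coreflection of `M` in `X` and
`H^0(V)` its reflection in `Y`, which gives the adjoints `r` and `ℓ`.

The same estimate makes `r` and `ℓ` of dimension at most one, and this is what reaches unbounded
complexes without K-injectives. The objects `M` for which every class in `Ext^1(T,M)`, `T` in `X`,
dies on an epimorphism `T' → T` within `X` contain the injectives and are closed under sums and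
quotients. On short exact sequences starting with such an object `r` is exact (`isRightAdapted`).
Every complex, bounded or not, has a resolution by such objects, obtained as the cocone of a
contractible injective complex mapping onto a quotient (`exists_resolution`), and `r` preserves
quasi-isomorphisms between complexes of such objects. The dual statement holds for `ℓ`.

Consequently the exact inclusions stay fully faithful on unbounded derived categories, orthogonality
holds because `r` kills `Y`, and the decomposition triangle of a resolved complex `N` is the cone of
the counit `i r N → N`: in each degree its kernel and cokernel are `H^{-1}` and `H^0` of the
`Y`-part, so lie in `Y` (`kernel_counit_and_cokernel_counit`). The amplitude estimate restricts
these triangles to every boundedness condition, and the recollement is then formal.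

Finally, the derived functors need not be computed. A right adjoint of `D(i)` is automatically the
left Kan extension of `Q ∘ K(r)` along `Q`, via mates, because every morphism in the image of `Q` is
a fraction (`isLeftKanExtension_rightMate`); dually for `ℓ`. -/

noncomputable section

open ZeroObject

namespace DerivedDecomposition

/-! ### Degreewise adjunctions, and maps of complexes that vanish in the derived category -/

section Complexes

variable {A : Type u₁} [Category.{v₁} A] [Abelian A]
  {B : Type u₂} [Category.{v₂} B] [Abelian B]

/-- An adjunction between additive functors extends to complexes, degreewise. -/
def mapComplexAdjunction {F : B ⥤ A} {G : A ⥤ B} [F.Additive] [G.Additive] (adj : F ⊣ G) :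
    F.mapHomologicalComplex (ComplexShape.up ℤ) ⊣ G.mapHomologicalComplex (ComplexShape.up ℤ) where
  unit :=
    { app K :=
        { f n := adj.unit.app (K.X n)
          comm' _ _ _ := (adj.unit.naturality _).symm }
      naturality _ _ f := by
        ext n
        exact adj.unit.naturality (f.f n) }
  counit :=
    { app K :=
        { f n := adj.counit.app (K.X n)
          comm' _ _ _ := (adj.counit.naturality _).symm }
      naturality _ _ f := by
        ext n
        exact adj.counit.naturality (f.f n) }
  left_triangle_components K := by
    ext n
    exact adj.left_triangle_components (K.X n)
  right_triangle_components K := by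
    ext n
    exact adj.right_triangle_components (K.X n)

variable [HasDerivedCategory.{w} A]

lemma exists_quasiIso_homotopy_postcomp {K L : CochainComplex A ℤ} (f : K ⟶ L)
    (hf : DerivedCategory.Q.map f = 0) :
    ∃ (L' : CochainComplex A ℤ) (s : L ⟶ L'), QuasiIso s ∧ Nonempty (Homotopy (f ≫ s) 0) := by
  have h : DerivedCategory.Qh.map ((HomotopyCategory.quotient A (ComplexShape.up ℤ)).map f) =
      DerivedCategory.Qh.map ((HomotopyCategory.quotient A (ComplexShape.up ℤ)).map 0) := by
    rw [← cancel_mono ((DerivedCategory.quotientCompQhIso A).hom.app L),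
      DerivedCategory.quotientCompQhIso_hom_naturality,
      DerivedCategory.quotientCompQhIso_hom_naturality, hf, Functor.map_zero]
  rw [MorphismProperty.map_eq_iff_postcomp DerivedCategory.Qh
    (HomotopyCategory.quasiIso A (ComplexShape.up ℤ))] at h
  obtain ⟨L', s, hs, h⟩ := h
  obtain ⟨L', rfl⟩ := HomotopyCategory.quotient_obj_surjective L'
  obtain ⟨s, rfl⟩ := (HomotopyCategory.quotient _ _).map_surjective s
  rw [HomotopyCategory.quotient_map_mem_quasiIso_iff] at hs
  refine ⟨L', s, hs, ⟨HomotopyCategory.homotopyOfEq _ _ ?_⟩⟩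
  rw [Functor.map_comp, h, Functor.map_zero, Functor.map_zero, zero_comp]

lemma exists_quasiIso_homotopy_precomp {K L : CochainComplex A ℤ} (f : K ⟶ L)
    (hf : DerivedCategory.Q.map f = 0) :
    ∃ (K' : CochainComplex A ℤ) (s : K' ⟶ K), QuasiIso s ∧ Nonempty (Homotopy (s ≫ f) 0) := by
  have h : DerivedCategory.Qh.map ((HomotopyCategory.quotient A (ComplexShape.up ℤ)).map f) =
      DerivedCategory.Qh.map ((HomotopyCategory.quotient A (ComplexShape.up ℤ)).map 0) := by
    rw [← cancel_mono ((DerivedCategory.quotientCompQhIso A).hom.app L),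
      DerivedCategory.quotientCompQhIso_hom_naturality,
      DerivedCategory.quotientCompQhIso_hom_naturality, hf, Functor.map_zero]
  rw [MorphismProperty.map_eq_iff_precomp DerivedCategory.Qh
    (HomotopyCategory.quasiIso A (ComplexShape.up ℤ))] at h
  obtain ⟨L', s, hs, h⟩ := h
  obtain ⟨L', rfl⟩ := HomotopyCategory.quotient_obj_surjective L'
  obtain ⟨s, rfl⟩ := (HomotopyCategory.quotient _ _).map_surjective s
  rw [HomotopyCategory.quotient_map_mem_quasiIso_iff] at hs
  refine ⟨L', s, hs, ⟨HomotopyCategory.homotopyOfEq _ _ ?_⟩⟩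
  rw [Functor.map_comp, h, Functor.map_zero, Functor.map_zero, comp_zero]

end Complexes

/-! ### A criterion for full faithfulness on unbounded derived categories -/

section FullyFaithful

lemma full_of_essSurj {C D E : Type*} [Category* C] [Category* D] [Category* E]
    (Q : C ⥤ D) [Q.EssSurj] (F : D ⥤ E)
    (h : ∀ K L : C, Function.Surjective (F.map : (Q.obj K ⟶ Q.obj L) → _)) : F.Full where
  map_surjective {X Y} f := by
    obtain ⟨g, hg⟩ := h _ _ (F.map (Q.objObjPreimageIso X).hom ≫ f ≫
      F.map (Q.objObjPreimageIso Y).inv)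
    refine ⟨(Q.objObjPreimageIso X).inv ≫ g ≫ (Q.objObjPreimageIso Y).hom, ?_⟩
    rw [F.map_comp, F.map_comp, hg, assoc, assoc, ← F.map_comp_assoc, ← F.map_comp]
    simp

lemma faithful_of_essSurj {C D E : Type*} [Category* C] [Category* D] [Category* E]
    [Preadditive D] [Preadditive E]
    (Q : C ⥤ D) [Q.EssSurj] (F : D ⥤ E) [F.Additive]
    (h : ∀ (K L : C) (f : Q.obj K ⟶ Q.obj L), F.map f = 0 → f = 0) : F.Faithful where
  map_injective {X Y} f g hfg := by
    have := h _ _ ((Q.objObjPreimageIso X).hom ≫ (f - g) ≫ (Q.objObjPreimageIso Y).inv) (by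
      rw [F.map_comp, F.map_comp, F.map_sub, hfg, sub_self, zero_comp, comp_zero])
    rw [← cancel_epi (Q.objObjPreimageIso X).hom, ← cancel_mono (Q.objObjPreimageIso Y).inv,
      ← sub_eq_zero, assoc, assoc, ← Preadditive.comp_sub,
      ← Preadditive.sub_comp, this]

variable {A : Type u₁} [Category.{v₁} A] [Abelian A]
  {B : Type u₂} [Category.{v₂} B] [Abelian B]
  [HasDerivedCategory.{w₁} A] [HasDerivedCategory.{w₂} B]
  {F : B ⥤ A} {G : A ⥤ B} [F.Additive] [G.Additive]
  [PreservesFiniteLimits F] [PreservesFiniteColimits F]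

/-- If every quasi-isomorphism from a complex in the image of `F` can be prolonged to a
quasi-isomorphism whose adjunct is a quasi-isomorphism, then `F` induces a fully faithful
functor on derived categories. -/
lemma fullyFaithful_mapDerivedCategory_of_rightAdjoint (adj : F ⊣ G)
    (h : ∀ (W : CochainComplex B ℤ) (N : CochainComplex A ℤ)
      (t : (F.mapHomologicalComplex (ComplexShape.up ℤ)).obj W ⟶ N), QuasiIso t →
      ∃ (N' : CochainComplex A ℤ) (t' : N ⟶ N'), QuasiIso t' ∧
        QuasiIso ((mapComplexAdjunction adj).homEquiv _ _ (t ≫ t'))) :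
    F.mapDerivedCategory.Full ∧ F.mapDerivedCategory.Faithful := by
  constructor
  · refine full_of_essSurj DerivedCategory.Q _ (fun W W₂ f => ?_)
    -- Write the morphism as a fraction `g t⁻¹` and enlarge the denominator until its adjunct `s` is
    -- a quasi-isomorphism. Since `F(s)` followed by the counit `ε` is `t ≫ t'`, two-out-of-three
    -- makes `ε` a quasi-isomorphism, and the preimage is `g' s⁻¹` with `g'` the adjunct of `g ≫
    -- t'`.
    obtain ⟨N, g, t, ht, fac⟩ := DerivedCategory.left_fac
      (F.mapDerivedCategoryFactors.inv.app W ≫ f ≫ F.mapDerivedCategoryFactors.hom.app W₂)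
    rw [DerivedCategory.isIso_Q_map_iff_quasiIso] at ht
    obtain ⟨N', t', ht', hs⟩ := h W₂ N t ht
    set s := (mapComplexAdjunction adj).homEquiv _ _ (t ≫ t') with hsdef
    let g' := (mapComplexAdjunction adj).homEquiv _ _ (g ≫ t')
    let ε := (mapComplexAdjunction adj).counit.app N'
    have fs : (F.mapHomologicalComplex (ComplexShape.up ℤ)).map s ≫ ε = t ≫ t' := by
      rw [hsdef]
      exact ((mapComplexAdjunction adj).homEquiv_counit (g := s)).symm.trans
        (((mapComplexAdjunction adj).homEquiv _ _).symm_apply_apply _)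
    have fg : (F.mapHomologicalComplex (ComplexShape.up ℤ)).map g' ≫ ε = g ≫ t' :=
      ((mapComplexAdjunction adj).homEquiv_counit (g := g')).symm.trans
        (((mapComplexAdjunction adj).homEquiv _ _).symm_apply_apply _)
    have : QuasiIso ε := by
      have : QuasiIso ((F.mapHomologicalComplex (ComplexShape.up ℤ)).map s ≫ ε) := by
        rw [fs]; infer_instance
      exact quasiIso_of_comp_left ((F.mapHomologicalComplex (ComplexShape.up ℤ)).map s) ε
    refine ⟨DerivedCategory.Q.map g' ≫ inv (DerivedCategory.Q.map s), ?_⟩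
    rw [← cancel_mono (F.mapDerivedCategory.map (DerivedCategory.Q.map s)), ← Functor.map_comp,
      assoc, IsIso.inv_hom_id, comp_id,
      ← cancel_mono (F.mapDerivedCategoryFactors.hom.app _), assoc,
      F.mapDerivedCategoryFactors_hom_naturality, F.mapDerivedCategoryFactors_hom_naturality,
      ← cancel_mono (DerivedCategory.Q.map ε), assoc, assoc, assoc, ← Functor.map_comp,
      ← Functor.map_comp, fs, fg, ← cancel_epi (F.mapDerivedCategoryFactors.inv.app W),
      Functor.map_comp, Functor.map_comp, Iso.inv_hom_id_app_assoc, reassoc_of% fac,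
      IsIso.inv_hom_id_assoc]
  · refine faithful_of_essSurj DerivedCategory.Q _ (fun W W₂ f hf => ?_)
    obtain ⟨N, g, t, ht, rfl⟩ := DerivedCategory.left_fac f
    rw [DerivedCategory.isIso_Q_map_iff_quasiIso] at ht
    have hg : DerivedCategory.Q.map ((F.mapHomologicalComplex (ComplexShape.up ℤ)).map g) = 0 := by
      rw [Functor.map_comp, Functor.map_inv, IsIso.comp_inv_eq, zero_comp] at hf
      rw [← cancel_epi (F.mapDerivedCategoryFactors.hom.app W), comp_zero,
        ← F.mapDerivedCategoryFactors_hom_naturality, hf, zero_comp]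
    -- `F(g)` becomes null-homotopic after a quasi-isomorphism `u`. Then `g` followed by the adjunct
    -- of `u ≫ u'` is the adjunct of a null-homotopic map, and that adjunct is invertible in the
    -- derived category.
    obtain ⟨N₁, u, hu, ⟨hgu⟩⟩ := exists_quasiIso_homotopy_postcomp _ hg
    obtain ⟨N', u', hu', hs⟩ := h N N₁ u hu
    have key : g ≫ (mapComplexAdjunction adj).homEquiv _ _ (u ≫ u') =
        (mapComplexAdjunction adj).unit.app W ≫
          (G.mapHomologicalComplex (ComplexShape.up ℤ)).map
            (((F.mapHomologicalComplex (ComplexShape.up ℤ)).map g ≫ u) ≫ u') := by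
      rw [assoc]
      exact ((mapComplexAdjunction adj).homEquiv_naturality_left g (u ≫ u')).symm.trans
        ((mapComplexAdjunction adj).homEquiv_unit _ _ _)
    have hz : DerivedCategory.Q.map
        (g ≫ (mapComplexAdjunction adj).homEquiv _ _ (u ≫ u')) = 0 := by
      have := DerivedCategory.Q_map_eq_of_homotopy _ (G.mapHomotopy (hgu.compRight u'))
      rw [key, Functor.map_comp, this]
      simp
    rw [Functor.map_comp] at hz
    rw [← cancel_mono (DerivedCategory.Q.map t), assoc, IsIso.inv_hom_id, comp_id, zero_comp,
      ← cancel_mono (DerivedCategory.Q.map ((mapComplexAdjunction adj).homEquiv _ _ (u ≫ u'))),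
      hz, zero_comp]

/-- If every quasi-isomorphism to a complex in the image of `F` can be precomposed with a
quasi-isomorphism so that the adjunct is a quasi-isomorphism, then `F` induces a fully faithful
functor on derived categories. -/
lemma fullyFaithful_mapDerivedCategory_of_leftAdjoint (adj : G ⊣ F)
    (h : ∀ (W : CochainComplex B ℤ) (N : CochainComplex A ℤ)
      (t : N ⟶ (F.mapHomologicalComplex (ComplexShape.up ℤ)).obj W), QuasiIso t →
      ∃ (N' : CochainComplex A ℤ) (t' : N' ⟶ N), QuasiIso t' ∧
        QuasiIso (((mapComplexAdjunction adj).homEquiv _ _).symm (t' ≫ t))) :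
    F.mapDerivedCategory.Full ∧ F.mapDerivedCategory.Faithful := by
  constructor
  · refine full_of_essSurj DerivedCategory.Q _ (fun W₂ W f => ?_)
    obtain ⟨N, t, ht, g, fac⟩ := DerivedCategory.right_fac
      (F.mapDerivedCategoryFactors.inv.app W₂ ≫ f ≫ F.mapDerivedCategoryFactors.hom.app W)
    rw [DerivedCategory.isIso_Q_map_iff_quasiIso] at ht
    obtain ⟨N', t', ht', hs⟩ := h W₂ N t ht
    set s := ((mapComplexAdjunction adj).homEquiv _ _).symm (t' ≫ t) with hsdef
    let g' := ((mapComplexAdjunction adj).homEquiv _ _).symm (t' ≫ g)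
    let η := (mapComplexAdjunction adj).unit.app N'
    have fs : η ≫ (F.mapHomologicalComplex (ComplexShape.up ℤ)).map s = t' ≫ t := by
      rw [hsdef]
      exact ((mapComplexAdjunction adj).homEquiv_unit (f := s)).symm.trans
        (((mapComplexAdjunction adj).homEquiv _ _).apply_symm_apply _)
    have fg : η ≫ (F.mapHomologicalComplex (ComplexShape.up ℤ)).map g' = t' ≫ g :=
      ((mapComplexAdjunction adj).homEquiv_unit (f := g')).symm.trans
        (((mapComplexAdjunction adj).homEquiv _ _).apply_symm_apply _)
    have : QuasiIso η := by
      have : QuasiIso (η ≫ (F.mapHomologicalComplex (ComplexShape.up ℤ)).map s) := by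
        rw [fs]; infer_instance
      exact quasiIso_of_comp_right η ((F.mapHomologicalComplex (ComplexShape.up ℤ)).map s)
    refine ⟨inv (DerivedCategory.Q.map s) ≫ DerivedCategory.Q.map g', ?_⟩
    rw [← cancel_epi (F.mapDerivedCategory.map (DerivedCategory.Q.map s)), ← Functor.map_comp,
      IsIso.hom_inv_id_assoc, ← cancel_epi (F.mapDerivedCategoryFactors.inv.app _),
      ← cancel_epi (DerivedCategory.Q.map η),
      ← cancel_mono (F.mapDerivedCategoryFactors.hom.app W)]
    have n₁ := F.mapDerivedCategoryFactors.inv.naturality s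
    have n₂ := F.mapDerivedCategoryFactors_hom_naturality g'
    dsimp at n₁ n₂
    simp only [assoc, n₂, Iso.inv_hom_id_app_assoc, ← reassoc_of% n₁, fac]
    rw [← Functor.map_comp, fg, ← Functor.map_comp_assoc, fs,
      Functor.map_comp, Functor.map_comp, assoc, IsIso.hom_inv_id_assoc]
  · refine faithful_of_essSurj DerivedCategory.Q _ (fun W₂ W f hf => ?_)
    obtain ⟨N, t, ht, g, rfl⟩ := DerivedCategory.right_fac f
    rw [DerivedCategory.isIso_Q_map_iff_quasiIso] at ht
    have hg : DerivedCategory.Q.map ((F.mapHomologicalComplex (ComplexShape.up ℤ)).map g) = 0 := by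
      rw [Functor.map_comp, Functor.map_inv, IsIso.inv_comp_eq, comp_zero] at hf
      rw [← cancel_epi (F.mapDerivedCategoryFactors.hom.app N), comp_zero,
        ← F.mapDerivedCategoryFactors_hom_naturality, hf, zero_comp]
    obtain ⟨N₁, u, hu, ⟨hgu⟩⟩ := exists_quasiIso_homotopy_precomp _ hg
    obtain ⟨N', u', hu', hs⟩ := h N N₁ u hu
    have key : ((mapComplexAdjunction adj).homEquiv _ _).symm (u' ≫ u) ≫ g =
        (G.mapHomologicalComplex (ComplexShape.up ℤ)).map
            (u' ≫ (u ≫ (F.mapHomologicalComplex (ComplexShape.up ℤ)).map g)) ≫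
          (mapComplexAdjunction adj).counit.app W := by
      rw [← assoc]
      exact ((mapComplexAdjunction adj).homEquiv_naturality_right_symm (u' ≫ u) g).symm.trans
        ((mapComplexAdjunction adj).homEquiv_counit _ _ _)
    have hz : DerivedCategory.Q.map
        (((mapComplexAdjunction adj).homEquiv _ _).symm (u' ≫ u) ≫ g) = 0 := by
      have := DerivedCategory.Q_map_eq_of_homotopy _ (G.mapHomotopy (hgu.compLeft u'))
      rw [key, Functor.map_comp, this]
      simp
    rw [Functor.map_comp] at hz
    rw [← cancel_epi (DerivedCategory.Q.map t), IsIso.hom_inv_id_assoc, comp_zero,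
      ← cancel_epi (DerivedCategory.Q.map
        (((mapComplexAdjunction adj).homEquiv _ _).symm (u' ≫ u))), hz, comp_zero]

end FullyFaithful

/-! ### Acyclicity and quasi-isomorphisms tested in the derived category -/

section Acyclic

variable {A : Type u} [Category.{v} A] [Abelian A]

lemma acyclic_iff_isZero_Q_obj [HasDerivedCategory.{w} A] (K : CochainComplex A ℤ) :
    K.Acyclic ↔ IsZero (DerivedCategory.Q.obj K) := by
  constructor
  · intro h
    have : IsIso (0 : DerivedCategory.Q.obj K ⟶ 0) := by
      rw [DerivedCategory.isIso_iff]
      intro n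
      have h₁ : IsZero ((DerivedCategory.homologyFunctor A n).obj (DerivedCategory.Q.obj K)) :=
        ((K.exactAt_iff_isZero_homology n).1 (h n)).of_iso
          ((DerivedCategory.homologyFunctorFactors A n).app K)
      have h₂ : IsZero ((DerivedCategory.homologyFunctor A n).obj 0) :=
        (DerivedCategory.homologyFunctor A n).map_isZero (isZero_zero _)
      exact ⟨0, h₁.eq_of_src _ _, h₂.eq_of_src _ _⟩
    exact (isZero_zero _).of_iso (asIso (0 : DerivedCategory.Q.obj K ⟶ 0))
  · intro h n
    rw [HomologicalComplex.exactAt_iff_isZero_homology]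
    exact ((DerivedCategory.homologyFunctor A n).map_isZero h).of_iso
      ((DerivedCategory.homologyFunctorFactors A n).app K).symm

lemma quasiIso_iff_acyclic_mappingCone {K L : CochainComplex A ℤ} (f : K ⟶ L) :
    QuasiIso f ↔ (CochainComplex.mappingCone f).Acyclic := by
  let := HasDerivedCategory.standard A
  rw [← DerivedCategory.isIso_Q_map_iff_quasiIso, acyclic_iff_isZero_Q_obj]
  exact (Triangle.isZero₃_iff_isIso₁ _
    (DerivedCategory.mappingCone_triangle_distinguished f)).symm

lemma acyclic_mappingCocone_id (K : CochainComplex A ℤ) :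
    (CochainComplex.mappingCocone (𝟙 K)).Acyclic := by
  let := HasDerivedCategory.standard A
  rw [acyclic_iff_isZero_Q_obj]
  refine (Triangle.isZero₁_iff_isIso₂ _
    (DerivedCategory.mappingCocone_triangle_distinguished (𝟙 K))).2 ?_
  show IsIso (DerivedCategory.Q.map (𝟙 K))
  infer_instance

lemma quasiIso_of_acyclic_X₃ {S : ShortComplex (CochainComplex A ℤ)} (hS : S.ShortExact)
    (h : S.X₃.Acyclic) : QuasiIso S.f := by
  let := HasDerivedCategory.standard A
  rw [← DerivedCategory.isIso_Q_map_iff_quasiIso]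
  rw [acyclic_iff_isZero_Q_obj] at h
  exact (Triangle.isZero₃_iff_isIso₁ _ (DerivedCategory.triangleOfSES_distinguished hS)).1 h

end Acyclic

/-! ### Mapping cocones of short exact sequences -/

section Cocone

open CochainComplex HomComplex

variable {A : Type u} [Category.{v} A] [Abelian A]

lemma mappingCocone_hom_ext {K L : CochainComplex A ℤ} (φ : K ⟶ L) {Z : A} (p q : ℤ)
    (hpq : p + -1 = q) {f g : Z ⟶ (mappingCocone φ).X p}
    (h₁ : f ≫ (mappingCocone.fst φ).f p = g ≫ (mappingCocone.fst φ).f p)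
    (h₂ : f ≫ (mappingCocone.snd φ).v p q hpq = g ≫ (mappingCocone.snd φ).v p q hpq) :
    f = g := by
  rw [← comp_id f, ← comp_id g, ← mappingCocone.id_X φ p q hpq, Preadditive.comp_add,
    Preadditive.comp_add, reassoc_of% h₁, reassoc_of% h₂]

lemma mappingCocone_hom_ext_from {K L : CochainComplex A ℤ} (φ : K ⟶ L) {Z : A} (p q : ℤ)
    (hpq : p + -1 = q) {f g : (mappingCocone φ).X p ⟶ Z}
    (h₁ : (mappingCocone.inl φ).v p p (add_zero p) ≫ f =
      (mappingCocone.inl φ).v p p (add_zero p) ≫ g)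
    (h₂ : (mappingCocone.inr φ).1.v q p (by lia) ≫ f =
      (mappingCocone.inr φ).1.v q p (by lia) ≫ g) :
    f = g := by
  rw [← id_comp f, ← id_comp g, ← mappingCocone.id_X φ p q hpq, Preadditive.add_comp,
    Preadditive.add_comp, assoc, assoc, assoc, assoc, h₁, h₂]

/-- This is the cocycle condition that lets `fst ≫ φ` and `snd` together define a morphism to the
cocone of the identity. -/
lemma mappingCocone_δ_snd {K L : CochainComplex A ℤ} (φ : K ⟶ L) :
    δ (-1) 0 (mappingCocone.snd φ) = -Cochain.ofHom (mappingCocone.fst φ ≫ φ) := by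
  have h : mappingCocone.snd φ =
      mappingCocone.descCochain φ (0 : Cochain K L (-1)) (Cochain.ofHom (𝟙 L)) (by lia) := by
    ext p q hpq
    apply mappingCocone_hom_ext_from φ p q hpq
    · simp
    · simp
  rw [h, mappingCocone.δ_descCochain _ _ _ _ 1 (by lia)]
  simp [Cochain.ofHom_comp]

/-- If `0 ⟶ N ⟶ E ⟶ C ⟶ 0` is a short exact sequence of complexes, the morphism from `N` to the
mapping cocone of `E ⟶ C` is a quasi-isomorphism. -/
lemma quasiIso_lift_mappingCocone {S : ShortComplex (CochainComplex A ℤ)} (hS : S.ShortExact) :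
    QuasiIso (mappingCocone.lift S.g S.f 0 (by simp)) := by
  have := hS.mono_f
  have := hS.epi_g
  set t := mappingCocone.lift S.g S.f 0 (by simp) with ht
  -- `ρ` applies `S.g` on the first summand and the identity on the second. It is onto with kernel
  -- `t`, so `t` is the first map of a short exact sequence whose last term, the cocone of an
  -- identity, is acyclic.
  let ρ : mappingCocone S.g ⟶ mappingCocone (𝟙 S.X₃) :=
    mappingCocone.lift _ (mappingCocone.fst S.g ≫ S.g) (mappingCocone.snd S.g)
      (by rw [mappingCocone_δ_snd]; simp)
  have htf : ∀ n, t.f n ≫ (mappingCocone.fst S.g).f n = S.f.f n := fun n => by simp [t]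
  have hts : ∀ p q hpq, t.f p ≫ (mappingCocone.snd S.g).v p q hpq = 0 :=
    fun p q hpq => by simp [t]
  have hρf : ∀ n, ρ.f n ≫ (mappingCocone.fst (𝟙 S.X₃)).f n =
      (mappingCocone.fst S.g).f n ≫ S.g.f n := fun n => by simp [ρ]
  have hρs : ∀ p q hpq, ρ.f p ≫ (mappingCocone.snd (𝟙 S.X₃)).v p q hpq =
      (mappingCocone.snd S.g).v p q hpq := fun p q hpq => by simp [ρ]
  have w : t ≫ ρ = 0 := by
    ext n
    obtain ⟨q, hq⟩ : ∃ q, n + -1 = q := ⟨_, rfl⟩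
    apply mappingCocone_hom_ext _ n q hq
    · rw [HomologicalComplex.comp_f, assoc, hρf, reassoc_of% htf,
        ← HomologicalComplex.comp_f, S.zero]
      simp
    · rw [HomologicalComplex.comp_f, assoc, hρs, hts]
      simp
  have hT : (ShortComplex.mk t ρ w).ShortExact := by
    apply HomologicalComplex.shortExact_of_degreewise_shortExact
    intro n
    obtain ⟨q, hq⟩ : ∃ q, n + -1 = q := ⟨_, rfl⟩
    have hq' : q + 1 = n := by omega
    have : Mono (t.f n) := by
      have : Mono (t.f n ≫ (mappingCocone.fst S.g).f n) := by rw [htf]; infer_instance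
      exact mono_of_mono _ ((mappingCocone.fst S.g).f n)
    have : Epi (ρ.f n) := by
      have h₁ : (mappingCocone.inl S.g).v n n (add_zero n) ≫ ρ.f n =
          S.g.f n ≫ (mappingCocone.inl (𝟙 S.X₃)).v n n (add_zero n) := by
        apply mappingCocone_hom_ext _ n q hq
        · rw [assoc, hρf, mappingCocone.inl_v_fst_f_assoc, assoc, mappingCocone.inl_v_fst_f,
            comp_id]
        · rw [assoc, hρs, assoc, mappingCocone.inl_v_snd_v, mappingCocone.inl_v_snd_v, comp_zero]
      have h₂ : (mappingCocone.inr S.g).1.v q n hq' ≫ ρ.f n =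
          (mappingCocone.inr (𝟙 S.X₃)).1.v q n hq' := by
        apply mappingCocone_hom_ext _ n q hq
        · rw [assoc, hρf, mappingCocone.inr_v_fst_f_assoc, mappingCocone.inr_v_fst_f, zero_comp]
        · rw [assoc, hρs, mappingCocone.inr_v_snd_v, mappingCocone.inr_v_snd_v]
      apply Preadditive.epi_of_cancel_zero
      intro Z g hg
      apply mappingCocone_hom_ext_from _ n q hq
      · rw [← cancel_epi (S.g.f n), ← reassoc_of% h₁, hg]
        simp
      · rw [← h₂, assoc, hg]
        simp
    have hSn := hS.map_of_exact (HomologicalComplex.eval A (ComplexShape.up ℤ) n)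
    -- A generalized element killed by `ρ` has zero second component and first component in the
    -- kernel of `S.g`, hence comes from `S.X₁`.
    have key : ∀ {Z : A} (k : Z ⟶ (mappingCocone S.g).X n), k ≫ ρ.f n = 0 →
        { l : Z ⟶ S.X₁.X n // l ≫ t.f n = k } := by
      intro Z k hk
      have hk₁ : (k ≫ (mappingCocone.fst S.g).f n) ≫ S.g.f n = 0 := by
        rw [assoc, ← hρf, reassoc_of% hk, zero_comp]
      have hk₂ : k ≫ (mappingCocone.snd S.g).v n q hq = 0 := by
        rw [← hρs, reassoc_of% hk, zero_comp]
      have := hSn.mono_f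
      let l : Z ⟶ S.X₁.X n := hSn.exact.lift _ hk₁
      have hl : l ≫ S.f.f n = k ≫ (mappingCocone.fst S.g).f n := hSn.exact.lift_f _ hk₁
      refine ⟨l, ?_⟩
      apply mappingCocone_hom_ext _ n q hq
      · rw [assoc, htf, hl]
      · rw [assoc, hk₂, hts, comp_zero]
    have : Mono ((ShortComplex.mk t ρ w).map (HomologicalComplex.eval A (ComplexShape.up ℤ) n)).f :=
      ‹Mono (t.f n)›
    exact ShortComplex.ShortExact.mk' (ShortComplex.exact_of_f_is_kernel _
      (KernelFork.IsLimit.ofι' _ _ key)) ‹Mono (t.f n)› ‹Epi (ρ.f n)›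
  exact quasiIso_of_acyclic_X₃ hT (acyclic_mappingCocone_id _)

end Cocone

/-! ### Adapted classes and resolutions for functors of dimension at most one -/

section Adapted

variable {A : Type u₁} [Category.{v₁} A] [Abelian A]
  {B : Type u₂} [Category.{v₂} B] [Abelian B]

/-- A class of objects which suffices in order to compute the right derived functor of a left
exact functor `G` of cohomological dimension at most one. -/
structure IsRightAdapted (G : A ⥤ B) (P : ObjectProperty A) : Prop where
  of_injective (I : A) [Injective I] : P I
  of_epi {M N : A} (f : M ⟶ N) [hf : Epi f] (hM : P M) : P N
  biprod {M N : A} (hM : P M) (hN : P N) : P (M ⊞ N)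
  epi_map {S : ShortComplex A} (hS : S.ShortExact) (h : P S.X₁) : Epi (G.map S.g)

/-- A class of objects which suffices in order to compute the left derived functor of a right
exact functor `G` of homological dimension at most one. -/
structure IsLeftAdapted (G : A ⥤ B) (P : ObjectProperty A) : Prop where
  of_projective (I : A) [Projective I] : P I
  of_mono {M N : A} (f : M ⟶ N) [hf : Mono f] (hN : P N) : P M
  biprod {M N : A} (hM : P M) (hN : P N) : P (M ⊞ N)
  mono_map {S : ShortComplex A} (hS : S.ShortExact) (h : P S.X₃) : Mono (G.map S.f)

namespace IsRightAdapted

variable {G : A ⥤ B} {P : ObjectProperty A}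

lemma of_iso (hP : IsRightAdapted G P) {M N : A} (e : M ≅ N) (hM : P M) : P N := hP.of_epi e.hom hM

variable [G.Additive]

/-- Split `S` at `kernel S.g`. Left exactness handles `0 → ker g → X₂ → X₃`, and `epi_map` applied
to `0 → ker f → X₁ → ker g → 0` keeps the remaining map epi. -/
lemma exact_map (hP : IsRightAdapted G P) [PreservesFiniteLimits G]
    {S : ShortComplex A} (hS : S.Exact)
    (h : P (kernel S.f)) : (S.map G).Exact := by
  have : Epi (kernel.lift S.g S.f S.zero) := (S.exact_iff_epi_kernel_lift).1 hS
  let T : ShortComplex A := ShortComplex.mk (kernel.ι S.g) S.g (kernel.condition _)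
  have hT : T.Exact := T.exact_of_f_is_kernel (kernelIsKernel S.g)
  let U : ShortComplex A := ShortComplex.mk (kernel.ι S.f) (kernel.lift S.g S.f S.zero) (by
    rw [← cancel_mono (kernel.ι S.g)]; simp)
  have hU : U.ShortExact := by
    refine ShortComplex.ShortExact.mk' ?_ (by dsimp [U]; infer_instance) this
    have : Mono U.f := by dsimp [U]; infer_instance
    refine U.exact_of_f_is_kernel (KernelFork.IsLimit.ofι' _ _ (fun {Z} k hk =>
      ⟨kernel.lift S.f k ?_, kernel.lift_ι _ _ _⟩))
    have h := hk =≫ kernel.ι S.g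
    rwa [assoc, zero_comp, kernel.lift_ι] at h
  have hepi : Epi (G.map (kernel.lift S.g S.f S.zero)) := hP.epi_map hU h
  have hTG : (T.map G).Exact := hT.map_of_mono_of_preservesKernel G
    (by dsimp [T]; infer_instance) inferInstance
  let ψ : S ⟶ T :=
    { τ₁ := kernel.lift S.g S.f S.zero
      τ₂ := 𝟙 S.X₂
      τ₃ := 𝟙 S.X₃
      comm₁₂ := (kernel.lift_ι _ _ _).trans (comp_id _).symm
      comm₂₃ := (id_comp _).trans (comp_id _).symm }
  let φ : S.map G ⟶ T.map G := G.mapShortComplex.map ψ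
  have : Epi φ.τ₁ := hepi
  have : IsIso φ.τ₂ := inferInstanceAs (IsIso (G.map (𝟙 S.X₂)))
  have : Mono φ.τ₃ := inferInstanceAs (Mono (G.map (𝟙 S.X₃)))
  exact (ShortComplex.exact_iff_of_epi_of_isIso_of_mono φ).2 hTG

/-- Exactness one degree lower presents the cycles in degree `n - 1` as a quotient of `K.X (n - 1 -
1)`, so they are adapted. No induction on degrees occurs, hence no boundedness is needed. -/
lemma acyclic_map (hP : IsRightAdapted G P) [PreservesFiniteLimits G]
    {K : CochainComplex A ℤ} (hK : K.Acyclic)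
    (h : ∀ n, P (K.X n)) :
    ((G.mapHomologicalComplex (ComplexShape.up ℤ)).obj K).Acyclic := by
  intro n
  have h₁ := hK n
  have h₂ := hK (n - 1)
  rw [HomologicalComplex.exactAt_iff' _ (n - 1) n (n + 1) (by simp) (by simp)] at h₁ ⊢
  rw [HomologicalComplex.exactAt_iff' _ (n - 1 - 1) (n - 1) n (by simp) (by simp)] at h₂
  have : Epi (kernel.lift _ _ (K.sc' (n - 1 - 1) (n - 1) n).zero) :=
    (ShortComplex.exact_iff_epi_kernel_lift _).1 h₂
  exact hP.exact_map h₁ (hP.of_epi (hf := this) _ (h _))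

/-- The cone has terms `K.X (n + 1) ⊞ L.X n`, which are again adapted, and `G` commutes with cones.
-/
lemma quasiIso_map (hP : IsRightAdapted G P) [PreservesFiniteLimits G]
    {K L : CochainComplex A ℤ} (f : K ⟶ L)
    (hf : QuasiIso f) (hK : ∀ n, P (K.X n)) (hL : ∀ n, P (L.X n)) :
    QuasiIso ((G.mapHomologicalComplex (ComplexShape.up ℤ)).map f) := by
  rw [quasiIso_iff_acyclic_mappingCone] at hf ⊢
  have h := hP.acyclic_map hf (fun n => hP.of_iso
    (HomologicalComplex.homotopyCofiber.XIsoBiprod f n (n + 1) rfl).symm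
      (hP.biprod (hK (n + 1)) (hL n)))
  exact fun n => (h n).of_iso (CochainComplex.mappingCone.mapHomologicalComplexIso f G)

/-- Embed `N` in a contractible complex `E` of injectives with quotient `C`. The cocone of `E → C`
resolves `N`, and its terms are sums of an injective and a quotient of an injective. Closure under
quotients is what lets the resolution stop here. -/
lemma exists_resolution (hP : IsRightAdapted G P) [EnoughInjectives A] (N : CochainComplex A ℤ) :
    ∃ (N' : CochainComplex A ℤ) (t : N ⟶ N'), QuasiIso t ∧ ∀ n, P (N'.X n) := by
  let E := CochainComplex.mappingCone (𝟙 (CochainComplex.cm5b.I N))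
  let a : N ⟶ E := CochainComplex.cm5b.i (0 : N ⟶ N) ≫ biprod.fst
  have : Mono a := by
    have : ∀ n, Mono (a.f n) := fun n => by
      have h : a.f n ≫
          (CochainComplex.mappingCone.snd (𝟙 (CochainComplex.cm5b.I N))).v n n (add_zero n) =
            Injective.ι (N.X n) := by
        rw [← CochainComplex.cm5b.i_f_comp (0 : N ⟶ N) n, HomologicalComplex.comp_f, assoc]
      have : Mono (a.f n ≫ (CochainComplex.mappingCone.snd
          (𝟙 (CochainComplex.cm5b.I N))).v n n (add_zero n)) := by
        rw [h]
        exact inferInstanceAs (Mono (Injective.ι _))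
      exact mono_of_mono (a.f n) ((CochainComplex.mappingCone.snd
        (𝟙 (CochainComplex.cm5b.I N))).v n n (add_zero n))
    exact HomologicalComplex.mono_of_mono_f a this
  let S : ShortComplex (CochainComplex A ℤ) := ShortComplex.mk a (cokernel.π a)
    (cokernel.condition a)
  have hS : S.ShortExact := ShortComplex.ShortExact.mk'
    (S.exact_of_g_is_cokernel (cokernelIsCokernel a)) this (by dsimp [S]; infer_instance)
  refine ⟨_, _, quasiIso_lift_mappingCocone hS, fun n => ?_⟩
  have hE : ∀ n, P (E.X n) := fun n => hP.of_injective _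
  have hC : ∀ n, P (S.X₃.X n) := fun n => by
    have : Epi (S.g.f n) := by have := hS.epi_g; infer_instance
    exact hP.of_epi (S.g.f n) (hE n)
  exact hP.of_iso (HomologicalComplex.homotopyCofiber.XIsoBiprod S.g (n + -1) (n + -1 + 1) rfl).symm
      (hP.biprod (by rw [neg_add_cancel_right]; exact hE _) (hC _))

/-- The unit is invertible as `F` is fully faithful, so the adjunct of `t ≫ t'` is, up to
isomorphism, `G` applied to a quasi-isomorphism between adapted complexes. -/
lemma fullyFaithful_mapDerivedCategory (hP : IsRightAdapted G P) [EnoughInjectives A]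
    [HasDerivedCategory.{w₁} A] [HasDerivedCategory.{w₂} B]
    {F : B ⥤ A} [F.Additive] [PreservesFiniteLimits F] [PreservesFiniteColimits F]
    [F.Full] [F.Faithful] (adj : F ⊣ G) (hF : ∀ W, P (F.obj W)) :
    F.mapDerivedCategory.Full ∧ F.mapDerivedCategory.Faithful := by
  refine fullyFaithful_mapDerivedCategory_of_rightAdjoint adj (fun W N t ht => ?_)
  obtain ⟨N', t', ht', hN'⟩ := hP.exists_resolution N
  refine ⟨N', t', ht', ?_⟩
  have : PreservesLimitsOfSize.{0, 0} G := adj.rightAdjoint_preservesLimits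
  have : PreservesFiniteLimits G := inferInstance
  rw [Adjunction.homEquiv_unit]
  have := hP.quasiIso_map (t ≫ t') inferInstance (fun n => hF _) hN'
  have : IsIso ((mapComplexAdjunction adj).unit.app W) := by
    have : ∀ n, IsIso (((mapComplexAdjunction adj).unit.app W).f n) := fun n =>
      inferInstanceAs (IsIso (adj.unit.app (W.X n)))
    exact HomologicalComplex.Hom.isIso_of_components _
  infer_instance

end IsRightAdapted

namespace IsLeftAdapted

variable {G : A ⥤ B} {P : ObjectProperty A}

lemma of_iso (hP : IsLeftAdapted G P) {M N : A} (e : M ≅ N) (hM : P M) : P N := hP.of_mono e.inv hM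

variable [G.Additive]

lemma exact_map (hP : IsLeftAdapted G P) [PreservesFiniteColimits G]
    {S : ShortComplex A} (hS : S.Exact)
    (h : P (cokernel S.g)) : (S.map G).Exact := by
  have : Mono (cokernel.desc S.f S.g S.zero) := (S.exact_iff_mono_cokernel_desc).1 hS
  let T : ShortComplex A := ShortComplex.mk S.f (cokernel.π S.f) (cokernel.condition _)
  have hT : T.Exact := T.exact_of_g_is_cokernel (cokernelIsCokernel S.f)
  let U : ShortComplex A := ShortComplex.mk (cokernel.desc S.f S.g S.zero) (cokernel.π S.g) (by
    rw [← cancel_epi (cokernel.π S.f)]; simp)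
  have hU : U.ShortExact := by
    refine ShortComplex.ShortExact.mk' ?_ this (by dsimp [U]; infer_instance)
    have : Epi U.g := by dsimp [U]; infer_instance
    refine U.exact_of_g_is_cokernel (CokernelCofork.IsColimit.ofπ' _ _ (fun {Z} k hk =>
      ⟨cokernel.desc S.g k ?_, cokernel.π_desc _ _ _⟩))
    have h := cokernel.π S.f ≫= hk
    rwa [comp_zero, cokernel.π_desc_assoc] at h
  have hmono : Mono (G.map (cokernel.desc S.f S.g S.zero)) := hP.mono_map hU h
  have hTG : (T.map G).Exact := hT.map_of_epi_of_preservesCokernel G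
    (by dsimp [T]; infer_instance) inferInstance
  let ψ : T ⟶ S :=
    { τ₁ := 𝟙 S.X₁
      τ₂ := 𝟙 S.X₂
      τ₃ := cokernel.desc S.f S.g S.zero
      comm₁₂ := (id_comp _).trans (comp_id _).symm
      comm₂₃ := (id_comp _).trans (cokernel.π_desc _ _ _).symm }
  let φ : T.map G ⟶ S.map G := G.mapShortComplex.map ψ
  have : Epi φ.τ₁ := inferInstanceAs (Epi (G.map (𝟙 S.X₁)))
  have : IsIso φ.τ₂ := inferInstanceAs (IsIso (G.map (𝟙 S.X₂)))
  have : Mono φ.τ₃ := hmono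
  exact (ShortComplex.exact_iff_of_epi_of_isIso_of_mono φ).1 hTG

lemma acyclic_map (hP : IsLeftAdapted G P) [PreservesFiniteColimits G]
    {K : CochainComplex A ℤ} (hK : K.Acyclic)
    (h : ∀ n, P (K.X n)) :
    ((G.mapHomologicalComplex (ComplexShape.up ℤ)).obj K).Acyclic := by
  intro n
  have h₁ := hK n
  have h₂ := hK (n + 1)
  rw [HomologicalComplex.exactAt_iff' _ (n - 1) n (n + 1) (by simp) (by simp)] at h₁ ⊢
  rw [HomologicalComplex.exactAt_iff' _ n (n + 1) (n + 1 + 1) (by simp) (by simp)] at h₂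
  have : Mono (cokernel.desc _ _ (K.sc' n (n + 1) (n + 1 + 1)).zero) :=
    (ShortComplex.exact_iff_mono_cokernel_desc _).1 h₂
  exact hP.exact_map h₁ (hP.of_mono (hf := this) _ (h _))

lemma quasiIso_map (hP : IsLeftAdapted G P) [PreservesFiniteColimits G]
    {K L : CochainComplex A ℤ} (f : K ⟶ L)
    (hf : QuasiIso f) (hK : ∀ n, P (K.X n)) (hL : ∀ n, P (L.X n)) :
    QuasiIso ((G.mapHomologicalComplex (ComplexShape.up ℤ)).map f) := by
  rw [quasiIso_iff_acyclic_mappingCone] at hf ⊢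
  have h := hP.acyclic_map hf (fun n => hP.of_iso
    (HomologicalComplex.homotopyCofiber.XIsoBiprod f n (n + 1) rfl).symm
      (hP.biprod (hK (n + 1)) (hL n)))
  exact fun n => (h n).of_iso (CochainComplex.mappingCone.mapHomologicalComplexIso f G)

/-- Any complex is a quotient of a contractible complex of projective objects. -/
lemma exists_epi_from_mappingCone_id [EnoughProjectives A] (N : CochainComplex A ℤ) :
    ∃ (J : CochainComplex A ℤ) (a : CochainComplex.mappingCone (𝟙 J) ⟶ N),
      (∀ n, Projective (J.X n)) ∧ Epi a := by
  -- `J` has zero differential and carries in degree `n` a projective cover-up of `N.X (n - 1)`.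
  -- These epimorphisms form a cochain `α` of degree `-1`, and the pair `α`, `δ α` descends to the
  -- cone of the identity. The resulting map is epi since its restriction along `inl` already is.
  let J : CochainComplex A ℤ :=
    { X n := Projective.over (N.X (n + -1))
      d _ _ := 0
      shape _ _ _ := rfl
      d_comp_d' _ _ _ _ _ := zero_comp }
  let α : CochainComplex.HomComplex.Cochain J N (-1) :=
    CochainComplex.HomComplex.Cochain.mk
      (fun p q hpq => Projective.π _ ≫ (N.XIsoOfEq hpq).hom)
  let z : CochainComplex.HomComplex.Cocycle J N 0 :=
    CochainComplex.HomComplex.Cocycle.mk (CochainComplex.HomComplex.δ (-1) 0 α) 1 (by simp)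
      (CochainComplex.HomComplex.δ_δ _ _ _ _)
  let a : CochainComplex.mappingCone (𝟙 J) ⟶ N :=
    CochainComplex.mappingCone.desc _ α z.homOf (by simp [z])
  refine ⟨J, a, fun n => Projective.projective_over _, ?_⟩
  have : ∀ n, Epi (a.f n) := fun n => by
    have h : (CochainComplex.mappingCone.inl (𝟙 J)).v (n + 1) n (by omega) ≫ a.f n =
        α.v (n + 1) n (by omega) := by simp [a]
    have : Epi (α.v (n + 1) n (by omega)) := by
      dsimp [α]
      infer_instance
    exact epi_of_epi_fac h
  exact HomologicalComplex.epi_of_epi_f a this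

/-- Dually to the injective case, the cone of the kernel of an epimorphism from a contractible
complex of projectives resolves `N`. -/
lemma exists_resolution (hP : IsLeftAdapted G P) [EnoughProjectives A] (N : CochainComplex A ℤ) :
    ∃ (N' : CochainComplex A ℤ) (t : N' ⟶ N), QuasiIso t ∧ ∀ n, P (N'.X n) := by
  obtain ⟨J, a, hJ, ha⟩ := exists_epi_from_mappingCone_id N
  let S : ShortComplex (CochainComplex A ℤ) := ShortComplex.mk (kernel.ι a) a
    (kernel.condition a)
  have hS : S.ShortExact := ShortComplex.ShortExact.mk'
    (S.exact_of_f_is_kernel (kernelIsKernel a)) (by dsimp [S]; infer_instance) ha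
  refine ⟨_, _, CochainComplex.mappingCone.quasiIso_descShortComplex hS, fun n => ?_⟩
  have hE : ∀ n, P (S.X₂.X n) := fun n => hP.of_iso
    (HomologicalComplex.homotopyCofiber.XIsoBiprod (𝟙 J) n (n + 1) rfl).symm
      (hP.biprod (hP.of_projective _) (hP.of_projective _))
  have hC : ∀ n, P (S.X₁.X n) := fun n => by
    have : Mono (S.f.f n) := by have := hS.mono_f; infer_instance
    exact hP.of_mono (S.f.f n) (hE n)
  exact hP.of_iso (HomologicalComplex.homotopyCofiber.XIsoBiprod S.f n (n + 1) rfl).symm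
      (hP.biprod (hC _) (hE _))

lemma fullyFaithful_mapDerivedCategory (hP : IsLeftAdapted G P) [EnoughProjectives A]
    [HasDerivedCategory.{w₁} A] [HasDerivedCategory.{w₂} B]
    {F : B ⥤ A} [F.Additive] [PreservesFiniteLimits F] [PreservesFiniteColimits F]
    [F.Full] [F.Faithful] (adj : G ⊣ F) (hF : ∀ W, P (F.obj W)) :
    F.mapDerivedCategory.Full ∧ F.mapDerivedCategory.Faithful := by
  refine fullyFaithful_mapDerivedCategory_of_leftAdjoint adj (fun W N t ht => ?_)
  obtain ⟨N', t', ht', hN'⟩ := hP.exists_resolution N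
  refine ⟨N', t', ht', ?_⟩
  have : PreservesColimitsOfSize.{0, 0} G := adj.leftAdjoint_preservesColimits
  have : PreservesFiniteColimits G := inferInstance
  rw [Adjunction.homEquiv_counit]
  have := hP.quasiIso_map (t' ≫ t) inferInstance hN' (fun n => hF _)
  have : IsIso ((mapComplexAdjunction adj).counit.app W) := by
    have : ∀ n, IsIso (((mapComplexAdjunction adj).counit.app W).f n) := fun n =>
      inferInstanceAs (IsIso (adj.counit.app (W.X n)))
    exact HomologicalComplex.Hom.isIso_of_components _
  infer_instance

end IsLeftAdapted

end Adapted

/-! ### Effacing morphisms between an object in degree zero and a complex -/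

section Effaceable

open DerivedCategory

variable {B : Type u} [Category.{v} B] [Abelian B] [HasDerivedCategory.{w} B]

/-- Take the cycles in degree `0` of a representing complex: on `H^0` their inclusion is the
projection from cycles to homology. The dual below uses opcycles. -/
lemma exists_single_to_epi_homology (W : DerivedCategory B) :
    ∃ (Z : B) (φ : (singleFunctor B 0).obj Z ⟶ W), Epi ((homologyFunctor B 0).map φ) := by
  obtain ⟨K, ⟨e⟩⟩ : ∃ K : CochainComplex B ℤ, Nonempty (Q.obj K ≅ W) :=
    ⟨_, ⟨Q.objObjPreimageIso W⟩⟩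
  let j : (HomologicalComplex.single B (ComplexShape.up ℤ) 0).obj (K.cycles 0) ⟶ K :=
    HomologicalComplex.mkHomFromSingle (K.iCycles 0) (fun k _ => by simp)
  have hj : Epi (HomologicalComplex.homologyMap j 0) := by
    have h₁ : HomologicalComplex.cyclesMap j 0 =
        (HomologicalComplex.singleObjCyclesSelfIso (ComplexShape.up ℤ) 0 (K.cycles 0)).hom := by
      rw [← cancel_mono (K.iCycles 0)]
      simp [j, HomologicalComplex.singleObjCyclesSelfIso_hom]
    have : Epi (HomologicalComplex.homologyπ _ 0 ≫ HomologicalComplex.homologyMap j 0) := by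
      rw [HomologicalComplex.homologyπ_naturality, h₁]
      infer_instance
    exact epi_of_epi (HomologicalComplex.homologyπ _ 0) _
  have hQ : Epi ((homologyFunctor B 0).map (Q.map j)) := by
    exact ((MorphismProperty.epimorphisms B).arrow_mk_iso_iff
      (((Functor.mapArrowFunctor _ _).mapIso (homologyFunctorFactors B 0)).app (Arrow.mk j))).2 hj
  let ε : (singleFunctor B 0).obj (K.cycles 0) ≅
      Q.obj ((HomologicalComplex.single B (ComplexShape.up ℤ) 0).obj (K.cycles 0)) :=
    (singleFunctorIsoCompQ B 0).app _
  refine ⟨K.cycles 0, ε.hom ≫ Q.map j ≫ e.hom, ?_⟩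
  rw [Functor.map_comp, Functor.map_comp]
  infer_instance

lemma exists_to_single_mono_homology (W : DerivedCategory B) :
    ∃ (Z : B) (φ : W ⟶ (singleFunctor B 0).obj Z), Mono ((homologyFunctor B 0).map φ) := by
  obtain ⟨K, ⟨e⟩⟩ : ∃ K : CochainComplex B ℤ, Nonempty (Q.obj K ≅ W) :=
    ⟨_, ⟨Q.objObjPreimageIso W⟩⟩
  let j : K ⟶ (HomologicalComplex.single B (ComplexShape.up ℤ) 0).obj (K.opcycles 0) :=
    HomologicalComplex.mkHomToSingle (K.pOpcycles 0) (fun k _ => by simp)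
  have hj : Mono (HomologicalComplex.homologyMap j 0) := by
    have h₁ : HomologicalComplex.opcyclesMap j 0 =
        (HomologicalComplex.singleObjOpcyclesSelfIso (ComplexShape.up ℤ) 0 (K.opcycles 0)).hom := by
      rw [← cancel_epi (K.pOpcycles 0)]
      simp [j, HomologicalComplex.singleObjOpcyclesSelfIso_hom]
    have : Mono (HomologicalComplex.homologyMap j 0 ≫ HomologicalComplex.homologyι _ 0) := by
      rw [HomologicalComplex.homologyι_naturality, h₁]
      infer_instance
    exact mono_of_mono _ (HomologicalComplex.homologyι _ 0)
  have hQ : Mono ((homologyFunctor B 0).map (Q.map j)) := by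
    exact ((MorphismProperty.monomorphisms B).arrow_mk_iso_iff
      (((Functor.mapArrowFunctor _ _).mapIso (homologyFunctorFactors B 0)).app (Arrow.mk j))).2 hj
  let ε : (singleFunctor B 0).obj (K.opcycles 0) ≅
      Q.obj ((HomologicalComplex.single B (ComplexShape.up ℤ) 0).obj (K.opcycles 0)) :=
    (singleFunctorIsoCompQ B 0).app _
  refine ⟨K.opcycles 0, e.inv ≫ Q.map j ≫ ε.inv, ?_⟩
  rw [Functor.map_comp, Functor.map_comp]
  infer_instance

lemma epi_of_epi_homology_map_single {Z T : B} (p : Z ⟶ T)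
    (hp : Epi ((homologyFunctor B 0).map ((singleFunctor B 0).map p))) : Epi p := by
  have h : p = (singleFunctorCompHomologyFunctorIso B 0).inv.app Z ≫
      (homologyFunctor B 0).map ((singleFunctor B 0).map p) ≫
        (singleFunctorCompHomologyFunctorIso B 0).hom.app T :=
    (NatIso.naturality_1 (singleFunctorCompHomologyFunctorIso B 0) p).symm
  rw [h]
  infer_instance

lemma mono_of_mono_homology_map_single {Z T : B} (p : Z ⟶ T)
    (hp : Mono ((homologyFunctor B 0).map ((singleFunctor B 0).map p))) : Mono p := by
  have h : p = (singleFunctorCompHomologyFunctorIso B 0).inv.app Z ≫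
      (homologyFunctor B 0).map ((singleFunctor B 0).map p) ≫
        (singleFunctorCompHomologyFunctorIso B 0).hom.app T :=
    (NatIso.naturality_1 (singleFunctorCompHomologyFunctorIso B 0) p).symm
  rw [h]
  infer_instance

/-- This is the effaceability of higher Yoneda extensions. In a triangle `C → T → W`, the vanishing
of `H^0(W)` makes `H^0(C) → T` epi; a map to `C` from an object in degree `0` that is epi on `H^0`
then composes to the required `p`. -/
lemma exists_epi_comp_eq_zero {T : B} {W : DerivedCategory B} (hW : W.IsLE (-1))
    (f : (singleFunctor B 0).obj T ⟶ W) :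
    ∃ (T' : B) (p : T' ⟶ T), Epi p ∧ (singleFunctor B 0).map p ≫ f = 0 := by
  obtain ⟨C, c, h, hT⟩ := distinguished_cocone_triangle₁ f
  obtain ⟨Z, φ, hφ⟩ := exists_single_to_epi_homology C
  have h₁ : (homologyFunctor B 0).map f = 0 := (isZero_of_isLE W (-1) 0 (by lia)).eq_of_tgt _ _
  have h₂ : Epi ((homologyFunctor B 0).map c) :=
    (HomologySequence.epi_homologyMap_mor₁_iff _ hT 0).2 h₁
  obtain ⟨p, hp⟩ := (singleFunctor B 0).map_surjective (φ ≫ c)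
  refine ⟨Z, p, epi_of_epi_homology_map_single p ?_, ?_⟩
  · rw [hp, Functor.map_comp]
    infer_instance
  · rw [hp, assoc]
    exact (φ ≫= comp_distTriang_mor_zero₁₂ _ hT).trans comp_zero

lemma exists_mono_comp_eq_zero {T : B} {W : DerivedCategory B} (hW : W.IsGE 1)
    (f : W ⟶ (singleFunctor B 0).obj T) :
    ∃ (T' : B) (p : T ⟶ T'), Mono p ∧ f ≫ (singleFunctor B 0).map p = 0 := by
  obtain ⟨C, c, h, hT⟩ := distinguished_cocone_triangle f
  obtain ⟨Z, φ, hφ⟩ := exists_to_single_mono_homology C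
  have h₁ : (homologyFunctor B 0).map f = 0 := (isZero_of_isGE W 1 0 (by lia)).eq_of_src _ _
  have h₂ : Mono ((homologyFunctor B 0).map c) :=
    (HomologySequence.mono_homologyMap_mor₂_iff _ hT 0).2 h₁
  obtain ⟨p, hp⟩ := (singleFunctor B 0).map_surjective (c ≫ φ)
  refine ⟨Z, p, mono_of_mono_homology_map_single p ?_, ?_⟩
  · rw [hp, Functor.map_comp]
    infer_instance
  · rw [hp]
    exact (comp_distTriang_mor_zero₁₂_assoc _ hT _).trans zero_comp

end Effaceable

/-! ### Dévissage of bounded complexes to objects in degree zero -/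

section Bounded

open DerivedCategory

variable {B : Type u} [Category.{v} B] [Abelian B] [HasDerivedCategory.{w} B]

lemma bounded_of_isGE_of_isLE (U : DerivedCategory B) (a b : ℤ) (hU : U.IsGE a) (hU' : U.IsLE b) :
    TStructure.t.bounded U :=
  ⟨⟨a, hU⟩, ⟨b, hU'⟩⟩

lemma bounded_single (M : B) (n : ℤ) : TStructure.t.bounded ((singleFunctor B n).obj M) :=
  bounded_of_isGE_of_isLE _ n n inferInstance inferInstance

/-- A triangulated subcategory which contains the complexes concentrated in degree `0` contains
all the bounded complexes. -/
lemma prop_of_bounded (P : ObjectProperty (DerivedCategory B)) [P.IsTriangulated]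
    [P.IsClosedUnderIsomorphisms] (h : ∀ M : B, P ((singleFunctor B 0).obj M))
    {V : DerivedCategory B} (hV : TStructure.t.bounded V) : P V := by
  -- Induction on the length of the cohomological interval `[a, a + d]`; truncation splits off the
  -- lowest cohomology.
  have key : ∀ (d : ℕ) (a : ℤ) (V : DerivedCategory B), V.IsGE a → V.IsLE (a + d) → P V := by
    intro d
    induction d with
    | zero =>
      intro a V _ hV
      rw [Nat.cast_zero, add_zero] at hV
      obtain ⟨M, ⟨e⟩⟩ := exists_iso_singleFunctor_obj_of_isGE_of_isLE V a
      have e' : V⟦a⟧ ≅ (singleFunctor B 0).obj M :=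
        (shiftFunctor _ a).mapIso e ≪≫
          ((singleFunctors B).shiftIso a 0 a (add_zero a)).app M
      have := P.le_shift (-a) _ (P.prop_of_iso e'.symm (h M))
      exact P.prop_of_iso (shiftShiftNeg V a) this
    | succ d hd =>
      intro a V _ hV
      have hT := TStructure.t.triangleLEGT_distinguished a V
      refine P.ext_of_isTriangulatedClosed₂ _ hT ?_ ?_
      · refine hd a _ ?_ ?_
        · exact inferInstanceAs (TStructure.t.IsGE ((TStructure.t.truncLE a).obj V) a)
        · exact TStructure.t.isLE_truncLE_obj V a _ (by lia)
      · refine hd (a + 1) _ ?_ ?_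
        · exact inferInstanceAs (TStructure.t.IsGE ((TStructure.t.truncGT a).obj V) (a + 1))
        · rw [show a + 1 + (d : ℤ) = a + ((d + 1 : ℕ) : ℤ) by push_cast; ring]
          exact inferInstanceAs (TStructure.t.IsLE ((TStructure.t.truncGT a).obj V) _)
  obtain ⟨⟨a, ha⟩, ⟨b, hb⟩⟩ := hV
  exact key (b - a).toNat a V ha (TStructure.t.isLE_of_le V b _ (by lia))

end Bounded

/-! ### Exact functors and homology -/

section ExactFunctor

open DerivedCategory

variable {A : Type u₁} [Category.{v₁} A] [Abelian A]
  {B : Type u₂} [Category.{v₂} B] [Abelian B]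
  [HasDerivedCategory.{w₁} A] [HasDerivedCategory.{w₂} B]
  (F : B ⥤ A) [F.Additive] [PreservesFiniteLimits F] [PreservesFiniteColimits F]

lemma nonempty_homologyFunctor_mapDerivedCategory_iso (U : DerivedCategory B) (n : ℤ) :
    Nonempty ((homologyFunctor A n).obj (F.mapDerivedCategory.obj U) ≅
      F.obj ((homologyFunctor B n).obj U)) := by
  obtain ⟨K, ⟨e⟩⟩ : ∃ K : CochainComplex B ℤ, Nonempty (Q.obj K ≅ U) :=
    ⟨_, ⟨Q.objObjPreimageIso U⟩⟩
  have : F.PreservesHomology := inferInstance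
  exact ⟨(homologyFunctor A n).mapIso (F.mapDerivedCategory.mapIso e.symm ≪≫
    F.mapDerivedCategoryFactors.app K) ≪≫ (homologyFunctorFactors A n).app _ ≪≫
    (K.sc n).mapHomologyIso F ≪≫
    F.mapIso (((homologyFunctorFactors B n).app K).symm ≪≫ (homologyFunctor B n).mapIso e)⟩

lemma isZero_homologyFunctor_mapDerivedCategory_iff [F.Faithful] (U : DerivedCategory B) (n : ℤ) :
    IsZero ((homologyFunctor A n).obj (F.mapDerivedCategory.obj U)) ↔
      IsZero ((homologyFunctor B n).obj U) := by
  obtain ⟨e⟩ := nonempty_homologyFunctor_mapDerivedCategory_iso F U n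
  rw [e.isZero_iff]
  refine ⟨fun h => ?_, fun h => F.map_isZero h⟩
  rw [IsZero.iff_id_eq_zero] at h ⊢
  exact F.map_injective (by rw [F.map_id, h, F.map_zero])

end ExactFunctor

/-! ### Universal arrows from orthogonality in a triangle -/

section Triangles

variable {C : Type u} [Category.{v} C] [HasZeroObject C] [HasShift C ℤ] [Preadditive C]
  [∀ n : ℤ, (shiftFunctor C n).Additive] [Pretriangulated C]

/-- In the long exact sequence of `Hom(W, -)`, the two vanishing groups are the neighbours giving
surjectivity and injectivity respectively. -/
lemma bijective_comp_mor₁ {T : Triangle C} (hT : T ∈ distTriang C) {W : C}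
    (h₀ : ∀ f : W ⟶ T.obj₃, f = 0) (h₁ : ∀ f : W ⟶ T.obj₃⟦(-1 : ℤ)⟧, f = 0) :
    Function.Bijective (fun ψ : W ⟶ T.obj₁ => ψ ≫ T.mor₁) := by
  constructor
  · intro ψ₁ ψ₂ h
    obtain ⟨γ, hγ⟩ := Triangle.coyoneda_exact₂ _ (inv_rot_of_distTriang _ hT) (ψ₁ - ψ₂)
      ((Preadditive.sub_comp ..).trans (sub_eq_zero.2 h))
    have h₀ : γ = 0 := h₁ γ
    exact sub_eq_zero.1 (hγ.trans (by rw [h₀]; exact zero_comp))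
  · intro φ
    obtain ⟨ψ, hψ⟩ := Triangle.coyoneda_exact₂ _ hT φ (h₀ _)
    exact ⟨ψ, hψ.symm⟩

lemma bijective_mor₂_comp {T : Triangle C} (hT : T ∈ distTriang C) {W : C}
    (h₀ : ∀ f : T.obj₁ ⟶ W, f = 0) (h₁ : ∀ f : T.obj₁⟦(1 : ℤ)⟧ ⟶ W, f = 0) :
    Function.Bijective (fun ψ : T.obj₃ ⟶ W => T.mor₂ ≫ ψ) := by
  constructor
  · intro ψ₁ ψ₂ h
    obtain ⟨γ, hγ⟩ := Triangle.yoneda_exact₃ _ hT (ψ₁ - ψ₂)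
      ((Preadditive.comp_sub ..).trans (sub_eq_zero.2 h))
    rwa [h₁ γ, comp_zero, sub_eq_zero] at hγ
  · intro φ
    obtain ⟨ψ, hψ⟩ := Triangle.yoneda_exact₂ _ hT φ (h₀ _)
    exact ⟨ψ, hψ.symm⟩

end Triangles

/-! ### The bounded decomposition: orthogonality and amplitude -/

section Bounded

open DerivedCategory

variable {A : Type u} [Category.{v} A] [Abelian A] [HasDerivedCategory.{w} A]

/-- The functor between derived categories induced by the inclusion of an abelian subcategory. -/
abbrev derivedι (P : ObjectProperty A) [IsAbelianSubcategory P]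
    [HasDerivedCategory.{w₁} P.FullSubcategory] :
    DerivedCategory P.FullSubcategory ⥤ DerivedCategory A :=
  P.ι.mapDerivedCategory

/-- The image under `derivedι` of a complex concentrated in degree `0`. -/
abbrev derivedιSingle (P : ObjectProperty A) [IsAbelianSubcategory P]
    [HasDerivedCategory.{w₁} P.FullSubcategory] (M : P.FullSubcategory) :
    (derivedι P).obj ((singleFunctor P.FullSubcategory 0).obj M) ≅
      (singleFunctor A 0).obj M.obj :=
  (P.ι.mapDerivedCategorySingleFunctor 0).app M

lemma derivedιSingle_naturality (P : ObjectProperty A) [IsAbelianSubcategory P]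
    [HasDerivedCategory.{w₁} P.FullSubcategory] {M N : P.FullSubcategory} (f : M ⟶ N) :
    (derivedι P).map ((singleFunctor P.FullSubcategory 0).map f) ≫ (derivedιSingle P N).hom =
      (derivedιSingle P M).hom ≫ (singleFunctor A 0).map f.hom :=
  (P.ι.mapDerivedCategorySingleFunctor 0).hom.naturality f

lemma derivedιSingle_inv_naturality (P : ObjectProperty A) [IsAbelianSubcategory P]
    [HasDerivedCategory.{w₁} P.FullSubcategory] {M N : P.FullSubcategory} (f : M ⟶ N) :
    (derivedιSingle P M).inv ≫ (derivedι P).map ((singleFunctor P.FullSubcategory 0).map f) =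
      (singleFunctor A 0).map f.hom ≫ (derivedιSingle P N).inv :=
  ((P.ι.mapDerivedCategorySingleFunctor 0).inv.naturality f).symm

lemma homology_derivedι_obj (P : ObjectProperty A) [IsAbelianSubcategory P]
    [HasDerivedCategory.{w₁} P.FullSubcategory] (U : DerivedCategory P.FullSubcategory) (n : ℤ) :
    P ((homologyFunctor A n).obj ((derivedι P).obj U)) := by
  obtain ⟨e⟩ := nonempty_homologyFunctor_mapDerivedCategory_iso P.ι U n
  exact P.prop_of_iso e.symm (P.prop_ι_obj _)

variable {X Y : ObjectProperty A} [IsAbelianSubcategory X] [IsAbelianSubcategory Y]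
  [HasDerivedCategory.{w₁} X.FullSubcategory] [HasDerivedCategory.{w₂} Y.FullSubcategory]

lemma bijective_derivedι_map (P : ObjectProperty A) [IsAbelianSubcategory P]
    [HasDerivedCategory.{w₁} P.FullSubcategory]
    (h : (mapDStar P.ι .bounded).Full) (h' : (mapDStar P.ι .bounded).Faithful)
    {U V : DerivedCategory P.FullSubcategory} (hU : TStructure.t.bounded U)
    (hV : TStructure.t.bounded V) :
    Function.Bijective ((derivedι P).map : (U ⟶ V) → _) := by
  let U' : DStar P.FullSubcategory .bounded := ⟨U, hU⟩
  let V' : DStar P.FullSubcategory .bounded := ⟨V, hV⟩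
  constructor
  · intro f g hfg
    have : (ObjectProperty.homMk f : U' ⟶ V') = ObjectProperty.homMk g :=
      (mapDStar P.ι .bounded).map_injective (by ext; exact hfg)
    exact congr_arg InducedCategory.Hom.hom this
  · intro f
    obtain ⟨g, hg⟩ := (mapDStar P.ι .bounded).map_surjective
      (X := U') (Y := V') (ObjectProperty.homMk f)
    exact ⟨g.hom, (dProp A .bounded).ι.congr_map hg⟩

namespace IsDDecomposition

lemma bijective_left (h : IsDDecomposition X Y .bounded)
    {U V : DerivedCategory X.FullSubcategory} (hU : TStructure.t.bounded U)
    (hV : TStructure.t.bounded V) : Function.Bijective ((derivedι X).map : (U ⟶ V) → _) :=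
  bijective_derivedι_map X h.full_left h.faithful_left hU hV

lemma bijective_right (h : IsDDecomposition X Y .bounded)
    {U V : DerivedCategory Y.FullSubcategory} (hU : TStructure.t.bounded U)
    (hV : TStructure.t.bounded V) : Function.Bijective ((derivedι Y).map : (U ⟶ V) → _) :=
  bijective_derivedι_map Y h.full_right h.faithful_right hU hV

lemma single_hom_eq_zero (h : IsDDecomposition X Y .bounded) {M N : A} (hM : X M) (hN : Y N)
    (n : ℤ) (f : (singleFunctor A 0).obj M ⟶ ((singleFunctor A 0).obj N)⟦n⟧) : f = 0 := by
  let e := ((dProp A .bounded).ι.commShiftIso n).app ((singleStar A .bounded).obj N)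
  have := h.hom_eq_zero M N hM hN n (ObjectProperty.homMk (f ≫ e.inv))
  have h₂ : f ≫ e.inv = 0 := congr_arg InducedCategory.Hom.hom this
  exact (cancel_mono e.inv).1 (h₂.trans zero_comp.symm)

/-- The identity of such an object is a degree-zero morphism from `X` to `Y`. -/
lemma isZero_of_left_of_right (h : IsDDecomposition X Y .bounded) {M : A} (hM : X M) (hM' : Y M) :
    IsZero M := by
  rw [IsZero.iff_id_eq_zero]
  apply (singleFunctor A 0).map_injective
  let e := (shiftFunctorZero (DerivedCategory A) ℤ).symm.app ((singleFunctor A 0).obj M)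
  have he : e.hom = 0 := h.single_hom_eq_zero hM hM' 0 _
  rw [(singleFunctor A 0).map_id, (singleFunctor A 0).map_zero]
  exact (cancel_mono e.hom).1 (by rw [he, comp_zero, comp_zero])

lemma exists_distTriang (h : IsDDecomposition X Y .bounded) {M : DerivedCategory A}
    (hM : TStructure.t.bounded M) :
    ∃ (U : DerivedCategory X.FullSubcategory) (_ : TStructure.t.bounded U)
      (V : DerivedCategory Y.FullSubcategory) (_ : TStructure.t.bounded V)
      (f : (derivedι X).obj U ⟶ M) (g : M ⟶ (derivedι Y).obj V)
      (h : (derivedι Y).obj V ⟶ ((derivedι X).obj U)⟦(1 : ℤ)⟧),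
      Triangle.mk f g h ∈ distTriang (DerivedCategory A) := by
  obtain ⟨U, V, f, g, δ, hT⟩ := h.exists_triangle ⟨M, hM⟩
  exact ⟨U.obj, U.property, V.obj, V.property, f.hom, g.hom, _,
    (dProp A .bounded).ι.map_distinguished _ hT⟩

/-- The objects of the derived category which are isomorphic to a shift of an object of the
subcategory `P`. -/
def shiftedSingle (P : ObjectProperty A) : ObjectProperty (DerivedCategory A) :=
  fun W => ∃ (M : A) (n : ℤ), P M ∧ Nonempty (W ≅ ((singleFunctor A 0).obj M)⟦n⟧)

instance (P : ObjectProperty A) : (shiftedSingle P).IsStableUnderShift ℤ where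
  isStableUnderShiftBy a := ⟨by
    rintro W ⟨M, n, hM, ⟨e⟩⟩
    exact ⟨M, n + a, hM, ⟨(shiftFunctor _ a).mapIso e ≪≫
      ((shiftFunctorAdd (DerivedCategory A) n a).app _).symm⟩⟩⟩

/-- Dévissage in `U`: the left orthogonal of a shift-stable class is triangulated, and it contains
the objects of `X` in degree `0` by hypothesis. The next lemma repeats the argument in `V`. -/
lemma left_single_hom_eq_zero (h : IsDDecomposition X Y .bounded)
    {U : DerivedCategory X.FullSubcategory} (hU : TStructure.t.bounded U) {N : A} (hN : Y N)
    (n : ℤ) (f : (derivedι X).obj U ⟶ ((singleFunctor A 0).obj N)⟦n⟧) : f = 0 := by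
  refine prop_of_bounded ((shiftedSingle Y).leftOrthogonal.inverseImage (derivedι X)) ?_ hU f
    ⟨N, n, hN, ⟨Iso.refl _⟩⟩
  rintro M W φ ⟨N, n, hN, ⟨e⟩⟩
  rw [← cancel_mono e.hom, ← cancel_epi (derivedιSingle X M).inv, zero_comp, comp_zero]
  exact h.single_hom_eq_zero M.property hN n _

lemma hom_eq_zero_of_bounded (h : IsDDecomposition X Y .bounded)
    {U : DerivedCategory X.FullSubcategory} (hU : TStructure.t.bounded U)
    {V : DerivedCategory Y.FullSubcategory} (hV : TStructure.t.bounded V)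
    (f : (derivedι X).obj U ⟶ (derivedι Y).obj V) : f = 0 := by
  let P : ObjectProperty (DerivedCategory A) :=
    (TStructure.t.bounded : ObjectProperty (DerivedCategory X.FullSubcategory)).map (derivedι X)
  have : P.IsStableUnderShift ℤ :=
    { isStableUnderShiftBy a := ⟨by
        rintro W ⟨U, hU, ⟨e⟩⟩
        exact ⟨U⟦a⟧, ObjectProperty.le_shift _ a _ hU,
          ⟨((derivedι X).commShiftIso a).app U ≪≫ (shiftFunctor _ a).mapIso e⟩⟩⟩ }
  refine prop_of_bounded (P.rightOrthogonal.inverseImage (derivedι Y)) ?_ hV f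
    ⟨U, hU, ⟨Iso.refl _⟩⟩
  rintro N W φ ⟨U, hU, ⟨e⟩⟩
  let e' := derivedιSingle Y N ≪≫
    (shiftFunctorZero (DerivedCategory A) ℤ).symm.app ((singleFunctor A 0).obj N.obj)
  rw [← cancel_epi e.hom, comp_zero]
  exact (cancel_mono e'.hom).1 (by
    rw [zero_comp]; exact h.left_single_hom_eq_zero hU N.property 0 _)

lemma hom_shift_eq_zero_of_bounded (h : IsDDecomposition X Y .bounded)
    {U : DerivedCategory X.FullSubcategory} (hU : TStructure.t.bounded U)
    {V : DerivedCategory Y.FullSubcategory} (hV : TStructure.t.bounded V) (n : ℤ)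
    (f : (derivedι X).obj U ⟶ ((derivedι Y).obj V)⟦n⟧) : f = 0 := by
  rw [← cancel_mono (((derivedι Y).commShiftIso n).inv.app V), zero_comp]
  exact h.hom_eq_zero_of_bounded hU (ObjectProperty.le_shift _ n _ hV) _

lemma shift_hom_eq_zero_of_bounded (h : IsDDecomposition X Y .bounded)
    {U : DerivedCategory X.FullSubcategory} (hU : TStructure.t.bounded U)
    {V : DerivedCategory Y.FullSubcategory} (hV : TStructure.t.bounded V) (n : ℤ)
    (f : ((derivedι X).obj U)⟦n⟧ ⟶ (derivedι Y).obj V) : f = 0 := by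
  rw [← cancel_epi (((derivedι X).commShiftIso n).hom.app U), comp_zero]
  exact h.hom_eq_zero_of_bounded (ObjectProperty.le_shift _ n _ hU) hV _

lemma bijective_comp_left (h : IsDDecomposition X Y .bounded) {M : DerivedCategory A}
    {U : DerivedCategory X.FullSubcategory} (hU : TStructure.t.bounded U)
    {V : DerivedCategory Y.FullSubcategory} (hV : TStructure.t.bounded V)
    {f : (derivedι X).obj U ⟶ M} {g : M ⟶ (derivedι Y).obj V}
    {δ : (derivedι Y).obj V ⟶ ((derivedι X).obj U)⟦(1 : ℤ)⟧}
    (hT : Triangle.mk f g δ ∈ distTriang (DerivedCategory A))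
    {W : DerivedCategory X.FullSubcategory} (hW : TStructure.t.bounded W) :
    Function.Bijective (fun ψ : W ⟶ U => (derivedι X).map ψ ≫ f) :=
  (bijective_comp_mor₁ hT (h.hom_eq_zero_of_bounded hW hV)
    (h.hom_shift_eq_zero_of_bounded hW hV (-1))).comp (h.bijective_left hW hU)

lemma bijective_comp_right (h : IsDDecomposition X Y .bounded) {M : DerivedCategory A}
    {U : DerivedCategory X.FullSubcategory} (hU : TStructure.t.bounded U)
    {V : DerivedCategory Y.FullSubcategory} (hV : TStructure.t.bounded V)
    {f : (derivedι X).obj U ⟶ M} {g : M ⟶ (derivedι Y).obj V}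
    {δ : (derivedι Y).obj V ⟶ ((derivedι X).obj U)⟦(1 : ℤ)⟧}
    (hT : Triangle.mk f g δ ∈ distTriang (DerivedCategory A))
    {W : DerivedCategory Y.FullSubcategory} (hW : TStructure.t.bounded W) :
    Function.Bijective (fun ψ : V ⟶ W => g ≫ (derivedι Y).map ψ) :=
  (bijective_mor₂_comp hT (fun f => h.hom_eq_zero_of_bounded hU hW f)
    (fun f => h.shift_hom_eq_zero_of_bounded hU hW 1 f)).comp (h.bijective_right hV hW)

section Amplitude

variable {M : DerivedCategory A}
    {U : DerivedCategory X.FullSubcategory} {V : DerivedCategory Y.FullSubcategory}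
    {f : (derivedι X).obj U ⟶ M} {g : M ⟶ (derivedι Y).obj V}
    {δ : (derivedι Y).obj V ⟶ ((derivedι X).obj U)⟦(1 : ℤ)⟧}

/-- The connecting map is an isomorphism from an object of `Y` to one of `X`, so both vanish.
Neither `U` nor `V` is assumed bounded, which allows reuse for unbounded triangles. -/
lemma isZero_homology (h : IsDDecomposition X Y .bounded)
    (hT : Triangle.mk f g δ ∈ distTriang (DerivedCategory A)) (n₀ n₁ : ℤ) (hn : n₀ + 1 = n₁)
    (h₀ : IsZero ((homologyFunctor A n₀).obj M)) (h₁ : IsZero ((homologyFunctor A n₁).obj M)) :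
    IsZero ((homologyFunctor X.FullSubcategory n₁).obj U) ∧
      IsZero ((homologyFunctor Y.FullSubcategory n₀).obj V) := by
  rw [← isZero_homologyFunctor_mapDerivedCategory_iff X.ι,
    ← isZero_homologyFunctor_mapDerivedCategory_iff Y.ι]
  have hmono : Mono (HomologySequence.δ (Triangle.mk f g δ) n₀ n₁ hn) :=
    (HomologySequence.exact₃ _ hT n₀ n₁ hn).mono_g (h₀.eq_of_src _ _)
  have hepi : Epi (HomologySequence.δ (Triangle.mk f g δ) n₀ n₁ hn) :=
    (HomologySequence.exact₁ _ hT n₀ n₁ hn).epi_f (h₁.eq_of_tgt _ _)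
  have hiso : IsIso (HomologySequence.δ (Triangle.mk f g δ) n₀ n₁ hn) :=
    @isIso_of_mono_of_epi _ _ _ _ _ _ hmono hepi
  let e : (homologyFunctor A n₀).obj ((derivedι Y).obj V) ≅
    (homologyFunctor A n₁).obj ((derivedι X).obj U) :=
      @asIso _ _ _ _ _ hiso
  have hU := h.isZero_of_left_of_right (homology_derivedι_obj X U n₁)
    (Y.prop_of_iso e (homology_derivedι_obj Y V n₀))
  exact ⟨hU, hU.of_iso e⟩

lemma isGE_of_isGE (h : IsDDecomposition X Y .bounded)
    (hT : Triangle.mk f g δ ∈ distTriang (DerivedCategory A)) (a : ℤ) (hM : M.IsGE a) :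
    U.IsGE a ∧ V.IsGE (a - 1) := by
  rw [isGE_iff] at hM
  rw [isGE_iff, isGE_iff]
  exact ⟨fun n hn => (h.isZero_homology hT (n - 1) n (by lia) (hM _ (by lia)) (hM _ hn)).1,
    fun n hn => (h.isZero_homology hT n (n + 1) rfl (hM _ (by lia)) (hM _ (by lia))).2⟩

lemma isLE_of_isLE (h : IsDDecomposition X Y .bounded)
    (hT : Triangle.mk f g δ ∈ distTriang (DerivedCategory A)) (b : ℤ) (hM : M.IsLE b) :
    U.IsLE (b + 1) ∧ V.IsLE b := by
  rw [isLE_iff] at hM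
  rw [isLE_iff, isLE_iff]
  exact ⟨fun n hn => (h.isZero_homology hT (n - 1) n (by lia) (hM _ (by lia)) (hM _ (by lia))).1,
    fun n hn => (h.isZero_homology hT n (n + 1) rfl (hM _ hn) (hM _ (by lia))).2⟩

end Amplitude

end IsDDecomposition

end Bounded

/-! ### Moving shifts and signs across triangles -/

section Shift

/-- This moves the shift to the source, so that effacement results stated for a target in degree `0`
apply to extension classes. -/
lemma exists_shift_adjunct {C : Type u} [Category.{v} C] [HasShift C ℤ] [Preadditive C]
    [∀ n : ℤ, (shiftFunctor C n).Additive] {W Z : C} (n : ℤ) (f : W ⟶ Z⟦n⟧) :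
    ∃ f' : W⟦(-n)⟧ ⟶ Z, ∀ {Z' : C} (p : Z ⟶ Z'), f' ≫ p = 0 → f ≫ p⟦n⟧' = 0 := by
  let adj := (shiftEquiv C n).symm.toAdjunction
  refine ⟨(adj.homEquiv _ _).symm f, fun {Z'} p hp => ?_⟩
  have h₁ := adj.homEquiv_naturality_right ((adj.homEquiv _ _).symm f) p
  have h₂ : adj.homEquiv W Z' ((adj.homEquiv W Z).symm f ≫ p) = 0 := by
    refine (congr_arg (adj.homEquiv W Z') hp).trans ?_
    refine (adj.homEquiv_unit W Z' _).trans ?_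
    exact ((adj.unit.app W) ≫= (shiftFunctor C n).map_zero _ _).trans comp_zero
  have h₃ := (adj.homEquiv W Z).apply_symm_apply f
  exact ((h₃ =≫ (shiftFunctor C n).map p).symm.trans h₁.symm).trans h₂

variable {C : Type u} [Category.{v} C] [HasZeroObject C] [HasShift C ℤ] [Preadditive C]
  [∀ n : ℤ, (shiftFunctor C n).Additive] [Pretriangulated C]

/-- Rotating twice puts a sign on the shifted second morphism; the witness absorbs it. -/
lemma exists_fac_shift_mor₂ {T : Triangle C} (hT : T ∈ distTriang C) {W : C}
    (φ : W ⟶ T.obj₃⟦(1 : ℤ)⟧) (hφ : φ ≫ T.mor₃⟦(1 : ℤ)⟧' = 0) :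
    ∃ ψ : W ⟶ T.obj₂⟦(1 : ℤ)⟧, φ = ψ ≫ T.mor₂⟦(1 : ℤ)⟧' := by
  obtain ⟨ψ, hψ⟩ := Triangle.coyoneda_exact₁ _
    (rot_of_distTriang _ (rot_of_distTriang _ hT)) φ hφ
  exact ⟨-ψ, hψ.trans ((Preadditive.comp_neg _ _).trans (Preadditive.neg_comp _ _).symm)⟩

lemma exists_fac_mor₁ {T : Triangle C} (hT : T ∈ distTriang C) {W : C}
    (φ : T.obj₁ ⟶ W) (hφ : T.mor₃ ≫ φ⟦(1 : ℤ)⟧' = 0) :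
    ∃ ψ : T.obj₂ ⟶ W, φ = T.mor₁ ≫ ψ := by
  obtain ⟨ψ, hψ⟩ := Triangle.yoneda_exact₃ _ (rot_of_distTriang _ hT) (φ⟦(1 : ℤ)⟧') hφ
  obtain ⟨ψ', hψ'⟩ : ∃ ψ' : T.obj₂ ⟶ W, ψ'⟦(1 : ℤ)⟧' = ψ :=
    (shiftFunctor C (1 : ℤ)).map_surjective ψ
  refine ⟨-ψ', (shiftFunctor C (1 : ℤ)).map_injective (hψ.trans ?_)⟩
  rw [← hψ', Preadditive.comp_neg, Functor.map_neg, Functor.map_comp]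
  exact Preadditive.neg_comp _ _

end Shift

/-! ### Objects with effaceable first extensions -/

section Effaceable

open DerivedCategory

variable {A : Type u} [Category.{v} A] [Abelian A] [HasDerivedCategory.{w} A]

/-- The extensions of objects of `X` by `M` are effaceable within `X`. -/
def IsRightEffaceable (X : ObjectProperty A) : ObjectProperty A := fun M =>
  ∀ (T : A) (_ : X T) (f : (singleFunctor A 0).obj T ⟶ ((singleFunctor A 0).obj M)⟦(1 : ℤ)⟧),
    ∃ (T' : A) (_ : X T') (p : T' ⟶ T), Epi p ∧ (singleFunctor A 0).map p ≫ f = 0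

/-- The extensions of `M` by objects of `Y` are effaceable within `Y`. -/
def IsLeftEffaceable (Y : ObjectProperty A) : ObjectProperty A := fun M =>
  ∀ (T : A) (_ : Y T) (f : (singleFunctor A 0).obj M ⟶ ((singleFunctor A 0).obj T)⟦(1 : ℤ)⟧),
    ∃ (T' : A) (_ : Y T') (p : T ⟶ T'), Mono p ∧ f ≫ ((singleFunctor A 0).map p)⟦(1 : ℤ)⟧' = 0

/-- A monomorphism out of `M` kills the class, and it splits since `M` is injective. So the class is
already zero and `T` itself serves. -/
lemma IsRightEffaceable.of_injective (X : ObjectProperty A) (M : A) [Injective M] :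
    IsRightEffaceable X M := by
  intro T hT f
  obtain ⟨f', hf'⟩ := exists_shift_adjunct 1 f
  obtain ⟨M', p, hp, hp'⟩ := exists_mono_comp_eq_zero
    (TStructure.t.isGE_shift ((singleFunctor A 0).obj T) 0 (-1) 1) f'
  refine ⟨T, hT, 𝟙 T, inferInstance, ?_⟩
  have h₁ := hf' _ hp' =≫ ((singleFunctor A 0).map (Injective.factorThru (𝟙 M) p))⟦(1 : ℤ)⟧'
  rw [assoc, ← Functor.map_comp, ← Functor.map_comp, Injective.comp_factorThru,
    (singleFunctor A 0).map_id, (shiftFunctor (DerivedCategory A) (1 : ℤ)).map_id, zero_comp] at h₁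
  rw [(singleFunctor A 0).map_id, id_comp]
  exact (comp_id f).symm.trans h₁

lemma IsLeftEffaceable.of_projective (Y : ObjectProperty A) (M : A) [Projective M] :
    IsLeftEffaceable Y M := by
  intro T hT f
  obtain ⟨M', p, hp, hp'⟩ := exists_epi_comp_eq_zero
    (TStructure.t.isLE_shift ((singleFunctor A 0).obj T) 0 1 (-1)) f
  refine ⟨T, hT, 𝟙 T, inferInstance, ?_⟩
  have h₁ := (singleFunctor A 0).map (Projective.factorThru (𝟙 M) p) ≫= hp'
  rw [← Functor.map_comp_assoc, Projective.factorThru_comp, (singleFunctor A 0).map_id, id_comp,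
    comp_zero] at h₁
  rw [h₁, zero_comp]

/-- The two components of the class are effaced one after the other. -/
lemma IsRightEffaceable.biprod {X : ObjectProperty A} {M N : A} (hM : IsRightEffaceable X M)
    (hN : IsRightEffaceable X N) : IsRightEffaceable X (M ⊞ N) := by
  intro T hT f
  let H := singleFunctor A 0 ⋙ shiftFunctor (DerivedCategory A) (1 : ℤ)
  obtain ⟨T₁, hT₁, p₁, hp₁, h₁⟩ := hM T hT (f ≫ H.map biprod.fst)
  obtain ⟨T₂, hT₂, p₂, hp₂, h₂⟩ := hN T₁ hT₁ ((singleFunctor A 0).map p₁ ≫ f ≫ H.map biprod.snd)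
  refine ⟨T₂, hT₂, p₂ ≫ p₁, inferInstance, ?_⟩
  have hid : (H.map biprod.fst ≫ H.map biprod.inl + H.map biprod.snd ≫ H.map biprod.inr :
      H.obj (M ⊞ N) ⟶ H.obj (M ⊞ N)) = 𝟙 _ := by
    rw [← H.map_comp, ← H.map_comp, ← H.map_add, biprod.total, H.map_id]
  have : (singleFunctor A 0).map (p₂ ≫ p₁) ≫ f ≫ 𝟙 (H.obj (M ⊞ N)) = 0 := by
    rw [← hid, Functor.map_comp, assoc, Preadditive.comp_add, Preadditive.comp_add,
      Preadditive.comp_add, reassoc_of% h₁, reassoc_of% h₂, zero_comp, comp_zero, zero_comp,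
      add_zero]
  exact (_ ≫= (comp_id f).symm).trans this

lemma IsLeftEffaceable.biprod {Y : ObjectProperty A} {M N : A} (hM : IsLeftEffaceable Y M)
    (hN : IsLeftEffaceable Y N) : IsLeftEffaceable Y (M ⊞ N) := by
  intro T hT f
  let H := singleFunctor A 0
  obtain ⟨T₁, hT₁, p₁, hp₁, h₁⟩ := hM T hT (H.map biprod.inl ≫ f)
  obtain ⟨T₂, hT₂, p₂, hp₂, h₂⟩ := hN T₁ hT₁ (H.map biprod.inr ≫ f ≫ (H.map p₁)⟦(1 : ℤ)⟧')
  refine ⟨T₂, hT₂, p₁ ≫ p₂, inferInstance, ?_⟩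
  have hid : (H.map biprod.fst ≫ H.map biprod.inl + H.map biprod.snd ≫ H.map biprod.inr :
      H.obj (M ⊞ N) ⟶ H.obj (M ⊞ N)) = 𝟙 _ := by
    rw [← H.map_comp, ← H.map_comp, ← H.map_add, biprod.total, H.map_id]
  rw [assoc] at h₁
  rw [assoc, assoc] at h₂
  have : 𝟙 (H.obj (M ⊞ N)) ≫ f ≫ (H.map (p₁ ≫ p₂))⟦(1 : ℤ)⟧' = 0 := by
    rw [← hid, H.map_comp, Functor.map_comp, Preadditive.add_comp, assoc, assoc, h₂,
      reassoc_of% h₁, zero_comp, comp_zero, comp_zero, add_zero]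
  rwa [id_comp] at this

end Effaceable

/-! ### Effaceable objects are adapted to the adjoints -/

namespace IsDDecomposition

open DerivedCategory

variable {A : Type u} [Category.{v} A] [Abelian A] [HasDerivedCategory.{w} A]
  {X Y : ObjectProperty A} [IsAbelianSubcategory X] [IsAbelianSubcategory Y]
  [HasDerivedCategory.{w₁} X.FullSubcategory] [HasDerivedCategory.{w₂} Y.FullSubcategory]

/-- The morphism factors through the `X`-part `U` of `M`. The amplitude estimate loses one degree,
so `-2` leaves `U` in degrees at most `-1`, where effacement takes place inside `X`. This makes
`Ext^2(T, -)` effaceable for `T` in `X`. -/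
lemma exists_epi_comp_eq_zero_of_isLE (h : IsDDecomposition X Y .bounded) {M : DerivedCategory A}
    (hM : TStructure.t.bounded M) (hM' : M.IsLE (-2)) {T : A} (hT : X T)
    (f : (singleFunctor A 0).obj T ⟶ M) :
    ∃ (T' : A) (_ : X T') (p : T' ⟶ T), Epi p ∧ (singleFunctor A 0).map p ≫ f = 0 := by
  obtain ⟨U, hU, V, hV, f₁, g, δ, H⟩ := h.exists_distTriang hM
  let T₀ : X.FullSubcategory := ⟨T, hT⟩
  obtain ⟨ψ, hψ⟩ := (h.bijective_comp_left hU hV H (bounded_single T₀ 0)).2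
    ((derivedιSingle X T₀).hom ≫ f)
  obtain ⟨T', p, hp, hpψ⟩ := exists_epi_comp_eq_zero (h.isLE_of_isLE H (-2) hM').1 ψ
  refine ⟨T'.obj, T'.property, p.hom, inferInstanceAs (Epi (X.ι.map p)), ?_⟩
  rw [← cancel_epi (derivedιSingle X T').hom, ← reassoc_of% (derivedιSingle_naturality X p), ← hψ,
    ← Functor.map_comp_assoc, hpψ, Functor.map_zero, zero_comp, comp_zero]

lemma exists_mono_comp_eq_zero_of_isGE (h : IsDDecomposition X Y .bounded) {M : DerivedCategory A}
    (hM : TStructure.t.bounded M) (hM' : M.IsGE 2) {T : A} (hT : Y T)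
    (f : M ⟶ (singleFunctor A 0).obj T) :
    ∃ (T' : A) (_ : Y T') (p : T ⟶ T'), Mono p ∧ f ≫ (singleFunctor A 0).map p = 0 := by
  obtain ⟨U, hU, V, hV, f₁, g, δ, H⟩ := h.exists_distTriang hM
  let T₀ : Y.FullSubcategory := ⟨T, hT⟩
  obtain ⟨ψ, hψ⟩ := (h.bijective_comp_right hU hV H (bounded_single T₀ 0)).2
    (f ≫ (derivedιSingle Y T₀).inv)
  obtain ⟨T', p, hp, hpψ⟩ := exists_mono_comp_eq_zero (h.isGE_of_isGE H 2 hM').2 ψ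
  refine ⟨T'.obj, T'.property, p.hom, inferInstanceAs (Mono (Y.ι.map p)), ?_⟩
  dsimp only at hψ
  rw [← cancel_mono (derivedιSingle Y T').inv, assoc, ← derivedιSingle_inv_naturality Y p,
    ← reassoc_of% hψ, ← Functor.map_comp, hpψ, Functor.map_zero, comp_zero, zero_comp]

/-- With `K` the kernel of `f`, use `Ext^1(T,M) → Ext^1(T,N) → Ext^2(T,K)`. One epimorphism kills
the image in `Ext^2`, so the class lifts to `M`; a second one kills the lift. -/
lemma isRightEffaceable_of_epi (h : IsDDecomposition X Y .bounded) {M N : A} (f : M ⟶ N) [Epi f]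
    (hM : IsRightEffaceable X M) : IsRightEffaceable X N := by
  intro T hT φ
  let S : ShortComplex A := ShortComplex.mk (kernel.ι f) f (kernel.condition f)
  have hS : S.ShortExact := ShortComplex.ShortExact.mk'
    (S.exact_of_f_is_kernel (kernelIsKernel f)) (by dsimp [S]; infer_instance) ‹Epi f›
  have hb : TStructure.t.bounded
      (((singleFunctor A 0).obj S.X₁)⟦(1 : ℤ)⟧⟦(1 : ℤ)⟧) :=
    ObjectProperty.le_shift _ (1 : ℤ) _ (ObjectProperty.le_shift _ (1 : ℤ) _ (bounded_single _ 0))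
  have hle₁ := TStructure.t.isLE_shift ((singleFunctor A 0).obj S.X₁) 0 1 (-1)
  have hle := TStructure.t.isLE_shift (((singleFunctor A 0).obj S.X₁)⟦(1 : ℤ)⟧) (-1) 1 (-2)
  obtain ⟨T₁, hT₁, p₁, hp₁, h₁⟩ := h.exists_epi_comp_eq_zero_of_isLE hb hle hT
    (φ ≫ hS.singleδ⟦(1 : ℤ)⟧')
  obtain ⟨ψ, hψ⟩ := exists_fac_shift_mor₂ hS.singleTriangle_distinguished
    ((singleFunctor A 0).map p₁ ≫ φ) ((assoc _ _ _).trans h₁)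
  obtain ⟨T₂, hT₂, p₂, hp₂, h₂⟩ := hM T₁ hT₁ ψ
  refine ⟨T₂, hT₂, p₂ ≫ p₁, inferInstance, ?_⟩
  rw [Functor.map_comp, assoc]
  refine ((singleFunctor A 0).map p₂ ≫= hψ).trans ?_
  exact (assoc _ _ _).symm.trans ((h₂ =≫ _).trans zero_comp)

lemma isLeftEffaceable_of_mono (h : IsDDecomposition X Y .bounded) {M N : A} (f : M ⟶ N) [Mono f]
    (hN : IsLeftEffaceable Y N) : IsLeftEffaceable Y M := by
  intro T hT φ
  let S : ShortComplex A := ShortComplex.mk f (cokernel.π f) (cokernel.condition f)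
  have hS : S.ShortExact := ShortComplex.ShortExact.mk'
    (S.exact_of_g_is_cokernel (cokernelIsCokernel f)) ‹Mono f› (by dsimp [S]; infer_instance)
  -- The obstruction in `Ext^2(coker f, T)` is rewritten, one shift at a time, as a morphism to `T`
  -- in degree `0` from an object in degree `2`.
  obtain ⟨φ₁, hφ₁⟩ := exists_shift_adjunct 1 (hS.singleδ ≫ φ⟦(1 : ℤ)⟧')
  obtain ⟨φ₂, hφ₂⟩ := exists_shift_adjunct 1 φ₁
  have hb : TStructure.t.bounded
      (((singleFunctor A 0).obj S.X₃)⟦(-1 : ℤ)⟧⟦(-1 : ℤ)⟧) :=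
    ObjectProperty.le_shift _ (-1 : ℤ) _ (ObjectProperty.le_shift _ (-1 : ℤ) _ (bounded_single _ 0))
  have hge₁ := TStructure.t.isGE_shift ((singleFunctor A 0).obj S.X₃) 0 (-1) 1
  have hge := TStructure.t.isGE_shift (((singleFunctor A 0).obj S.X₃)⟦(-1 : ℤ)⟧) 1 (-1) 2
  obtain ⟨T₁, hT₁, p₁, hp₁, h₁⟩ := h.exists_mono_comp_eq_zero_of_isGE hb hge hT φ₂
  have h₁' := hφ₁ _ (hφ₂ _ h₁)
  rw [assoc, ← Functor.map_comp] at h₁'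
  obtain ⟨ψ, hψ⟩ := exists_fac_mor₁ hS.singleTriangle_distinguished
    (φ ≫ ((singleFunctor A 0).map p₁)⟦(1 : ℤ)⟧') h₁'
  obtain ⟨T₂, hT₂, p₂, hp₂, h₂⟩ := hN T₁ hT₁ ψ
  refine ⟨T₂, hT₂, p₁ ≫ p₂, inferInstance, ?_⟩
  rw [Functor.map_comp, Functor.map_comp, ← assoc]
  exact (hψ =≫ _).trans ((assoc _ _ _).trans ((_ ≫= h₂).trans comp_zero))

/-- Full faithfulness on bounded complexes moves the class into the derived category of `X`, where
Yoneda extensions are effaceable. -/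
lemma isRightEffaceable_of_left (h : IsDDecomposition X Y .bounded) {M : A} (hM : X M) :
    IsRightEffaceable X M := by
  intro T hT φ
  let T₀ : X.FullSubcategory := ⟨T, hT⟩
  let M₀ : X.FullSubcategory := ⟨M, hM⟩
  let e := ((derivedι X).commShiftIso (1 : ℤ)).app ((singleFunctor X.FullSubcategory 0).obj M₀) ≪≫
    (shiftFunctor _ (1 : ℤ)).mapIso (derivedιSingle X M₀)
  obtain ⟨ψ, hψ⟩ := (h.bijective_left (bounded_single T₀ 0)
    (ObjectProperty.le_shift _ (1 : ℤ) _ (bounded_single M₀ 0))).2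
      ((derivedιSingle X T₀).hom ≫ φ ≫ e.inv)
  obtain ⟨T', p, hp, hpψ⟩ := exists_epi_comp_eq_zero
    (TStructure.t.isLE_shift ((singleFunctor X.FullSubcategory 0).obj M₀) 0 1 (-1)) ψ
  refine ⟨T'.obj, T'.property, p.hom, inferInstanceAs (Epi (X.ι.map p)), ?_⟩
  have : (singleFunctor A 0).map p.hom ≫ φ ≫ e.inv = 0 := by
    rw [← cancel_epi (derivedιSingle X T').hom, ← reassoc_of% (derivedιSingle_naturality X p), ← hψ,
      ← Functor.map_comp, hpψ, Functor.map_zero, comp_zero]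
  exact (cancel_mono e.inv).1 ((assoc _ _ _).trans (this.trans zero_comp.symm))

lemma isLeftEffaceable_of_right (h : IsDDecomposition X Y .bounded) {M : A} (hM : Y M) :
    IsLeftEffaceable Y M := by
  intro T hT φ
  let T₀ : Y.FullSubcategory := ⟨T, hT⟩
  let M₀ : Y.FullSubcategory := ⟨M, hM⟩
  let e (T₀ : Y.FullSubcategory) :=
    ((derivedι Y).commShiftIso (1 : ℤ)).app ((singleFunctor Y.FullSubcategory 0).obj T₀) ≪≫
    (shiftFunctor _ (1 : ℤ)).mapIso (derivedιSingle Y T₀)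
  obtain ⟨ψ, hψ⟩ := (h.bijective_right (bounded_single M₀ 0)
    (ObjectProperty.le_shift _ (1 : ℤ) _ (bounded_single T₀ 0))).2
      ((derivedιSingle Y M₀).hom ≫ φ ≫ (e T₀).inv)
  obtain ⟨ψ', hψ'⟩ := exists_shift_adjunct 1 ψ
  obtain ⟨T', p, hp, hpψ⟩ := exists_mono_comp_eq_zero
    (TStructure.t.isGE_shift ((singleFunctor Y.FullSubcategory 0).obj M₀) 0 (-1) 1) ψ'
  refine ⟨T'.obj, T'.property, p.hom, inferInstanceAs (Mono (Y.ι.map p)), ?_⟩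
  have h₁ := hψ' _ hpψ
  have hφ : φ = (derivedιSingle Y M₀).inv ≫ (derivedι Y).map ψ ≫ (e T₀).hom := by
    rw [hψ, assoc, assoc, Iso.inv_hom_id_assoc, Iso.inv_hom_id]
    exact (comp_id φ).symm
  have hnat : (e T₀).hom ≫ ((singleFunctor A 0).map p.hom)⟦(1 : ℤ)⟧' =
      (derivedι Y).map (((singleFunctor Y.FullSubcategory 0).map p)⟦(1 : ℤ)⟧') ≫ (e T').hom := by
    have n₁ := ((derivedι Y).commShiftIso (1 : ℤ)).hom.naturality
      ((singleFunctor Y.FullSubcategory 0).map p)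
    have n₂ := congr_arg (shiftFunctor (DerivedCategory A) (1 : ℤ)).map
      (derivedιSingle_naturality Y p)
    rw [Functor.map_comp, Functor.map_comp] at n₂
    dsimp only [e, Iso.trans_hom, Functor.mapIso_hom]
    rw [assoc, ← n₂]
    exact ((reassoc_of% n₁) _).symm
  rw [hφ, assoc, assoc, hnat, ← Functor.map_comp_assoc, h₁, Functor.map_zero, zero_comp, comp_zero]

lemma isRightEffaceable_of_right (h : IsDDecomposition X Y .bounded) {M : A} (hM : Y M) :
    IsRightEffaceable X M := fun T hT f =>
  ⟨T, hT, 𝟙 T, inferInstance, by rw [h.single_hom_eq_zero hT hM 1 f, comp_zero]⟩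

/-- For `epi_map`, the obstruction to lifting the counit `r X₃ → X₃` to `X₂` is a class in `Ext^1(r
X₃, X₁)`. It dies on some epimorphism `p` within `X`, so `p` factors through `r(S.g)`, which is
therefore epi. -/
lemma isRightAdapted (h : IsDDecomposition X Y .bounded) {r : A ⥤ X.FullSubcategory}
    (adj : X.ι ⊣ r) : IsRightAdapted r (IsRightEffaceable X) where
  of_injective I _ := IsRightEffaceable.of_injective X I
  of_epi f _ hM := h.isRightEffaceable_of_epi f hM
  biprod := IsRightEffaceable.biprod
  epi_map {S} hS hS₁ := by
    let c : (r.obj S.X₃).obj ⟶ S.X₃ := adj.counit.app S.X₃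
    obtain ⟨T', hT', p, hp, hp'⟩ := hS₁ _ (r.obj S.X₃).property
      ((singleFunctor A 0).map c ≫ hS.singleδ)
    obtain ⟨k, hk⟩ := Triangle.coyoneda_exact₃ _ hS.singleTriangle_distinguished
      ((singleFunctor A 0).map (p ≫ c)) 
        (((singleFunctor A 0).map_comp p c =≫ _).trans ((assoc _ _ _).trans hp'))
    obtain ⟨k, rfl⟩ := (singleFunctor A 0).map_surjective k
    have hk' : p ≫ c = k ≫ S.g :=
      (singleFunctor A 0).map_injective (hk.trans ((singleFunctor A 0).map_comp k S.g).symm)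
    let p' : (⟨T', hT'⟩ : X.FullSubcategory) ⟶ r.obj S.X₃ := ObjectProperty.homMk p
    have : Epi p' := by
      have : Epi (X.ι.map p') := hp
      exact X.ι.epi_of_epi_map this
    let k' : X.ι.obj ⟨T', hT'⟩ ⟶ S.X₂ := k
    have fac : adj.homEquiv _ _ k' ≫ r.map S.g = p' := by
      rw [← adj.homEquiv_naturality_right]
      apply (adj.homEquiv _ _).symm.injective
      rw [Equiv.symm_apply_apply, Adjunction.homEquiv_counit]
      exact hk'.symm
    exact epi_of_epi_fac fac

lemma isLeftAdapted (h : IsDDecomposition X Y .bounded) {l : A ⥤ Y.FullSubcategory}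
    (adj : l ⊣ Y.ι) : IsLeftAdapted l (IsLeftEffaceable Y) where
  of_projective I _ := IsLeftEffaceable.of_projective Y I
  of_mono f _ hM := h.isLeftEffaceable_of_mono f hM
  biprod := IsLeftEffaceable.biprod
  mono_map {S} hS hS₃ := by
    let c : S.X₁ ⟶ (l.obj S.X₁).obj := adj.unit.app S.X₁
    obtain ⟨T', hT', p, hp, hp'⟩ := hS₃ _ (l.obj S.X₁).property
      (hS.singleδ ≫ ((singleFunctor A 0).map c)⟦(1 : ℤ)⟧')
    obtain ⟨k, hk⟩ := exists_fac_mor₁ hS.singleTriangle_distinguished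
      ((singleFunctor A 0).map (c ≫ p)) 
        ((_ ≫= ((congr_arg (shiftFunctor _ (1 : ℤ)).map ((singleFunctor A 0).map_comp c p)).trans
          (Functor.map_comp _ _ _))).trans ((assoc _ _ _).symm.trans hp'))
    obtain ⟨k, rfl⟩ := (singleFunctor A 0).map_surjective k
    have hk' : c ≫ p = S.f ≫ k :=
      (singleFunctor A 0).map_injective (hk.trans ((singleFunctor A 0).map_comp S.f k).symm)
    let p' : l.obj S.X₁ ⟶ (⟨T', hT'⟩ : Y.FullSubcategory) := ObjectProperty.homMk p
    have : Mono p' := by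
      have : Mono (Y.ι.map p') := hp
      exact Y.ι.mono_of_mono_map this
    let k' : S.X₂ ⟶ Y.ι.obj ⟨T', hT'⟩ := k
    have fac : l.map S.f ≫ (adj.homEquiv _ _).symm k' = p' := by
      rw [← adj.homEquiv_naturality_left_symm]
      apply (adj.homEquiv _ _).injective
      rw [Equiv.apply_symm_apply, Adjunction.homEquiv_unit]
      exact hk'.symm
    exact mono_of_mono_fac fac

end IsDDecomposition

/-! ### Adjoints from chosen universal arrows -/

section UniversalArrows

variable {C : Type u₁} [Category.{v₁} C] {D : Type u₂} [Category.{v₂} D]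

/-- The right adjoint of a functor `F` given by a choice of universal arrows from `F`. -/
def rightAdjointOfBijective (F : C ⥤ D) (R : D → C) (ε : ∀ d, F.obj (R d) ⟶ d)
    (h : ∀ c d, Function.Bijective (fun g : c ⟶ R d => F.map g ≫ ε d)) : D ⥤ C :=
  Adjunction.rightAdjointOfEquiv (F := F) (G_obj := R)
    (fun c d => (Equiv.ofBijective _ (h c d)).symm) (fun c' c d f g => by
      rw [Equiv.symm_apply_eq]
      dsimp
      rw [F.map_comp, assoc]
      exact congr_arg _ ((Equiv.ofBijective _ (h c d)).apply_symm_apply g).symm)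

/-- The adjunction given by a choice of universal arrows from a functor. -/
def adjunctionOfBijectiveRight (F : C ⥤ D) (R : D → C) (ε : ∀ d, F.obj (R d) ⟶ d)
    (h : ∀ c d, Function.Bijective (fun g : c ⟶ R d => F.map g ≫ ε d)) :
    F ⊣ rightAdjointOfBijective F R ε h :=
  Adjunction.adjunctionOfEquivRight _ _

lemma adjunctionOfBijectiveRight_counit_app (F : C ⥤ D) (R : D → C) (ε : ∀ d, F.obj (R d) ⟶ d)
    (h : ∀ c d, Function.Bijective (fun g : c ⟶ R d => F.map g ≫ ε d)) (d : D) :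
    (adjunctionOfBijectiveRight F R ε h).counit.app d = ε d := by
  refine (Adjunction.adjunctionOfEquivRight_counit_app _ _ d).trans ?_
  exact ((F.map_id (R d)) =≫ ε d).trans (id_comp _)

/-- The left adjoint of a functor `G` given by a choice of universal arrows to `G`. -/
def leftAdjointOfBijective (G : C ⥤ D) (L : D → C) (η : ∀ d, d ⟶ G.obj (L d))
    (h : ∀ c d, Function.Bijective (fun g : L d ⟶ c => η d ≫ G.map g)) : D ⥤ C :=
  Adjunction.leftAdjointOfEquiv (G := G) (F_obj := L)
    (fun d c => Equiv.ofBijective _ (h c d)) (fun c d d' f g => by simp)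

/-- The adjunction given by a choice of universal arrows to a functor. -/
def adjunctionOfBijectiveLeft (G : C ⥤ D) (L : D → C) (η : ∀ d, d ⟶ G.obj (L d))
    (h : ∀ c d, Function.Bijective (fun g : L d ⟶ c => η d ≫ G.map g)) :
    leftAdjointOfBijective G L η h ⊣ G :=
  Adjunction.adjunctionOfEquivLeft _ _

lemma adjunctionOfBijectiveLeft_unit_app (G : C ⥤ D) (L : D → C) (η : ∀ d, d ⟶ G.obj (L d))
    (h : ∀ c d, Function.Bijective (fun g : L d ⟶ c => η d ≫ G.map g)) (d : D) :
    (adjunctionOfBijectiveLeft G L η h).unit.app d = η d := by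
  refine (Adjunction.adjunctionOfEquivLeft_unit_app _ _ d).trans ?_
  exact (η d ≫= G.map_id (L d)).trans (comp_id _)

end UniversalArrows

/-! ### Degree-zero cohomology as coreflection and reflection -/

section Single

open DerivedCategory

lemma bijective_comp_iso_hom {C : Type u} [Category.{v} C] {W U V Z : C} {a : V ⟶ Z}
    (h : Function.Bijective (fun f : W ⟶ V => f ≫ a)) (e : U ≅ V) :
    Function.Bijective (fun f : W ⟶ U => f ≫ e.hom ≫ a) := by
  simpa [Function.comp_def] using h.comp (e.homToEquiv (Z := W)).bijective

lemma bijective_iso_hom_comp {C : Type u} [Category.{v} C] {W U V Z : C} {a : Z ⟶ U}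
    (h : Function.Bijective (fun f : U ⟶ W => a ≫ f)) (e : U ≅ V) :
    Function.Bijective (fun f : V ⟶ W => (a ≫ e.hom) ≫ f) := by
  simpa [Function.comp_def] using h.comp (e.symm.homFromEquiv (Z := W)).bijective

variable {B : Type u} [Category.{v} B] [Abelian B] [HasDerivedCategory.{w} B]

lemma bijective_singleFunctor_map (M N : B) :
    Function.Bijective ((singleFunctor B 0).map : (M ⟶ N) → _) :=
  ⟨(singleFunctor B 0).map_injective, (singleFunctor B 0).map_surjective⟩

/-- `R` is `H^0(W)`, and `a` is the truncation map. The cone lies in degrees at least `1`, so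
receives no morphism from degree `0`. -/
lemma exists_coreflection_of_isGE (W : DerivedCategory B) (hW : W.IsGE 0) :
    ∃ (R : B) (a : (singleFunctor B 0).obj R ⟶ W),
      (∀ T : B, Function.Bijective (fun f : (singleFunctor B 0).obj T ⟶ (singleFunctor B 0).obj R =>
        f ≫ a)) ∧ (W.IsLE 0 → IsIso a) := by
  have hT := TStructure.t.triangleLEGT_distinguished 0 W
  obtain ⟨R, ⟨e⟩⟩ := exists_iso_singleFunctor_obj_of_isGE_of_isLE
    ((TStructure.t.truncLE 0).obj W) 0
  let a : (TStructure.t.truncLE 0).obj W ⟶ W := (TStructure.t.truncLEι 0).app W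
  have ha (h : W.IsLE 0) : IsIso a := (TStructure.t.isLE_iff_isIso_truncLEι_app 0 W).1 h
  refine ⟨R, e.symm.hom ≫ a, fun T => bijective_comp_iso_hom (a := a) ?_ e.symm, fun h => ?_⟩
  swap
  · have := ha h
    exact IsIso.comp_isIso
  have hge : TStructure.t.IsGE ((TStructure.t.truncGT 0).obj W) 1 :=
    TStructure.t.isGE_truncGT_obj ..
  have hge' := TStructure.t.isGE_shift ((TStructure.t.truncGT 0).obj W) 1 (-1) 2
  exact bijective_comp_mor₁ hT (W := (singleFunctor B 0).obj T)
    (fun f => TStructure.t.zero_of_isLE_of_isGE f 0 1 (by omega) inferInstance hge)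
    (fun f => TStructure.t.zero_of_isLE_of_isGE f 0 2 (by omega) inferInstance hge')

lemma exists_reflection_of_isLE (W : DerivedCategory B) (hW : W.IsLE 0) :
    ∃ (R : B) (a : W ⟶ (singleFunctor B 0).obj R),
      ∀ T : B, Function.Bijective (fun f : (singleFunctor B 0).obj R ⟶ (singleFunctor B 0).obj T =>
        a ≫ f) := by
  have hT := TStructure.t.triangleLEGT_distinguished (-1) W
  have hle₀ : TStructure.t.IsLE ((TStructure.t.truncGT (-1)).obj W) 0 := inferInstance
  have hge : TStructure.t.IsGE ((TStructure.t.truncGT (-1)).obj W) 0 :=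
    TStructure.t.isGE_truncGT_obj ..
  obtain ⟨R, ⟨e⟩⟩ := exists_iso_singleFunctor_obj_of_isGE_of_isLE
    ((TStructure.t.truncGT (-1)).obj W) 0
  let a : W ⟶ (TStructure.t.truncGT (-1)).obj W := (TStructure.t.truncGTπ (-1)).app W
  refine ⟨R, a ≫ e.hom, fun T => bijective_iso_hom_comp (a := a) ?_ e⟩
  have hle : TStructure.t.IsLE ((TStructure.t.truncLE (-1)).obj W) (-1) := inferInstance
  have hle' := TStructure.t.isLE_shift ((TStructure.t.truncLE (-1)).obj W) (-1) 1 (-2)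
  exact bijective_mor₂_comp hT (W := (singleFunctor B 0).obj T)
    (fun f => TStructure.t.zero_of_isLE_of_isGE f (-1) 0 (by omega) hle inferInstance)
    (fun f => TStructure.t.zero_of_isLE_of_isGE f (-2) 0 (by omega) hle' inferInstance)

lemma epi_homology_map_single {M N : B} (p : M ⟶ N) [Epi p] :
    Epi ((homologyFunctor B 0).map ((singleFunctor B 0).map p)) := by
  have h := NatIso.naturality_2 (singleFunctorCompHomologyFunctorIso B 0) p
  dsimp only [Functor.comp_map, Functor.id_map] at h
  rw [← h]
  exact @epi_comp _ _ _ _ _ _ inferInstance _ (@epi_comp _ _ _ _ _ _ ‹_› _ inferInstance)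

end Single

/-! ### The adjoints of the two inclusions -/

namespace IsDDecomposition

open DerivedCategory

variable {A : Type u} [Category.{v} A] [Abelian A] [HasDerivedCategory.{w} A]
  {X Y : ObjectProperty A} [IsAbelianSubcategory X] [IsAbelianSubcategory Y]
  [HasDerivedCategory.{w₁} X.FullSubcategory] [HasDerivedCategory.{w₂} Y.FullSubcategory]

/-- Amplitude leaves only `H^1(U)` to kill. Cover it by `Z → U[1]`; effacing the composite to `M[1]`
gives an epimorphism `T → Z` such that `T → U[1]` factors through `V`. By orthogonality it is zero,
yet it is epi on `H^0(U[1]) = H^1(U)`. -/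
lemma isLE_zero_of_isRightEffaceable (h : IsDDecomposition X Y .bounded) {M : A}
    {U : DerivedCategory X.FullSubcategory} (hU : TStructure.t.bounded U)
    {V : DerivedCategory Y.FullSubcategory} (hV : TStructure.t.bounded V)
    {f : (derivedι X).obj U ⟶ (singleFunctor A 0).obj M}
    {g : (singleFunctor A 0).obj M ⟶ (derivedι Y).obj V}
    {δ : (derivedι Y).obj V ⟶ ((derivedι X).obj U)⟦(1 : ℤ)⟧}
    (hT : Triangle.mk f g δ ∈ distTriang (DerivedCategory A)) (hM : IsRightEffaceable X M) :
    U.IsLE 0 := by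
  have hU' : U.IsLE 1 := (h.isLE_of_isLE hT 0 inferInstance).1
  have hle := TStructure.t.isLE_shift U 1 1 0
  obtain ⟨Z, φ, hφ⟩ := exists_single_to_epi_homology (U⟦(1 : ℤ)⟧)
  let φ' : (derivedι X).obj ((singleFunctor X.FullSubcategory 0).obj Z) ⟶
    ((derivedι X).obj U)⟦(1 : ℤ)⟧ :=
      (derivedι X).map φ ≫ ((derivedι X).commShiftIso (1 : ℤ)).hom.app U
  obtain ⟨T', hT', p, hp, hp'⟩ := hM _ Z.property ((derivedιSingle X Z).inv ≫ φ' ≫ f⟦(1 : ℤ)⟧')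
  let T : X.FullSubcategory := ⟨T', hT'⟩
  let p₀ : T ⟶ Z := ObjectProperty.homMk p
  have hp₀ : Epi p₀ := X.ι.epi_of_epi_map (show Epi (X.ι.map p₀) from hp)
  have h₁ : (derivedι X).map ((singleFunctor _ 0).map p₀) ≫ φ' ≫ f⟦(1 : ℤ)⟧' = 0 := by
    have h₂ := derivedιSingle_inv_naturality X p₀
    apply (cancel_epi (derivedιSingle X T).inv).1
    rw [reassoc_of% h₂, comp_zero]
    exact hp'
  obtain ⟨k, hk⟩ := Triangle.coyoneda_exact₁ _ hT
    ((derivedι X).map ((singleFunctor _ 0).map p₀) ≫ φ') ((assoc _ _ _).trans h₁)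
  have hk₀ : k = 0 := h.hom_eq_zero_of_bounded (bounded_single T 0) hV k
  have h₃ : (derivedι X).map ((singleFunctor _ 0).map p₀) ≫ φ' = 0 :=
    hk.trans (by rw [hk₀]; exact zero_comp)
  have h₄ : (singleFunctor _ 0).map p₀ ≫ φ = 0 := by
    apply (h.bijective_left (bounded_single T 0) (ObjectProperty.le_shift _ (1 : ℤ) _ hU)).1
    apply (cancel_mono (((derivedι X).commShiftIso (1 : ℤ)).hom.app U)).1
    rw [Functor.map_comp, assoc, Functor.map_zero, zero_comp]
    exact h₃
  have h₅ := (homologyFunctor _ 0).congr_map h₄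
  rw [Functor.map_comp, Functor.map_zero] at h₅
  have := epi_homology_map_single p₀
  have h₆ : IsZero ((homologyFunctor _ 0).obj (U⟦(1 : ℤ)⟧)) := by
    rw [IsZero.iff_id_eq_zero, ← cancel_epi ((homologyFunctor _ 0).map φ),
      ← cancel_epi ((homologyFunctor _ 0).map ((singleFunctor _ 0).map p₀)), comp_zero, comp_zero,
      comp_id, h₅]
  have h₇ : (U⟦(1 : ℤ)⟧).IsLE (-1) := by
    have hle := (isLE_iff _ _).1 hle
    refine (isLE_iff _ _).2 ?_
    intro n hn
    obtain rfl | hn' := (show (0 : ℤ) ≤ n by omega).eq_or_lt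
    · exact h₆
    · exact hle n hn'
  exact TStructure.t.isLE_of_shift U 0 1 (-1)

/-- `R` is `H^0(U)`. When `M` is effaceable, `U` is concentrated in degree `0`, and the homology
sequence becomes `0 → H^{-1}(V) → R → M → H^0(V) → 0`, identifying kernel and cokernel as objects of
`Y`. -/
lemma exists_coreflection (h : IsDDecomposition X Y .bounded) (M : A) :
    ∃ (R : X.FullSubcategory) (ε : R.obj ⟶ M),
      (∀ T : X.FullSubcategory, Function.Bijective (fun g : T ⟶ R => g.hom ≫ ε)) ∧
        (IsRightEffaceable X M → Y (kernel ε) ∧ Y (cokernel ε)) := by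
  obtain ⟨U, hU, V, hV, f, g, δ, hT⟩ := h.exists_distTriang (bounded_single M 0)
  obtain ⟨R, a, ha, ha'⟩ := exists_coreflection_of_isGE U (h.isGE_of_isGE hT 0 inferInstance).1
  obtain ⟨ε, hε⟩ := (singleFunctor A 0).map_surjective
    ((derivedιSingle X R).inv ≫ (derivedι X).map a ≫ f)
  refine ⟨R, ε, fun T => ?_, fun hM => ?_⟩
  · have h₁ := ((h.bijective_comp_left hU hV hT (bounded_single T 0)).comp (ha T)).comp
      (bijective_singleFunctor_map T R)
    have h₂ : Function.Bijective
        (fun k : T.obj ⟶ M => (derivedιSingle X T).hom ≫ (singleFunctor A 0).map k) :=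
      (derivedιSingle X T).symm.homFromEquiv.bijective.comp (bijective_singleFunctor_map T.obj M)
    refine (Function.Bijective.of_comp_iff' h₂ _).1 ?_
    convert h₁ using 1
    ext k
    have h₃ := derivedιSingle_naturality X k
    dsimp only [Function.comp_apply]
    rw [Functor.map_comp, Functor.map_comp, hε, ← reassoc_of% h₃, Iso.hom_inv_id_assoc, assoc]
  · have hU' := h.isLE_zero_of_isRightEffaceable hU hV hT hM
    have := ha' hU'
    have z₁ : IsZero ((homologyFunctor A (-1)).obj ((singleFunctor A 0).obj M)) :=
      isZero_of_isGE _ 0 (-1) (by omega)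
    have z₂ : IsZero ((homologyFunctor A 1).obj ((derivedι X).obj U)) :=
      (isZero_homologyFunctor_mapDerivedCategory_iff X.ι U 1).2 (isZero_of_isLE _ 0 1 (by omega))
    let e : R.obj ≅ (homologyFunctor A 0).obj ((derivedι X).obj U) :=
      ((singleFunctorCompHomologyFunctorIso A 0).app R.obj).symm ≪≫
        (homologyFunctor A 0).mapIso ((derivedιSingle X R).symm ≪≫ (derivedι X).mapIso (asIso a))
    let e' : M ≅ (homologyFunctor A 0).obj ((singleFunctor A 0).obj M) :=
      ((singleFunctorCompHomologyFunctorIso A 0).app M).symm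
    have he : ε ≫ e'.hom = e.hom ≫ (homologyFunctor A 0).map f := by
      have h₁ : ε ≫ e'.hom = (singleFunctorCompHomologyFunctorIso A 0).inv.app R.obj ≫
          (homologyFunctor A 0).map ((singleFunctor A 0).map ε) :=
        (singleFunctorCompHomologyFunctorIso A 0).inv.naturality ε
      have h₂ : (homologyFunctor A 0).map ((singleFunctor A 0).map ε) = (homologyFunctor A 0).map
          ((derivedιSingle X R).symm ≪≫ (derivedι X).mapIso (asIso a)).hom ≫
            (homologyFunctor A 0).map f :=
        ((homologyFunctor A 0).congr_map (hε.trans (assoc _ _ _).symm)).trans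
          ((homologyFunctor A 0).map_comp _ _)
      rw [h₂] at h₁
      exact h₁.trans (assoc _ _ _).symm
    have h₁ := HomologySequence.exact₁ _ hT (-1) 0 (by omega)
    have : Mono (HomologySequence.δ (Triangle.mk f g δ) (-1) 0 (by omega)) :=
      (HomologySequence.exact₃ _ hT (-1) 0 (by omega)).mono_g (z₁.eq_of_src _ _)
    have h₂ := HomologySequence.exact₂ _ hT 0
    have : Epi ((homologyFunctor A 0).map (Triangle.mk f g δ).mor₂) :=
      (HomologySequence.exact₃ _ hT 0 1 (by omega)).epi_f (z₂.eq_of_tgt _ _)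
    exact ⟨Y.prop_of_iso ((h₁.fIsKernel).conePointUniqueUpToIso (kernelIsKernel _) ≪≫
        (kernel.mapIso _ _ e e' he).symm) (homology_derivedι_obj Y V (-1)),
      Y.prop_of_iso ((h₂.gIsCokernel).coconePointUniqueUpToIso (cokernelIsCokernel _) ≪≫
        (cokernel.mapIso _ _ e e' he).symm) (homology_derivedι_obj Y V 0)⟩

lemma exists_reflection (h : IsDDecomposition X Y .bounded) (M : A) :
    ∃ (R : Y.FullSubcategory) (η : M ⟶ R.obj),
      ∀ T : Y.FullSubcategory, Function.Bijective (fun g : R ⟶ T => η ≫ g.hom) := by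
  obtain ⟨U, hU, V, hV, f, g, δ, hT⟩ := h.exists_distTriang (bounded_single M 0)
  obtain ⟨R, a, ha⟩ := exists_reflection_of_isLE V (h.isLE_of_isLE hT 0 inferInstance).2
  obtain ⟨η, hη⟩ := (singleFunctor A 0).map_surjective
    (g ≫ (derivedι Y).map a ≫ (derivedιSingle Y R).hom)
  refine ⟨R, η, fun T => ?_⟩
  have h₁ := ((h.bijective_comp_right hU hV hT (bounded_single T 0)).comp (ha T)).comp
    (bijective_singleFunctor_map R T)
  have h₂ : Function.Bijective
      (fun k : M ⟶ T.obj => (singleFunctor A 0).map k ≫ (derivedιSingle Y T).inv) :=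
    (derivedιSingle Y T).symm.homToEquiv.bijective.comp (bijective_singleFunctor_map M T.obj)
  refine (Function.Bijective.of_comp_iff' h₂ _).1 ?_
  convert h₁ using 1
  ext k
  have h₃ := derivedιSingle_naturality Y k
  dsimp only [Function.comp_apply]
  rw [Functor.map_comp, Functor.map_comp, hη, assoc, assoc, assoc, ← reassoc_of% h₃,
    Iso.hom_inv_id, comp_id]

lemma isLeftAdjoint (h : IsDDecomposition X Y .bounded) : X.ι.IsLeftAdjoint := by
  choose R ε hε _ using h.exists_coreflection
  exact (adjunctionOfBijectiveRight X.ι R ε (fun c d => hε d c)).isLeftAdjoint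

lemma isRightAdjoint (h : IsDDecomposition X Y .bounded) : Y.ι.IsRightAdjoint := by
  choose L η hη using h.exists_reflection
  exact (adjunctionOfBijectiveLeft Y.ι L η (fun c d => hη d c)).isRightAdjoint

/-- Coreflections are unique up to isomorphism over `M`, so the previous description passes to the
counit of any adjunction. -/
lemma kernel_counit_and_cokernel_counit (h : IsDDecomposition X Y .bounded)
    {r : A ⥤ X.FullSubcategory} (adj : X.ι ⊣ r) {M : A} (hM : IsRightEffaceable X M) :
    Y (kernel (adj.counit.app M)) ∧ Y (cokernel (adj.counit.app M)) := by
  obtain ⟨R, ε, hε, hY⟩ := h.exists_coreflection M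
  obtain ⟨hk, hc⟩ := hY hM
  let ε' : (r.obj M).obj ⟶ M := adj.counit.app M
  obtain ⟨φ, hφ⟩ := (hε (r.obj M)).2 ε'
  let ψ : R ⟶ r.obj M := adj.homEquiv R M ε
  have hψ : ψ.hom ≫ ε' = ε := (adj.homEquiv_counit R M _).symm.trans
    ((adj.homEquiv R M).symm_apply_apply ε)
  let e : r.obj M ≅ R :=
    { hom := φ
      inv := ψ
      hom_inv_id := by
        apply (adj.homEquiv (r.obj M) M).symm.injective
        refine (adj.homEquiv_counit _ _ _).trans (Eq.trans ?_ (adj.homEquiv_counit _ _ _).symm)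
        change (φ.hom ≫ ψ.hom) ≫ ε' = 𝟙 (r.obj M).obj ≫ ε'
        rw [assoc, hψ, id_comp]
        exact hφ
      inv_hom_id := (hε R).1 (by
        change (ψ.hom ≫ φ.hom) ≫ ε = 𝟙 R.obj ≫ ε
        rw [assoc, id_comp]
        exact (_ ≫= hφ).trans hψ) }
  have comm : ε' ≫ (Iso.refl M).hom = (X.ι.mapIso e).hom ≫ ε := (comp_id _).trans hφ.symm
  exact ⟨Y.prop_of_iso (kernel.mapIso _ _ (X.ι.mapIso e) (Iso.refl M) comm).symm hk,
    Y.prop_of_iso (cokernel.mapIso _ _ (X.ι.mapIso e) (Iso.refl M) comm).symm hc⟩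

end IsDDecomposition

/-! ### The decomposition of the unbounded derived category -/

open DerivedCategory

lemma mk_distinguished_of_iso {C : Type u} [Category.{v} C] [HasZeroObject C] [HasShift C ℤ]
    [Preadditive C] [∀ n : ℤ, (shiftFunctor C n).Additive] [Pretriangulated C]
    {X Y Z X' Y' Z' : C} {f : X ⟶ Y} {g : Y ⟶ Z} {h : Z ⟶ X⟦(1 : ℤ)⟧}
    (hT : Triangle.mk f g h ∈ distTriang C) (e₁ : X' ≅ X) (e₂ : Y' ≅ Y) (e₃ : Z' ≅ Z) :
    Triangle.mk (e₁.hom ≫ f ≫ e₂.inv) (e₂.hom ≫ g ≫ e₃.inv) (e₃.hom ≫ h ≫ e₁.inv⟦(1 : ℤ)⟧') ∈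
      distTriang C := by
  have h₁ : (e₁.hom ≫ f ≫ e₂.inv) ≫ e₂.hom = e₁.hom ≫ f := by simp
  have h₂ : (e₂.hom ≫ g ≫ e₃.inv) ≫ e₃.hom = e₂.hom ≫ g := by simp
  have h₃ : (e₃.hom ≫ h ≫ e₁.inv⟦(1 : ℤ)⟧') ≫ e₁.hom⟦(1 : ℤ)⟧' = e₃.hom ≫ h := by
    rw [assoc, assoc, ← Functor.map_comp, Iso.inv_hom_id, CategoryTheory.Functor.map_id, comp_id]
  exact isomorphic_distinguished _ hT _ (Triangle.isoMk _ _ e₁ e₂ e₃ h₁ h₂ h₃)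

section

variable {A : Type u} [Category.{v} A] [Abelian A] [HasDerivedCategory.{w} A]

lemma essImage_derivedι_of_prop (P : ObjectProperty A) [IsAbelianSubcategory P]
    [HasDerivedCategory.{w₁} P.FullSubcategory] (K : CochainComplex A ℤ) (hK : ∀ n, P (K.X n)) :
    (derivedι P).essImage (Q.obj K) := by
  let K' : CochainComplex P.FullSubcategory ℤ := HomologicalComplex.liftObjectProperty P K hK
  let e : (P.ι.mapHomologicalComplex (ComplexShape.up ℤ)).obj K' ≅ K :=
    HomologicalComplex.Hom.isoOfComponents (fun n => Iso.refl _) (fun i j _ => by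
      exact (id_comp _).trans (comp_id _).symm)
  exact ⟨Q.obj K', ⟨P.ι.mapDerivedCategoryFactors.app K' ≪≫ Q.mapIso e⟩⟩

/-- Factor `f` through its image. The two short exact sequences have the kernel, up to shift, and
the cokernel as cones. -/
lemma trW_Q_map (P : ObjectProperty (DerivedCategory A)) [P.IsTriangulated]
    {K L : CochainComplex A ℤ} (f : K ⟶ L) (hk : P (Q.obj (kernel f)))
    (hc : P (Q.obj (cokernel f))) : P.trW (Q.map f) := by
  let S₁ : ShortComplex (CochainComplex A ℤ) := ShortComplex.mk (kernel.ι f)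
    (Abelian.factorThruImage f) (by
      apply (cancel_mono (Abelian.image.ι f)).1
      rw [assoc, Abelian.image.fac, kernel.condition, zero_comp])
  have hS₁ : S₁.ShortExact := ShortComplex.ShortExact.mk'
    (S₁.exact_of_f_is_kernel (isKernelOfComp (Abelian.image.ι f) f (kernelIsKernel f) S₁.zero
      (Abelian.image.fac f)))
    (by dsimp [S₁]; infer_instance) (by dsimp [S₁]; infer_instance)
  let S₂ : ShortComplex (CochainComplex A ℤ) := ShortComplex.mk (Abelian.image.ι f)
    (cokernel.π f) (kernel.condition _)
  have hS₂ : S₂.ShortExact := ShortComplex.ShortExact.mk'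
    (S₂.exact_of_f_is_kernel (kernelIsKernel (cokernel.π f)))
    (by dsimp [S₂]; infer_instance) (by dsimp [S₂]; infer_instance)
  have h₁ : P.trW (Q.map (Abelian.factorThruImage f)) :=
    ObjectProperty.trW.mk' P (triangleOfSES_distinguished hS₁) hk
  have h₂ : P.trW (Q.map (Abelian.image.ι f)) :=
    ObjectProperty.trW.mk P (triangleOfSES_distinguished hS₂) hc
  rw [← Abelian.image.fac f, Q.map_comp]
  exact MorphismProperty.comp_mem _ _ _ h₁ h₂

end

namespace IsDDecomposition

variable {A : Type u} [Category.{v} A] [Abelian A] [HasDerivedCategory.{w} A]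
  {X Y : ObjectProperty A} [IsAbelianSubcategory X] [IsAbelianSubcategory Y]
  [HasDerivedCategory.{w₁} X.FullSubcategory] [HasDerivedCategory.{w₂} Y.FullSubcategory]



lemma fullyFaithful_derivedι_left [EnoughInjectives A] (h : IsDDecomposition X Y .bounded) :
    (derivedι X).Full ∧ (derivedι X).Faithful := by
  obtain ⟨r, ⟨adj⟩⟩ := h.isLeftAdjoint
  have := adj.right_adjoint_additive
  exact (h.isRightAdapted adj).fullyFaithful_mapDerivedCategory adj
    (fun W => h.isRightEffaceable_of_left W.property)

lemma fullyFaithful_derivedι_right [EnoughProjectives A] (h : IsDDecomposition X Y .bounded) :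
    (derivedι Y).Full ∧ (derivedι Y).Faithful := by
  obtain ⟨l, ⟨adj⟩⟩ := h.isRightAdjoint
  have := adj.left_adjoint_additive
  exact (h.isLeftAdapted adj).fullyFaithful_mapDerivedCategory adj
    (fun W => h.isLeftEffaceable_of_right W.property)

lemma isZero_obj_of_right (h : IsDDecomposition X Y .bounded) {r : A ⥤ X.FullSubcategory}
    (adj : X.ι ⊣ r) {N : A} (hN : Y N) : IsZero (r.obj N) := by
  have : ∀ (f : (r.obj N).obj ⟶ N), f = 0 := fun f => by
    apply (singleFunctor A 0).map_injective
    let e := (shiftFunctorZero (DerivedCategory A) ℤ).symm.app ((singleFunctor A 0).obj N)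
    apply (cancel_mono e.hom).1
    rw [(singleFunctor A 0).map_zero, zero_comp]
    exact h.single_hom_eq_zero (r.obj N).property hN 0 _
  rw [IsZero.iff_id_eq_zero]
  apply (adj.homEquiv _ _).symm.injective
  exact (this _).trans (this _).symm

/-- Dévissage is unavailable for unbounded complexes. Instead, write `f` as a fraction with
numerator `g : K → N` and enlarge `N` to an adapted `N'`. Since `r` kills `L` termwise and preserves
the quasi-isomorphism `L → N'`, `r N'` is acyclic; and `K → N'` factors through `i r N'`. -/
lemma derivedι_hom_eq_zero [EnoughInjectives A] (h : IsDDecomposition X Y .bounded)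
    {U : DerivedCategory X.FullSubcategory} {V : DerivedCategory Y.FullSubcategory}
    (f : (derivedι X).obj U ⟶ (derivedι Y).obj V) : f = 0 := by
  obtain ⟨K, ⟨eK⟩⟩ : ∃ K : CochainComplex X.FullSubcategory ℤ, Nonempty (Q.obj K ≅ U) :=
    ⟨_, ⟨Q.objObjPreimageIso U⟩⟩
  obtain ⟨L, ⟨eL⟩⟩ : ∃ L : CochainComplex Y.FullSubcategory ℤ, Nonempty (Q.obj L ≅ V) :=
    ⟨_, ⟨Q.objObjPreimageIso V⟩⟩
  let i := X.ι.mapHomologicalComplex (ComplexShape.up ℤ)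
  let j := Y.ι.mapHomologicalComplex (ComplexShape.up ℤ)
  let e₁ : Q.obj (i.obj K) ≅ (derivedι X).obj U :=
    (X.ι.mapDerivedCategoryFactors.app K).symm ≪≫ (derivedι X).mapIso eK
  let e₂ : Q.obj (j.obj L) ≅ (derivedι Y).obj V :=
    (Y.ι.mapDerivedCategoryFactors.app L).symm ≪≫ (derivedι Y).mapIso eL
  suffices ∀ f : Q.obj (i.obj K) ⟶ Q.obj (j.obj L), f = 0 by
    apply (cancel_mono e₂.inv).1
    apply (cancel_epi e₁.hom).1
    rw [zero_comp, comp_zero]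
    exact this _
  intro f
  obtain ⟨r, ⟨adj⟩⟩ := h.isLeftAdjoint
  have := adj.right_adjoint_additive
  have := adj.rightAdjoint_preservesLimits
  have : PreservesFiniteLimits r := inferInstance
  have hP := h.isRightAdapted adj
  obtain ⟨N, g, s, hs, rfl⟩ := left_fac f
  obtain ⟨N', t, ht, hN'⟩ := hP.exists_resolution N
  rw [isIso_Q_map_iff_quasiIso] at hs
  let r' := r.mapHomologicalComplex (ComplexShape.up ℤ)
  have hq : QuasiIso (r'.map (s ≫ t)) := hP.quasiIso_map (s ≫ t) inferInstance
    (fun n => h.isRightEffaceable_of_right (L.X n).property) hN'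
  have hz : IsZero (r'.obj (j.obj L)) := by
    rw [IsZero.iff_id_eq_zero]
    ext n : 1
    exact (h.isZero_obj_of_right adj (L.X n).property).eq_of_src _ _
  have hz' : IsZero (Q.obj (r'.obj N')) :=
    (Q.map_isZero hz).of_iso (@asIso _ _ _ _ _ ((isIso_Q_map_iff_quasiIso _ _).2 hq)).symm
  have hz'' : IsZero (Q.obj (i.obj (r'.obj N'))) :=
    ((derivedι X).map_isZero hz').of_iso (X.ι.mapDerivedCategoryFactors.app _).symm
  have hg : Q.map (g ≫ t) = 0 := by
    have fac := ((mapComplexAdjunction adj).homEquiv_counit (g :=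
      (mapComplexAdjunction adj).homEquiv _ _ (g ≫ t))).symm.trans
        (((mapComplexAdjunction adj).homEquiv _ _).symm_apply_apply _)
    rw [← fac, Q.map_comp]
    refine (?_ =≫ _).trans zero_comp
    exact hz''.eq_of_tgt _ _
  have hg' : Q.map g = 0 := by
    apply (cancel_mono (Q.map t)).1
    rw [← Q.map_comp, hg, zero_comp]
  rw [hg', zero_comp]

/-- For an adapted representative `N'` of `M`, the counit `i r N' → N'` has kernel and cokernel with
terms in `Y`. Its cone lies in the essential image of the derived category of `Y`, a triangulated
subcategory because the inclusion is fully faithful. -/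
lemma exists_derivedι_distTriang [EnoughInjectives A] [EnoughProjectives A]
    (h : IsDDecomposition X Y .bounded)
    (M : DerivedCategory A) :
    ∃ (U : DerivedCategory X.FullSubcategory) (V : DerivedCategory Y.FullSubcategory)
      (f : (derivedι X).obj U ⟶ M) (g : M ⟶ (derivedι Y).obj V)
      (h : (derivedι Y).obj V ⟶ ((derivedι X).obj U)⟦(1 : ℤ)⟧),
      Triangle.mk f g h ∈ distTriang (DerivedCategory A) := by
  obtain ⟨N, ⟨eN⟩⟩ : ∃ K : CochainComplex A ℤ, Nonempty (Q.obj K ≅ M) :=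
    ⟨_, ⟨Q.objObjPreimageIso M⟩⟩
  obtain ⟨r, ⟨adj⟩⟩ := h.isLeftAdjoint
  have := adj.right_adjoint_additive
  obtain ⟨N', t, ht, hN'⟩ := (h.isRightAdapted adj).exists_resolution N
  let e : Q.obj N' ≅ M := (asIso (Q.map t)).symm ≪≫ eN
  obtain ⟨_, _⟩ := h.fullyFaithful_derivedι_right
  let ε := (mapComplexAdjunction adj).counit.app N'
  have hY (n : ℤ) := h.kernel_counit_and_cokernel_counit adj (hN' n)
  let ev := HomologicalComplex.eval A (ComplexShape.up ℤ)
  have hε : (derivedι Y).essImage.trW (Q.map ε) := trW_Q_map _ ε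
    (essImage_derivedι_of_prop Y _ (fun n =>
      Y.prop_of_iso (PreservesKernel.iso (ev n) ε).symm (hY n).1))
    (essImage_derivedι_of_prop Y _ (fun n =>
      Y.prop_of_iso (PreservesCokernel.iso (ev n) ε).symm (hY n).2))
  obtain ⟨Z, g, δ, hT, V, ⟨eV⟩⟩ := hε
  exact ⟨_, V, _, _, _, mk_distinguished_of_iso hT (X.ι.mapDerivedCategoryFactors.app
    ((r.mapHomologicalComplex (ComplexShape.up ℤ)).obj N')) e.symm eV⟩

end IsDDecomposition

/-! ### Formal construction of the half recollement -/

section Recollement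

variable {𝒳 𝒟 𝒴 : Type*} [Category* 𝒳] [Category* 𝒟] [Category* 𝒴]
    [HasZeroObject 𝒳] [HasShift 𝒳 ℤ] [Preadditive 𝒳]
    [∀ n : ℤ, (shiftFunctor 𝒳 n).Additive] [Pretriangulated 𝒳]
    [HasZeroObject 𝒟] [HasShift 𝒟 ℤ] [Preadditive 𝒟]
    [∀ n : ℤ, (shiftFunctor 𝒟 n).Additive] [Pretriangulated 𝒟]
    [HasZeroObject 𝒴] [HasShift 𝒴 ℤ] [Preadditive 𝒴]
    [∀ n : ℤ, (shiftFunctor 𝒴 n).Additive] [Pretriangulated 𝒴]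
    (i : 𝒳 ⥤ 𝒟) (j : 𝒴 ⥤ 𝒟)
    [i.CommShift ℤ] [j.CommShift ℤ] [i.IsTriangulated] [j.IsTriangulated]
    [i.Full] [i.Faithful] [j.Full] [j.Faithful]

/-- Two orthogonal triangulated subcategories which generate by distinguished triangles form a
lower half recollement. -/
lemma exists_lowerHalfRecollement (h₀ : ∀ (U : 𝒳) (V : 𝒴) (f : i.obj U ⟶ j.obj V), f = 0)
    (h₁ : ∀ D : 𝒟, ∃ (U : 𝒳) (V : 𝒴) (f : i.obj U ⟶ D) (g : D ⟶ j.obj V)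
      (h : j.obj V ⟶ (i.obj U)⟦(1 : ℤ)⟧), Triangle.mk f g h ∈ distTriang 𝒟) :
    ∃ (R : 𝒟 ⥤ 𝒳) (_ : R.CommShift ℤ) (L : 𝒟 ⥤ 𝒴) (_ : L.CommShift ℤ)
      (H : LowerHalfRecollement i R L j), H.adjRight.CommShift ℤ ∧ H.adjLeft.CommShift ℤ := by
  choose U V f g h hT using h₁
  have h₂ (U : 𝒳) (V : 𝒴) (k : i.obj U ⟶ (j.obj V)⟦(-1 : ℤ)⟧) : k = 0 := by
    rw [← cancel_mono ((j.commShiftIso (-1 : ℤ)).inv.app V), zero_comp]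
    exact h₀ _ _ _
  have h₃ (U : 𝒳) (V : 𝒴) (k : (i.obj U)⟦(1 : ℤ)⟧ ⟶ j.obj V) : k = 0 := by
    rw [← cancel_epi ((i.commShiftIso (1 : ℤ)).hom.app U), comp_zero]
    exact h₀ _ _ _
  have hf (c : 𝒳) (d : 𝒟) : Function.Bijective (fun k : c ⟶ U d => i.map k ≫ f d) :=
    (bijective_comp_mor₁ (hT d) (h₀ _ _) (h₂ c (V d))).comp ⟨i.map_injective, i.map_surjective⟩
  have hg (c : 𝒴) (d : 𝒟) : Function.Bijective (fun k : V d ⟶ c => g d ≫ j.map k) :=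
    (bijective_mor₂_comp (hT d) (fun k => h₀ _ _ k) (fun k => h₃ (U d) c k)).comp
        ⟨j.map_injective, j.map_surjective⟩
  let adj₁ := adjunctionOfBijectiveRight i U f hf
  let adj₂ := adjunctionOfBijectiveLeft j V g hg
  -- The shift structures on the adjoints are transported along the adjunctions; this choice makes
  -- the mates below compatible with shifts.
  let : (rightAdjointOfBijective i U f hf).CommShift ℤ := adj₁.rightAdjointCommShift ℤ
  let : (leftAdjointOfBijective j V g hg).CommShift ℤ := adj₂.leftAdjointCommShift ℤ
  have hadj₁ : adj₁.CommShift ℤ := adj₁.commShift_of_leftAdjoint ℤ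
  have hadj₂ : adj₂.CommShift ℤ := adj₂.commShift_of_rightAdjoint ℤ
  have z₁ (M : 𝒳) : IsZero ((leftAdjointOfBijective j V g hg).obj (i.obj M)) := by
    rw [IsZero.iff_id_eq_zero]
    apply (adj₂.homEquiv _ _).injective
    exact (h₀ _ _ _).trans (h₀ _ _ _).symm
  have z₂ (N : 𝒴) : IsZero ((rightAdjointOfBijective i U f hf).obj (j.obj N)) := by
    rw [IsZero.iff_id_eq_zero]
    apply (adj₁.homEquiv _ _).symm.injective
    exact (h₀ _ _ _).trans (h₀ _ _ _).symm
  refine ⟨_, inferInstance, _, inferInstance,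
    { triangulated_i := inferInstance
      triangulated_R := adj₁.isTriangulated_rightAdjoint
      triangulated_L := adj₂.isTriangulated_leftAdjoint
      triangulated_j := inferInstance
      full_i := inferInstance
      faithful_i := inferInstance
      full_j := inferInstance
      faithful_j := inferInstance
      adjRight := adj₁
      adjLeft := adj₂
      isZero_L_i := z₁
      isZero_R_j := z₂
      exists_triangle D := ⟨h D, ?_⟩ }, hadj₁, hadj₂⟩
  have e₁ : adj₁.counit.app D = f D := adjunctionOfBijectiveRight_counit_app i U f hf D
  have e₂ : adj₂.unit.app D = g D := adjunctionOfBijectiveLeft_unit_app j V g hg D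
  rw [e₁, e₂]
  exact hT D

end Recollement

/-! ### Restriction to boundedness conditions -/

section Star

open DerivedCategory

variable {A : Type u₁} [Category.{v₁} A] [Abelian A] {B : Type u₂} [Category.{v₂} B] [Abelian B]
  [HasDerivedCategory.{w₁} A] [HasDerivedCategory.{w₂} B] (F : A ⥤ B) [F.Additive]
  [PreservesFiniteLimits F] [PreservesFiniteColimits F] (s : Bound)

instance : (mapDStar F s).IsTriangulated := by
  dsimp only [mapDStar]
  infer_instance

instance [F.mapDerivedCategory.Full] : (mapDStar F s).Full := by
  dsimp only [mapDStar]
  infer_instance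

instance [F.mapDerivedCategory.Faithful] : (mapDStar F s).Faithful := by
  dsimp only [mapDStar]
  infer_instance

lemma dProp_of_isGE_of_isLE {U : DerivedCategory A} {M : DerivedCategory B}
    (hge : ∀ a, M.IsGE a → ∃ b, U.IsGE b) (hle : ∀ a, M.IsLE a → ∃ b, U.IsLE b)
    (hM : dProp B s M) : dProp A s U := by
  have hge' (h : (TStructure.t (C := B)).plus M) : (TStructure.t (C := A)).plus U := by
    obtain ⟨a, ha⟩ := h
    obtain ⟨b, hb⟩ := hge a ha
    exact ⟨b, hb⟩
  have hle' (h : (TStructure.t (C := B)).minus M) : (TStructure.t (C := A)).minus U := by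
    obtain ⟨a, ha⟩ := h
    obtain ⟨b, hb⟩ := hle a ha
    exact ⟨b, hb⟩
  cases s
  exacts [⟨hge' hM.1, hle' hM.2⟩, hge' hM, hle' hM, trivial]

lemma mk_distinguished_dStar {M₁ M₂ M₃ : DStar A s} {f : M₁.obj ⟶ M₂.obj} {g : M₂.obj ⟶ M₃.obj}
    {h : M₃.obj ⟶ M₁.obj⟦(1 : ℤ)⟧} (hT : Triangle.mk f g h ∈ distTriang (DerivedCategory A)) :
    ∃ h' : M₃ ⟶ M₁⟦(1 : ℤ)⟧, Triangle.mk (ObjectProperty.homMk f : M₁ ⟶ M₂)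
      (ObjectProperty.homMk g) h' ∈ distTriang (DStar A s) := by
  let e := (dProp A s).ι.commShiftIso (1 : ℤ)
  -- The shift of the full subcategory agrees with the ambient one only through `commShiftIso`, so
  -- the third morphism is corrected by it.
  let k : M₃.obj ⟶ ((dProp A s).ι.obj (M₁⟦(1 : ℤ)⟧)) := h ≫ e.inv.app M₁
  refine ⟨ObjectProperty.homMk k, ((dProp A s).ι.map_distinguished_iff _).1 ?_⟩
  have hk : k ≫ e.hom.app M₁ = h :=
    (assoc _ _ _).trans ((h ≫= e.inv_hom_id_app M₁).trans (comp_id h))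
  refine isomorphic_distinguished _ hT _
    (Triangle.isoMk _ _ (Iso.refl _) (Iso.refl _) (Iso.refl _) ?_ ?_ ?_)
  · exact (comp_id _).trans (id_comp _).symm
  · exact (comp_id _).trans (id_comp _).symm
  · refine (_ ≫= (shiftFunctor _ (1 : ℤ)).map_id _).trans ((comp_id _).trans ?_)
    exact hk.trans (id_comp _).symm

end Star

/-! ### The half recollement for each boundedness condition -/

namespace IsDDecomposition

open DerivedCategory

variable {A : Type u} [Category.{v} A] [Abelian A] [HasDerivedCategory.{w} A]
  [EnoughInjectives A] [EnoughProjectives A]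
  {X Y : ObjectProperty A} [IsAbelianSubcategory X] [IsAbelianSubcategory Y]
  [HasDerivedCategory.{w₁} X.FullSubcategory] [HasDerivedCategory.{w₂} Y.FullSubcategory]

/-- A derived decomposition induces lower half recollements between derived categories
with an arbitrary boundedness condition. -/
lemma exists_lowerHalfRecollement (h : IsDDecomposition X Y .bounded) (s : Bound) :
    ∃ (R : DStar A s ⥤ DStar X.FullSubcategory s) (_ : R.CommShift ℤ)
      (L : DStar A s ⥤ DStar Y.FullSubcategory s) (_ : L.CommShift ℤ)
      (H : LowerHalfRecollement (mapDStar X.ι s) R L (mapDStar Y.ι s)),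
        H.adjRight.CommShift ℤ ∧ H.adjLeft.CommShift ℤ := by
  obtain ⟨_, _⟩ := h.fullyFaithful_derivedι_left
  obtain ⟨_, _⟩ := h.fullyFaithful_derivedι_right
  refine DerivedDecomposition.exists_lowerHalfRecollement _ _ (fun U V f => ?_) (fun D => ?_)
  · ext
    exact h.derivedι_hom_eq_zero f.hom
  · obtain ⟨U, V, f, g, δ, hT⟩ := h.exists_derivedι_distTriang D.obj
    -- The amplitude estimates bound `U` and `V` by the bounds of `D`.
    let U' : DStar X.FullSubcategory s := ⟨U, dProp_of_isGE_of_isLE s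
      (fun a ha => ⟨_, (h.isGE_of_isGE hT a ha).1⟩) (fun a ha => ⟨_, (h.isLE_of_isLE hT a ha).1⟩)
      D.property⟩
    let V' : DStar Y.FullSubcategory s := ⟨V, dProp_of_isGE_of_isLE s
      (fun a ha => ⟨_, (h.isGE_of_isGE hT a ha).2⟩) (fun a ha => ⟨_, (h.isLE_of_isLE hT a ha).2⟩)
      D.property⟩
    obtain ⟨δ', hδ'⟩ := mk_distinguished_dStar (M₁ := (mapDStar X.ι s).obj U') (M₂ := D)
      (M₃ := (mapDStar Y.ι s).obj V') s hT
    exact ⟨U', V', _, _, δ', hδ'⟩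

end IsDDecomposition

/-! ### Descending natural transformations along a functor with fractions -/

section Whisker

variable {C D E : Type*} [Category* C] [Category* D] [Category* E]

/-- The morphisms in the target of `F` are fractions of morphisms in the source. -/
def HasFractions (F : C ⥤ D) : Prop :=
  ∀ ⦃X Y : C⦄ (f : F.obj X ⟶ F.obj Y),
    (∃ (Y' : C) (g : X ⟶ Y') (t : Y ⟶ Y'), IsIso (F.map t) ∧ f ≫ F.map t = F.map g) ∨
      ∃ (X' : C) (g : X' ⟶ Y) (t : X' ⟶ X), IsIso (F.map t) ∧ F.map t ≫ f = F.map g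

/-- Naturality for morphisms `F.map g` extends to their fractions by cancelling the inverted map,
hence to all morphisms between objects in the image; chosen preimages extend it to `D`. -/
lemma exists_whiskerLeft_eq (F : C ⥤ D) [F.EssSurj] (hF : HasFractions F) {G H : D ⥤ E}
    (τ : F ⋙ G ⟶ F ⋙ H) : ∃ σ : G ⟶ H, ∀ X, σ.app (F.obj X) = τ.app X := by
  have key ⦃X Y : C⦄ (f : F.obj X ⟶ F.obj Y) : G.map f ≫ τ.app Y = τ.app X ≫ H.map f := by
    have nat {X Y : C} (g : X ⟶ Y) : G.map (F.map g) ≫ τ.app Y = τ.app X ≫ H.map (F.map g) :=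
      τ.naturality g
    obtain ⟨Y', g, t, _, ht⟩ | ⟨X', g, t, _, ht⟩ := hF f
    · rw [← cancel_mono (H.map (F.map t)), assoc, assoc, ← nat, ← G.map_comp_assoc, ht, nat,
        ← H.map_comp, ht]
    · rw [← cancel_epi (G.map (F.map t)), ← G.map_comp_assoc, ht, nat, ← ht, H.map_comp,
        ← assoc, ← nat, assoc]
  let e (d : D) := F.objObjPreimageIso d
  refine ⟨{ app d := G.map (e d).inv ≫ τ.app _ ≫ H.map (e d).hom, naturality := ?_ }, ?_⟩
  · intro d d' f
    have h := key ((e d).hom ≫ f ≫ (e d').inv)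
    rw [← cancel_epi (G.map (e d).hom), ← cancel_mono (H.map (e d').inv)]
    simpa using h
  · intro X
    have h := key (e (F.obj X)).hom
    dsimp only
    rw [← h, ← G.map_comp_assoc, Iso.inv_hom_id, G.map_id, id_comp]

end Whisker

/-! ### Adjoints as Kan extensions -/

section Kan

variable {KA KB DA DB : Type*} [Category* KA] [Category* KB] [Category* DA] [Category* DB]

section Right

variable {QA : KA ⥤ DA} {QB : KB ⥤ DB} {F : KB ⥤ KA} {G : KA ⥤ KB} {F' : DB ⥤ DA} {G' : DA ⥤ DB}
  (φ : F ⋙ QA ≅ QB ⋙ F') (adj : F ⊣ G) (adj' : F' ⊣ G')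

/-- The canonical natural transformation between right adjoints. -/
def rightMate : G ⋙ QB ⟶ QA ⋙ G' :=
  (G ⋙ QB).rightUnitor.inv ≫ Functor.whiskerLeft (G ⋙ QB) adj'.unit ≫
    (Functor.associator (G ⋙ QB) F' G').inv ≫
      Functor.whiskerRight ((Functor.associator G QB F').hom ≫ Functor.whiskerLeft G φ.inv ≫
        (Functor.associator G F QA).inv ≫ Functor.whiskerRight adj.counit QA ≫
          QA.leftUnitor.hom) G'

lemma rightMate_app (K : KA) : (rightMate φ adj adj').app K =
    adj'.unit.app (QB.obj (G.obj K)) ≫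
      G'.map (φ.inv.app (G.obj K) ≫ QA.map (adj.counit.app K)) := by
  simp [rightMate]

lemma map_rightMate_app_counit (K : KA) :
    F'.map ((rightMate φ adj adj').app K) ≫ adj'.counit.app (QA.obj K) =
      φ.inv.app (G.obj K) ≫ QA.map (adj.counit.app K) := by
  rw [rightMate_app, F'.map_comp, assoc]
  have h := adj'.counit.naturality (φ.inv.app (G.obj K) ≫ QA.map (adj.counit.app K))
  refine (_ ≫= h).trans ?_
  exact adj'.left_triangle_components_assoc _ _

lemma map_unit_rightMate_app (L : KB) :
    QB.map (adj.unit.app L) ≫ (rightMate φ adj adj').app (F.obj L) ≫ G'.map (φ.hom.app L) =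
      adj'.unit.app (QB.obj L) := by
  have h₁ : F'.map (QB.map (adj.unit.app L)) ≫ φ.inv.app (G.obj (F.obj L)) =
      φ.inv.app L ≫ QA.map (F.map (adj.unit.app L)) := φ.inv.naturality (adj.unit.app L)
  have h₂ : QB.map (adj.unit.app L) ≫ adj'.unit.app (QB.obj (G.obj (F.obj L))) =
      adj'.unit.app (QB.obj L) ≫ G'.map (F'.map (QB.map (adj.unit.app L))) :=
    adj'.unit.naturality (QB.map (adj.unit.app L))
  rw [rightMate_app, assoc, ← assoc, h₂, assoc, ← G'.map_comp, ← G'.map_comp, assoc,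
    reassoc_of% h₁, ← QA.map_comp_assoc, adj.left_triangle_components, QA.map_id]
  dsimp
  rw [id_comp, Iso.inv_hom_id_app]
  exact (_ ≫= G'.map_id _).trans (comp_id _)

/-- Transposing along both adjunctions, maps `G' ⟶ H` are maps `𝟭 ⟶ F' ⋙ H`, while maps `G ⋙ QB ⟶ QA
⋙ H` are maps `QB ⟶ F ⋙ QA ⋙ H`, and the latter target is `QB ⋙ F' ⋙ H`. Fractions identify the two
sets. -/
lemma isLeftKanExtension_rightMate [QB.EssSurj] (hQB : HasFractions QB) :
    G'.IsLeftKanExtension (rightMate φ adj adj') := by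
  let α := rightMate φ adj adj'
  have fac (H : DA ⥤ DB) (β : G ⋙ QB ⟶ QA ⋙ H) :
      ∃ σ : G' ⟶ H, ∀ K, α.app K ≫ σ.app (QA.obj K) = β.app K := by
    -- `γ` is the transpose of `β` along `F ⊣ G`; it descends to `γ'` on `DB`, and `σ` is the
    -- transpose of `γ'` along `F' ⊣ G'`.
    let γ : QB ⋙ 𝟭 DB ⟶ QB ⋙ F' ⋙ H :=
      { app L := QB.map (adj.unit.app L) ≫ β.app (F.obj L) ≫ H.map (φ.hom.app L)
        naturality L L' f := by
          have h₁ : QB.map f ≫ QB.map (adj.unit.app L') =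
              QB.map (adj.unit.app L) ≫ QB.map (G.map (F.map f)) := by
            rw [← QB.map_comp, ← QB.map_comp]
            exact QB.congr_map (adj.unit.naturality f)
          have h₂ : QB.map (G.map (F.map f)) ≫ β.app (F.obj L') =
              β.app (F.obj L) ≫ H.map (QA.map (F.map f)) := β.naturality (F.map f)
          have h₃ : QA.map (F.map f) ≫ φ.hom.app L' = φ.hom.app L ≫ F'.map (QB.map f) :=
            φ.hom.naturality f
          change QB.map f ≫ QB.map (adj.unit.app L') ≫ β.app (F.obj L') ≫ H.map (φ.hom.app L') =
            (QB.map (adj.unit.app L) ≫ β.app (F.obj L) ≫ H.map (φ.hom.app L)) ≫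
              H.map (F'.map (QB.map f))
          rw [reassoc_of% h₁, reassoc_of% h₂, ← H.map_comp, h₃, assoc, assoc, ← H.map_comp] }
    obtain ⟨γ', hγ'⟩ := exists_whiskerLeft_eq QB hQB γ
    let σ : G' ⟶ H :=
      { app d := γ'.app (G'.obj d) ≫ H.map (adj'.counit.app d)
        naturality d d' f := by
          have h₁ : G'.map f ≫ γ'.app (G'.obj d') =
            γ'.app (G'.obj d) ≫ H.map (F'.map (G'.map f)) := γ'.naturality (G'.map f)
          have h₂ : F'.map (G'.map f) ≫ adj'.counit.app d' = adj'.counit.app d ≫ f :=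
            adj'.counit.naturality f
          rw [reassoc_of% h₁, ← H.map_comp, h₂, assoc, ← H.map_comp] }
    refine ⟨σ, fun K => ?_⟩
    have h₁ : α.app K ≫ γ'.app (G'.obj (QA.obj K)) =
      γ'.app (QB.obj (G.obj K)) ≫ H.map (F'.map (α.app K)) := γ'.naturality (α.app K)
    have h₂ : β.app (F.obj (G.obj K)) ≫ H.map (QA.map (adj.counit.app K)) =
      QB.map (G.map (adj.counit.app K)) ≫ β.app K := (β.naturality (adj.counit.app K)).symm
    have h₃ : γ'.app (QB.obj (G.obj K)) = QB.map (adj.unit.app (G.obj K)) ≫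
      β.app (F.obj (G.obj K)) ≫ H.map (φ.hom.app (G.obj K)) := hγ' (G.obj K)
    have h₄ : F'.map (α.app K) ≫ adj'.counit.app (QA.obj K) =
      φ.inv.app (G.obj K) ≫ QA.map (adj.counit.app K) := map_rightMate_app_counit φ adj adj' K
    change α.app K ≫ γ'.app (G'.obj (QA.obj K)) ≫ H.map (adj'.counit.app (QA.obj K)) = β.app K
    rw [reassoc_of% h₁, ← H.map_comp, h₄, h₃, assoc, assoc, ← H.map_comp, Iso.hom_inv_id_app_assoc,
      h₂, ← QB.map_comp_assoc, adj.right_triangle_components]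
    exact (QB.map_id _ =≫ _).trans (id_comp _)
  have uniq (H : DA ⥤ DB) (σ τ : G' ⟶ H)
      (h : ∀ K, α.app K ≫ σ.app (QA.obj K) = α.app K ≫ τ.app (QA.obj K)) : σ = τ := by
    -- The transpose of `σ` at `QB.obj L` depends only on `σ` composed with the mate; `h₂` extends
    -- this to all objects by essential surjectivity, and `h₃` recovers `σ` from its transpose.
    have h₁ (σ : G' ⟶ H) (L : KB) : adj'.unit.app (QB.obj L) ≫ σ.app (F'.obj (QB.obj L)) =
        QB.map (adj.unit.app L) ≫ (α.app (F.obj L) ≫ σ.app (QA.obj (F.obj L))) ≫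
          H.map (φ.hom.app L) := by
      have h₀ : G'.map (φ.hom.app L) ≫ σ.app (F'.obj (QB.obj L)) =
        σ.app (QA.obj (F.obj L)) ≫ H.map (φ.hom.app L) := σ.naturality (φ.hom.app L)
      rw [assoc, ← h₀, ← map_unit_rightMate_app φ adj adj' L, assoc, assoc]
    have h₂ (m : DB) : adj'.unit.app m ≫ σ.app (F'.obj m) =
        adj'.unit.app m ≫ τ.app (F'.obj m) := by
      let e := QB.objObjPreimageIso m
      have h₃ (σ : G' ⟶ H) : e.hom ≫ adj'.unit.app m ≫ σ.app (F'.obj m) =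
          (adj'.unit.app _ ≫ σ.app (F'.obj (QB.obj (QB.objPreimage m)))) ≫
              H.map (F'.map e.hom) := by
        have n₁ : e.hom ≫ adj'.unit.app m = adj'.unit.app _ ≫ G'.map (F'.map e.hom) :=
          adj'.unit.naturality e.hom
        have n₂ : G'.map (F'.map e.hom) ≫ σ.app (F'.obj m) =
          σ.app _ ≫ H.map (F'.map e.hom) := σ.naturality (F'.map e.hom)
        rw [reassoc_of% n₁, n₂, assoc]
      rw [← cancel_epi e.hom, h₃, h₃, h₁, h₁, h]
    ext d
    have h₃ (σ : G' ⟶ H) : σ.app d =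
        (adj'.unit.app (G'.obj d) ≫ σ.app (F'.obj (G'.obj d))) ≫ H.map (adj'.counit.app d) := by
      have n₁ : G'.map (adj'.counit.app d) ≫ σ.app d =
        σ.app (F'.obj (G'.obj d)) ≫ H.map (adj'.counit.app d) := σ.naturality _
      rw [assoc, ← n₁, adj'.right_triangle_components_assoc]
    rw [h₃ σ, h₃ τ, h₂]
  refine ⟨⟨IsInitial.ofUniqueHom
    (fun Z => StructuredArrow.homMk (fac Z.right Z.hom).choose ?_) (fun Z m => ?_)⟩⟩
  · ext K
    exact (fac Z.right Z.hom).choose_spec K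
  · apply StructuredArrow.hom_ext
    refine uniq _ _ _ (fun K => ?_)
    refine Eq.trans ?_ ((fac Z.right Z.hom).choose_spec K).symm
    exact NatTrans.congr_app (StructuredArrow.w m) K

end Right

section Left

variable {QA : KA ⥤ DA} {QB : KB ⥤ DB} {F : KB ⥤ KA} {G : KA ⥤ KB} {F' : DB ⥤ DA} {G' : DA ⥤ DB}
  (φ : F ⋙ QA ≅ QB ⋙ F') (adj : G ⊣ F) (adj' : G' ⊣ F')

/-- The canonical natural transformation between left adjoints. -/
def leftMate : QA ⋙ G' ⟶ G ⋙ QB :=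
  Functor.whiskerRight (QA.leftUnitor.inv ≫ Functor.whiskerRight adj.unit QA ≫
    (Functor.associator G F QA).hom ≫ Functor.whiskerLeft G φ.hom ≫
      (Functor.associator G QB F').inv) G' ≫ (Functor.associator (G ⋙ QB) F' G').hom ≫
        Functor.whiskerLeft (G ⋙ QB) adj'.counit ≫ (G ⋙ QB).rightUnitor.hom

lemma leftMate_app (K : KA) : (leftMate φ adj adj').app K =
    G'.map (QA.map (adj.unit.app K) ≫ φ.hom.app (G.obj K)) ≫
      adj'.counit.app (QB.obj (G.obj K)) := by
  simp [leftMate]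

lemma unit_app_map_leftMate_app (K : KA) :
    adj'.unit.app (QA.obj K) ≫ F'.map ((leftMate φ adj adj').app K) =
      QA.map (adj.unit.app K) ≫ φ.hom.app (G.obj K) := by
  rw [leftMate_app, F'.map_comp]
  have h := adj'.unit.naturality (QA.map (adj.unit.app K) ≫ φ.hom.app (G.obj K))
  refine (assoc _ _ _).symm.trans ((h.symm =≫ _).trans ((assoc _ _ _).trans ?_))
  exact (_ ≫= adj'.right_triangle_components _).trans (comp_id _)

lemma leftMate_app_map_counit (L : KB) :
    G'.map (φ.inv.app L) ≫ (leftMate φ adj adj').app (F.obj L) ≫ QB.map (adj.counit.app L) =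
      adj'.counit.app (QB.obj L) := by
  have h₁ : φ.hom.app (G.obj (F.obj L)) ≫ F'.map (QB.map (adj.counit.app L)) =
      QA.map (F.map (adj.counit.app L)) ≫ φ.hom.app L :=
    (φ.hom.naturality (adj.counit.app L)).symm
  have h₂ : adj'.counit.app (QB.obj (G.obj (F.obj L))) ≫ QB.map (adj.counit.app L) =
      G'.map (F'.map (QB.map (adj.counit.app L))) ≫ adj'.counit.app (QB.obj L) :=
    (adj'.counit.naturality (QB.map (adj.counit.app L))).symm
  rw [leftMate_app, assoc, h₂, ← G'.map_comp_assoc, ← G'.map_comp_assoc, assoc,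
    assoc, h₁, ← QA.map_comp_assoc, adj.right_triangle_components]
  have h₃ : φ.inv.app L ≫ QA.map (𝟙 (F.obj L)) ≫ φ.hom.app L = 𝟙 _ := by
    rw [QA.map_id]
    exact (_ ≫= id_comp _).trans (φ.inv_hom_id_app L)
  rw [h₃]
  exact (G'.map_id _ =≫ _).trans (id_comp _)

lemma isRightKanExtension_leftMate [QB.EssSurj] (hQB : HasFractions QB) :
    G'.IsRightKanExtension (leftMate φ adj adj') := by
  let α := leftMate φ adj adj'
  have fac (H : DA ⥤ DB) (β : QA ⋙ H ⟶ G ⋙ QB) :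
      ∃ σ : H ⟶ G', ∀ K, σ.app (QA.obj K) ≫ α.app K = β.app K := by
    let γ : QB ⋙ F' ⋙ H ⟶ QB ⋙ 𝟭 DB :=
      { app L := H.map (φ.inv.app L) ≫ β.app (F.obj L) ≫ QB.map (adj.counit.app L)
        naturality L L' f := by
          have h₁ : QB.map (G.map (F.map f)) ≫ QB.map (adj.counit.app L') =
              QB.map (adj.counit.app L) ≫ QB.map f := by
            rw [← QB.map_comp, ← QB.map_comp]
            exact QB.congr_map (adj.counit.naturality f)
          have h₂ : H.map (QA.map (F.map f)) ≫ β.app (F.obj L') =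
              β.app (F.obj L) ≫ QB.map (G.map (F.map f)) := β.naturality (F.map f)
          have h₃ : F'.map (QB.map f) ≫ φ.inv.app L' = φ.inv.app L ≫ QA.map (F.map f) :=
            φ.inv.naturality f
          change H.map (F'.map (QB.map f)) ≫ H.map (φ.inv.app L') ≫ β.app (F.obj L') ≫
            QB.map (adj.counit.app L') = (H.map (φ.inv.app L) ≫ β.app (F.obj L) ≫
              QB.map (adj.counit.app L)) ≫ QB.map f
          rw [← H.map_comp_assoc, h₃, H.map_comp_assoc, reassoc_of% h₂, h₁, assoc, assoc] }
    obtain ⟨γ', hγ'⟩ := exists_whiskerLeft_eq QB hQB γ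
    let σ : H ⟶ G' :=
      { app d := H.map (adj'.unit.app d) ≫ γ'.app (G'.obj d)
        naturality d d' f := by
          have h₁ : H.map (F'.map (G'.map f)) ≫ γ'.app (G'.obj d') =
            γ'.app (G'.obj d) ≫ G'.map f := γ'.naturality (G'.map f)
          have h₂ : f ≫ adj'.unit.app d' = adj'.unit.app d ≫ F'.map (G'.map f) :=
            adj'.unit.naturality f
          rw [← H.map_comp_assoc, h₂, H.map_comp_assoc, h₁, assoc] }
    refine ⟨σ, fun K => ?_⟩
    have h₁ : γ'.app (G'.obj (QA.obj K)) ≫ α.app K =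
      H.map (F'.map (α.app K)) ≫ γ'.app (QB.obj (G.obj K)) := (γ'.naturality (α.app K)).symm
    have h₂ : H.map (QA.map (adj.unit.app K)) ≫ β.app (F.obj (G.obj K)) =
      β.app K ≫ QB.map (G.map (adj.unit.app K)) := β.naturality (adj.unit.app K)
    have h₃ : γ'.app (QB.obj (G.obj K)) = H.map (φ.inv.app (G.obj K)) ≫
      β.app (F.obj (G.obj K)) ≫ QB.map (adj.counit.app (G.obj K)) := hγ' (G.obj K)
    have h₄ : adj'.unit.app (QA.obj K) ≫ F'.map (α.app K) =
      QA.map (adj.unit.app K) ≫ φ.hom.app (G.obj K) := unit_app_map_leftMate_app φ adj adj' K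
    change (H.map (adj'.unit.app (QA.obj K)) ≫ γ'.app (G'.obj (QA.obj K))) ≫ α.app K = β.app K
    rw [assoc, h₁, ← H.map_comp_assoc, h₄, h₃, ← H.map_comp_assoc, assoc, Iso.hom_inv_id_app]
    have h₅ : H.map (QA.map (adj.unit.app K) ≫ 𝟙 _) = H.map (QA.map (adj.unit.app K)) :=
      H.congr_map (comp_id _)
    refine (h₅ =≫ _).trans ?_
    rw [reassoc_of% h₂, ← QB.map_comp, adj.left_triangle_components]
    exact (_ ≫= QB.map_id _).trans (comp_id _)
  have uniq (H : DA ⥤ DB) (σ τ : H ⟶ G')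
      (h : ∀ K, σ.app (QA.obj K) ≫ α.app K = τ.app (QA.obj K) ≫ α.app K) : σ = τ := by
    have h₁ (σ : H ⟶ G') (L : KB) : σ.app (F'.obj (QB.obj L)) ≫ adj'.counit.app (QB.obj L) =
        H.map (φ.inv.app L) ≫ (σ.app (QA.obj (F.obj L)) ≫ α.app (F.obj L)) ≫
          QB.map (adj.counit.app L) := by
      have h₀ : H.map (φ.inv.app L) ≫ σ.app (QA.obj (F.obj L)) =
        σ.app (F'.obj (QB.obj L)) ≫ G'.map (φ.inv.app L) := σ.naturality (φ.inv.app L)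
      rw [assoc, reassoc_of% h₀, ← leftMate_app_map_counit φ adj adj' L]
    have h₂ (m : DB) : σ.app (F'.obj m) ≫ adj'.counit.app m =
        τ.app (F'.obj m) ≫ adj'.counit.app m := by
      let e := QB.objObjPreimageIso m
      have h₃ (σ : H ⟶ G') : (σ.app (F'.obj m) ≫ adj'.counit.app m) ≫ e.inv =
          H.map (F'.map e.inv) ≫ (σ.app (F'.obj (QB.obj (QB.objPreimage m))) ≫
            adj'.counit.app _) := by
        have n₁ : adj'.counit.app m ≫ e.inv = G'.map (F'.map e.inv) ≫ adj'.counit.app _ :=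
          (adj'.counit.naturality e.inv).symm
        have n₂ : H.map (F'.map e.inv) ≫ σ.app _ =
          σ.app (F'.obj m) ≫ G'.map (F'.map e.inv) := σ.naturality (F'.map e.inv)
        rw [assoc, n₁, reassoc_of% n₂]
      rw [← cancel_mono e.inv, h₃, h₃, h₁, h₁, h]
    ext d
    have h₃ (σ : H ⟶ G') : σ.app d =
        H.map (adj'.unit.app d) ≫ σ.app (F'.obj (G'.obj d)) ≫ adj'.counit.app (G'.obj d) := by
      have n₁ : H.map (adj'.unit.app d) ≫ σ.app (F'.obj (G'.obj d)) =
        σ.app d ≫ G'.map (adj'.unit.app d) := σ.naturality _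
      rw [reassoc_of% n₁, adj'.left_triangle_components]
      exact (comp_id _).symm
    rw [h₃ σ, h₃ τ, h₂]
  refine ⟨⟨IsTerminal.ofUniqueHom
    (fun Z => CostructuredArrow.homMk (fac Z.left Z.hom).choose ?_) (fun Z m => ?_)⟩⟩
  · ext K
    exact (fac Z.left Z.hom).choose_spec K
  · apply CostructuredArrow.hom_ext
    refine uniq _ _ _ (fun K => ?_)
    refine Eq.trans ?_ ((fac Z.left Z.hom).choose_spec K).symm
    exact NatTrans.congr_app (CostructuredArrow.w m) K

end Left

end Kan

/-! ### Detecting shift compatibility after whiskering -/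

section CommShift

variable {C D E : Type*} [Category* C] [Category* D] [Category* E]
  [HasShift C ℤ] [HasShift D ℤ] [HasShift E ℤ]

lemma commShift_of_whiskerRight {F G : C ⥤ D} [F.CommShift ℤ] [G.CommShift ℤ] (τ : F ⟶ G)
    (H : D ⥤ E) [H.CommShift ℤ] [H.Faithful]
    [NatTrans.CommShift (Functor.whiskerRight τ H) ℤ] : NatTrans.CommShift τ ℤ where
  shift_comm a := by
    ext K
    have h := NatTrans.shift_app_comm (Functor.whiskerRight τ H) a K
    apply H.map_injective
    rw [← cancel_mono ((H.commShiftIso a).hom.app _)]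
    simpa [Functor.commShiftIso_comp_hom_app] using h

lemma commShift_of_whiskerLeft {F G : D ⥤ E} [F.CommShift ℤ] [G.CommShift ℤ] (τ : F ⟶ G)
    (H : C ⥤ D) [H.CommShift ℤ] [H.EssSurj]
    [NatTrans.CommShift (Functor.whiskerLeft H τ) ℤ] : NatTrans.CommShift τ ℤ where
  shift_comm a := by
    have h₀ (X : C) : (F.commShiftIso a).hom.app (H.obj X) ≫ (τ.app (H.obj X))⟦a⟧' =
        τ.app _ ≫ (G.commShiftIso a).hom.app (H.obj X) := by
      have h := NatTrans.shift_app_comm (Functor.whiskerLeft H τ) a X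
      rw [← cancel_epi (F.map ((H.commShiftIso a).hom.app X))]
      simpa [Functor.commShiftIso_comp_hom_app] using h
    ext d
    let e := H.objObjPreimageIso d
    have h₁ := h₀ (H.objPreimage d)
    change (F.commShiftIso a).hom.app d ≫ (τ.app d)⟦a⟧' = τ.app _ ≫ (G.commShiftIso a).hom.app d
    have h₂ : F.map (e.hom⟦a⟧') ≫ (F.commShiftIso a).hom.app d =
        (F.commShiftIso a).hom.app _ ≫ (F.map e.hom)⟦a⟧' := (F.commShiftIso a).hom.naturality e.hom
    have h₃ : G.map (e.hom⟦a⟧') ≫ (G.commShiftIso a).hom.app d =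
        (G.commShiftIso a).hom.app _ ≫ (G.map e.hom)⟦a⟧' := (G.commShiftIso a).hom.naturality e.hom
    rw [← cancel_epi (F.map (e.hom⟦a⟧')), reassoc_of% h₂, ← Functor.map_comp, τ.naturality,
      Functor.map_comp, reassoc_of% h₁, ← h₃, τ.naturality_assoc]

end CommShift

/-! ### Shift-compatible adjunctions on bounded homotopy categories -/

section Homotopy

variable {A : Type u₁} [Category.{v₁} A] [Abelian A]
  {B : Type u₂} [Category.{v₂} B] [Abelian B] {F : B ⥤ A} {G : A ⥤ B} [F.Additive] [G.Additive]

instance (adj : F ⊣ G) : (mapComplexAdjunction adj).CommShift ℤ := by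
  refine Adjunction.CommShift.mk' _ _ ⟨fun a => ?_⟩
  ext K n
  simp [mapComplexAdjunction, Functor.commShiftIso_comp_hom_app]
  exact ((_ ≫= (comp_id _).trans (G.map_id _)).trans (comp_id _)).symm

/-- An adjunction between additive functors extends to homotopy categories. -/
def mapHomotopyAdjunction (adj : F ⊣ G) :
    F.mapHomotopyCategory (ComplexShape.up ℤ) ⊣ G.mapHomotopyCategory (ComplexShape.up ℤ) where
  unit :=
    { app K := (HomotopyCategory.quotient _ _).map ((mapComplexAdjunction adj).unit.app K.as)
      naturality := by
        rintro ⟨K⟩ ⟨L⟩ ⟨f : K ⟶ L⟩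
        exact (HomotopyCategory.quotient _ _).congr_map
          ((mapComplexAdjunction adj).unit.naturality f) }
  counit :=
    { app K := (HomotopyCategory.quotient _ _).map ((mapComplexAdjunction adj).counit.app K.as)
      naturality := by
        rintro ⟨K⟩ ⟨L⟩ ⟨f : K ⟶ L⟩
        exact (HomotopyCategory.quotient _ _).congr_map
          ((mapComplexAdjunction adj).counit.naturality f) }
  left_triangle_components K := (HomotopyCategory.quotient _ _).congr_map
    ((mapComplexAdjunction adj).left_triangle_components K.as)
  right_triangle_components K := (HomotopyCategory.quotient _ _).congr_map
    ((mapComplexAdjunction adj).right_triangle_components K.as)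

instance (adj : F ⊣ G) : (mapHomotopyAdjunction adj).CommShift ℤ := by
  refine Adjunction.CommShift.mk' _ _ ?_
  let Q := HomotopyCategory.quotient B (ComplexShape.up ℤ)
  have : NatTrans.CommShift (Functor.whiskerLeft Q (mapHomotopyAdjunction adj).unit) ℤ := by
    -- The whiskered unit is written as a composite of transformations already known to respect
    -- shifts; the connecting isomorphisms have identity components.
    have : Functor.whiskerLeft Q (mapHomotopyAdjunction adj).unit =
      Q.rightUnitor.hom ≫ Q.leftUnitor.inv ≫
        Functor.whiskerRight (mapComplexAdjunction adj).unit Q ≫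
        (Functor.associator _ _ _).hom ≫
        Functor.whiskerLeft _ (G.mapHomotopyCategoryFactors _).inv ≫
        (Functor.associator _ _ _).inv ≫
        Functor.whiskerRight (F.mapHomotopyCategoryFactors _).inv _ ≫
        (Functor.associator _ _ _).hom := by
      ext K
      refine Eq.symm ?_
      simp only [Functor.comp_obj, Functor.id_obj, NatTrans.comp_app, Functor.whiskerLeft_app,
        Functor.whiskerRight_app, Functor.rightUnitor_hom_app, Functor.leftUnitor_inv_app,
        Functor.associator_hom_app, Functor.associator_inv_app, id_comp, comp_id]
      have h : (G.mapHomotopyCategory (ComplexShape.up ℤ)).map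
          ((F.mapHomotopyCategoryFactors (ComplexShape.up ℤ)).inv.app K) = 𝟙 _ :=
        CategoryTheory.Functor.map_id _ _
      exact (_ ≫= (id_comp _).trans h).trans (comp_id _)
    rw [this]
    infer_instance
  exact commShift_of_whiskerLeft _ Q

/-- An adjunction between additive functors extends to `s`-bounded homotopy categories. -/
def mapKStarAdjunction (adj : F ⊣ G) (s : Bound) : mapKStar F s ⊣ mapKStar G s where
  unit :=
    { app K := ⟨(mapHomotopyAdjunction adj).unit.app K.obj⟩
      naturality K L f := by
        ext
        exact (mapHomotopyAdjunction adj).unit.naturality f.hom }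
  counit :=
    { app K := ⟨(mapHomotopyAdjunction adj).counit.app K.obj⟩
      naturality K L f := by
        ext
        exact (mapHomotopyAdjunction adj).counit.naturality f.hom }
  left_triangle_components K := by
    ext
    exact (mapHomotopyAdjunction adj).left_triangle_components K.obj
  right_triangle_components K := by
    ext
    exact (mapHomotopyAdjunction adj).right_triangle_components K.obj

/-- `mapKStar` is a restriction of `mapHomotopyCategory`. -/
def mapKStarCompι (F : B ⥤ A) [F.Additive] (s : Bound) :
    mapKStar F s ⋙ (kProp A s).ι ≅ (kProp B s).ι ⋙ F.mapHomotopyCategory _ :=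
  (kProp A s).liftCompιIso _ _

instance (s : Bound) : NatTrans.CommShift (mapKStarCompι F s).hom ℤ := by
  exact Functor.CommShift.ofComp_compatibility _ _

instance (adj : F ⊣ G) (s : Bound) : (mapKStarAdjunction adj s).CommShift ℤ := by
  refine Adjunction.CommShift.mk' _ _ ?_
  have : NatTrans.CommShift
      (Functor.whiskerRight (mapKStarAdjunction adj s).unit (kProp B s).ι) ℤ := by
    have : Functor.whiskerRight (mapKStarAdjunction adj s).unit (kProp B s).ι =
      (kProp B s).ι.leftUnitor.hom ≫ (kProp B s).ι.rightUnitor.inv ≫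
        Functor.whiskerLeft _ (mapHomotopyAdjunction adj).unit ≫
        (Functor.associator _ _ _).inv ≫
        Functor.whiskerRight (mapKStarCompι F s).inv _ ≫
        (Functor.associator _ _ _).hom ≫
        Functor.whiskerLeft _ (mapKStarCompι G s).inv ≫
        (Functor.associator _ _ _).inv := by
      ext K
      refine Eq.symm ?_
      simp only [Functor.comp_obj, Functor.id_obj, NatTrans.comp_app, Functor.whiskerLeft_app,
        Functor.whiskerRight_app, Functor.rightUnitor_inv_app, Functor.leftUnitor_hom_app,
        Functor.associator_hom_app, Functor.associator_inv_app, id_comp, comp_id]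
      have h : (G.mapHomotopyCategory (ComplexShape.up ℤ)).map
          ((mapKStarCompι F s).inv.app K) = 𝟙 _ := CategoryTheory.Functor.map_id _ _
      exact (_ ≫= (comp_id _).trans h).trans (comp_id _)
    rw [this]
    infer_instance
  exact commShift_of_whiskerRight _ (kProp B s).ι

end Homotopy

/-! ### Exact functors commute with localization -/

section Localization

variable (A : Type u₁) [Category.{v₁} A] [Abelian A] [HasDerivedCategory.{w₁} A]
  {B : Type u₂} [Category.{v₂} B] [Abelian B] [HasDerivedCategory.{w₂} B]

/-- `qStar` is a restriction of the localization functor. -/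
def qStarCompι (s : Bound) :
    qStar A s ⋙ (dProp A s).ι ≅ (kProp A s).ι ⋙ DerivedCategory.Qh :=
  (dProp A s).liftCompιIso _ _

instance (s : Bound) : NatTrans.CommShift (qStarCompι A s).hom ℤ := by
  exact Functor.CommShift.ofComp_compatibility _ _

variable {A} (F : A ⥤ B) [F.Additive] [PreservesFiniteLimits F] [PreservesFiniteColimits F]
  (s : Bound)

/-- `mapDStar` is a restriction of `mapDerivedCategory`. -/
def mapDStarCompι :
    mapDStar F s ⋙ (dProp B s).ι ≅ (dProp A s).ι ⋙ F.mapDerivedCategory :=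
  (dProp B s).liftCompιIso _ _

instance : NatTrans.CommShift (mapDStarCompι F s).hom ℤ := by
  exact Functor.CommShift.ofComp_compatibility _ _

/-- The square of functors relating `mapKStar` and `mapDStar`, after inclusion in the
derived category. -/
def qStarSquareι : (mapKStar F s ⋙ qStar B s) ⋙ (dProp B s).ι ≅
    (qStar A s ⋙ mapDStar F s) ⋙ (dProp B s).ι :=
  Functor.associator _ _ _ ≪≫ Functor.isoWhiskerLeft _ (qStarCompι B s) ≪≫
    (Functor.associator _ _ _).symm ≪≫ Functor.isoWhiskerRight (mapKStarCompι F s) _ ≪≫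
    Functor.associator _ _ _ ≪≫ Functor.isoWhiskerLeft _ F.mapDerivedCategoryFactorsh.symm ≪≫
    (Functor.associator _ _ _).symm ≪≫ Functor.isoWhiskerRight (qStarCompι A s).symm _ ≪≫
    Functor.associator _ _ _ ≪≫ Functor.isoWhiskerLeft _ (mapDStarCompι F s).symm ≪≫
    (Functor.associator _ _ _).symm

instance : NatTrans.CommShift (qStarSquareι F s).hom ℤ := by
  dsimp [qStarSquareι]
  infer_instance

/-- The functor `mapDStar F s` is induced by `mapKStar F s`. -/
def qStarSquare : mapKStar F s ⋙ qStar B s ≅ qStar A s ⋙ mapDStar F s :=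
  ((dProp B s).fullyFaithfulι.whiskeringRight _).preimageIso (qStarSquareι F s)

instance : NatTrans.CommShift (qStarSquare F s).hom ℤ := by
  have : NatTrans.CommShift (Functor.whiskerRight (qStarSquare F s).hom (dProp B s).ι) ℤ := by
    have : Functor.whiskerRight (qStarSquare F s).hom (dProp B s).ι = (qStarSquareι F s).hom :=
      ((dProp B s).fullyFaithfulι.whiskeringRight _).map_preimage _
    rw [this]
    infer_instance
  exact commShift_of_whiskerRight _ (dProp B s).ι

end Localization

/-! ### Mates respect shifts -/

section Mate

variable {KA KB DA DB : Type*} [Category* KA] [Category* KB] [Category* DA] [Category* DB]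
  [HasShift KA ℤ] [HasShift KB ℤ] [HasShift DA ℤ] [HasShift DB ℤ]
  {QA : KA ⥤ DA} {QB : KB ⥤ DB} {F : KB ⥤ KA} {G : KA ⥤ KB} {F' : DB ⥤ DA} {G' : DA ⥤ DB}
  [QA.CommShift ℤ] [QB.CommShift ℤ] [F.CommShift ℤ] [G.CommShift ℤ] [F'.CommShift ℤ]
  [G'.CommShift ℤ]
  (φ : F ⋙ QA ≅ QB ⋙ F') [NatTrans.CommShift φ.hom ℤ]

instance (adj : F ⊣ G) (adj' : F' ⊣ G') [adj.CommShift ℤ] [adj'.CommShift ℤ] :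
    NatTrans.CommShift (rightMate φ adj adj') ℤ := by
  unfold rightMate
  infer_instance

instance (adj : G ⊣ F) (adj' : G' ⊣ F') [adj.CommShift ℤ] [adj'.CommShift ℤ] :
    NatTrans.CommShift (leftMate φ adj adj') ℤ := by
  unfold leftMate
  infer_instance

end Mate

/-! ### Fractions within bounded complexes -/

section Fractions

variable (A : Type u) [Category.{v} A] [Abelian A] [HasDerivedCategory.{w} A]

lemma exists_iso_Q_obj_of_dProp (s : Bound) (M : DerivedCategory A) (hM : dProp A s M) :
    ∃ K : CochainComplex A ℤ, cProp A s K ∧ Nonempty (M ≅ DerivedCategory.Q.obj K) := by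
  cases s
  · obtain ⟨⟨a, ha⟩, ⟨b, hb⟩⟩ := hM
    have : M.IsGE a := ha
    have : M.IsLE b := hb
    obtain ⟨K, _, _, ⟨e⟩⟩ := DerivedCategory.exists_iso_Q_obj_of_isGE_of_isLE M a b
    exact ⟨K, ⟨⟨a, inferInstance⟩, ⟨b, inferInstance⟩⟩, ⟨e⟩⟩
  · obtain ⟨a, ha⟩ := hM
    have : M.IsGE a := ha
    obtain ⟨K, _, ⟨e⟩⟩ := DerivedCategory.exists_iso_Q_obj_of_isGE M a
    exact ⟨K, ⟨a, inferInstance⟩, ⟨e⟩⟩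
  · obtain ⟨b, hb⟩ := hM
    have : M.IsLE b := hb
    obtain ⟨K, _, ⟨e⟩⟩ := DerivedCategory.exists_iso_Q_obj_of_isLE M b
    exact ⟨K, ⟨b, inferInstance⟩, ⟨e⟩⟩
  · exact ⟨_, trivial, ⟨(DerivedCategory.Q.objObjPreimageIso M).symm⟩⟩

instance (s : Bound) : (qStar A s).EssSurj where
  mem_essImage M := by
    obtain ⟨K, hK, ⟨e⟩⟩ := exists_iso_Q_obj_of_dProp A s M.obj M.property
    exact ⟨⟨(HomotopyCategory.quotient A _).obj K, hK⟩,
      ⟨(dProp A s).isoMk ((DerivedCategory.quotientCompQhIso A).app K ≪≫ e.symm)⟩⟩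

variable {A}

/-- The side of the fraction follows the bound, since the auxiliary complex must satisfy it too:
enlarge the target for bounded below complexes, and replace the source for bounded above or bounded
ones. -/
lemma exists_fraction_of_cProp (s : Bound) {K L : CochainComplex A ℤ} (hK : cProp A s K)
    (hL : cProp A s L) (f : DerivedCategory.Q.obj K ⟶ DerivedCategory.Q.obj L) :
    (∃ (L' : CochainComplex A ℤ) (_ : cProp A s L') (g : K ⟶ L') (t : L ⟶ L'),
      IsIso (DerivedCategory.Q.map t) ∧ f ≫ DerivedCategory.Q.map t = DerivedCategory.Q.map g) ∨
    ∃ (K' : CochainComplex A ℤ) (_ : cProp A s K') (g : K' ⟶ L) (t : K' ⟶ K),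
      IsIso (DerivedCategory.Q.map t) ∧
        DerivedCategory.Q.map t ≫ f = DerivedCategory.Q.map g := by
  cases s
  · obtain ⟨⟨a, _⟩, ⟨b, _⟩⟩ := hK
    obtain ⟨⟨a', _⟩, ⟨b', _⟩⟩ := hL
    -- The right fraction preserving a lower bound needs one common to both complexes, hence the
    -- minimum; the upper bound comes from `K` alone.
    have := L.isStrictlyGE_of_ge (min a a') a' (min_le_right _ _)
    have := K.isStrictlyGE_of_ge (min a a') a (min_le_left _ _)
    obtain ⟨K', _, _, t, _, g, rfl⟩ :=
      DerivedCategory.right_fac_of_isStrictlyLE_of_isStrictlyGE (min a a') b f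
    exact Or.inr ⟨K', ⟨⟨min a a', inferInstance⟩, ⟨b, inferInstance⟩⟩, g, t, inferInstance, by simp⟩
  · obtain ⟨a, _⟩ := hL
    obtain ⟨L', _, g, t, _, rfl⟩ := DerivedCategory.left_fac_of_isStrictlyGE f a
    exact Or.inl ⟨L', ⟨a, inferInstance⟩, g, t, inferInstance, by simp⟩
  · obtain ⟨b, _⟩ := hK
    obtain ⟨K', _, t, _, g, rfl⟩ := DerivedCategory.right_fac_of_isStrictlyLE f b
    exact Or.inr ⟨K', ⟨b, inferInstance⟩, g, t, inferInstance, by simp⟩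
  · obtain ⟨L', g, t, _, rfl⟩ := DerivedCategory.left_fac f
    exact Or.inl ⟨L', trivial, g, t, inferInstance, by simp⟩

lemma exists_fraction_Qh_of_cProp (s : Bound) {K L : CochainComplex A ℤ} (hK : cProp A s K)
    (hL : cProp A s L) (f : DerivedCategory.Qh.obj ((HomotopyCategory.quotient A _).obj K) ⟶
      DerivedCategory.Qh.obj ((HomotopyCategory.quotient A _).obj L)) :
    (∃ (L' : CochainComplex A ℤ) (_ : cProp A s L') (g : K ⟶ L') (t : L ⟶ L'),
      IsIso (DerivedCategory.Qh.map ((HomotopyCategory.quotient A _).map t)) ∧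
        f ≫ DerivedCategory.Qh.map ((HomotopyCategory.quotient A _).map t) =
          DerivedCategory.Qh.map ((HomotopyCategory.quotient A _).map g)) ∨
    ∃ (K' : CochainComplex A ℤ) (_ : cProp A s K') (g : K' ⟶ L) (t : K' ⟶ K),
      IsIso (DerivedCategory.Qh.map ((HomotopyCategory.quotient A _).map t)) ∧
        DerivedCategory.Qh.map ((HomotopyCategory.quotient A _).map t) ≫ f =
          DerivedCategory.Qh.map ((HomotopyCategory.quotient A _).map g) := by
  let e := DerivedCategory.quotientCompQhIso A
  have map_eq {K L : CochainComplex A ℤ} (t : K ⟶ L) :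
      DerivedCategory.Qh.map ((HomotopyCategory.quotient A _).map t) =
        e.hom.app K ≫ DerivedCategory.Q.map t ≫ e.inv.app L :=
    (NatIso.naturality_2 e t).symm
  have isIso {K L : CochainComplex A ℤ} (t : K ⟶ L) [IsIso (DerivedCategory.Q.map t)] :
      IsIso (DerivedCategory.Qh.map ((HomotopyCategory.quotient A _).map t)) := by
    rw [map_eq]
    infer_instance
  obtain ⟨L', hL', g, t, _, h⟩ | ⟨K', hK', g, t, _, h⟩ :=
    exists_fraction_of_cProp s hK hL (e.inv.app K ≫ f ≫ e.hom.app L)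
  · refine Or.inl ⟨L', hL', g, t, isIso t, ?_⟩
    have h' : e.hom.app K ≫ ((e.inv.app K ≫ f ≫ e.hom.app L) ≫ DerivedCategory.Q.map t) ≫
        e.inv.app L' = f ≫ e.hom.app L ≫ DerivedCategory.Q.map t ≫ e.inv.app L' := by
      rw [assoc, assoc, assoc, e.hom_inv_id_app_assoc]
    rw [map_eq, map_eq, ← h, h']
  · refine Or.inr ⟨K', hK', g, t, isIso t, ?_⟩
    have h' : e.hom.app K' ≫ (DerivedCategory.Q.map t ≫ e.inv.app K ≫ f ≫ e.hom.app L) ≫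
        e.inv.app L = (e.hom.app K' ≫ DerivedCategory.Q.map t ≫ e.inv.app K) ≫ f := by
      rw [assoc, assoc, assoc, assoc, assoc, e.hom_inv_id_app]
      exact _ ≫= _ ≫= _ ≫= comp_id f
    rw [map_eq, map_eq, ← h, h']

variable (A) in
lemma hasFractions_qStar (s : Bound) : HasFractions (qStar A s) := by
  rintro ⟨⟨K⟩, hK⟩ ⟨⟨L⟩, hL⟩ f
  obtain ⟨L', hL', g, t, ht, h⟩ | ⟨K', hK', g, t, ht, h⟩ :=
    exists_fraction_Qh_of_cProp s hK hL f.hom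
  · refine Or.inl ⟨⟨(HomotopyCategory.quotient A _).obj L', hL'⟩,
      ⟨(HomotopyCategory.quotient A _).map g⟩, ⟨(HomotopyCategory.quotient A _).map t⟩, ?_, ?_⟩
    · exact @isIso_of_fully_faithful _ _ _ _ (dProp A s).ι _ _ _ _ _ ht
    · ext
      exact h
  · refine Or.inr ⟨⟨(HomotopyCategory.quotient A _).obj K', hK'⟩,
      ⟨(HomotopyCategory.quotient A _).map g⟩, ⟨(HomotopyCategory.quotient A _).map t⟩, ?_, ?_⟩
    · exact @isIso_of_fully_faithful _ _ _ _ (dProp A s).ι _ _ _ _ _ ht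
    · ext
      exact h

end Fractions

/-! ### Adjoints are derived functors -/

section Derived

variable {A : Type u₁} [Category.{v₁} A] [Abelian A] [HasDerivedCategory.{w₁} A]
  {B : Type u₂} [Category.{v₂} B] [Abelian B] [HasDerivedCategory.{w₂} B]
  {F : B ⥤ A} {G : A ⥤ B} [F.Additive] [G.Additive]
  [PreservesFiniteLimits F] [PreservesFiniteColimits F] {s : Bound}

/-- A right adjoint of the functor induced on derived categories by an exact functor `F` is
the right derived functor of the right adjoint of `F`. -/
lemma isRightDerived_of_adjunction (adj : F ⊣ G) {R : DStar A s ⥤ DStar B s} [R.CommShift ℤ]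
    (adj' : mapDStar F s ⊣ R) [adj'.CommShift ℤ] : IsRightDerived G s R :=
  ⟨rightMate (qStarSquare F s) (mapKStarAdjunction adj s) adj', inferInstance,
    isLeftKanExtension_rightMate _ _ _ (hasFractions_qStar B s)⟩

/-- A left adjoint of the functor induced on derived categories by an exact functor `F` is
the left derived functor of the left adjoint of `F`. -/
lemma isLeftDerived_of_adjunction (adj : G ⊣ F) {L : DStar A s ⥤ DStar B s} [L.CommShift ℤ]
    (adj' : L ⊣ mapDStar F s) [adj'.CommShift ℤ] : IsLeftDerived G s L :=
  ⟨leftMate (qStarSquare F s) (mapKStarAdjunction adj s) adj', inferInstance,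
    isRightKanExtension_leftMate _ _ _ (hasFractions_qStar B s)⟩

end Derived

end DerivedDecomposition

end

theorem corollary3p16
    {A : Type u} [Category.{v} A] [Abelian A]
    [HasProducts.{v} A] [HasCoproducts.{v} A] [EnoughProjectives A] [EnoughInjectives A]
    (X Y : ObjectProperty A) [IsAbelianSubcategory X] [IsAbelianSubcategory Y]
    [HasDerivedCategory.{w} A] [HasDerivedCategory.{w₁} X.FullSubcategory]
    [HasDerivedCategory.{w₂} Y.FullSubcategory]
    (hXY : IsDDecomposition X Y .bounded) :
    X.ι.IsLeftAdjoint ∧ Y.ι.IsRightAdjoint ∧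
      ∀ (r : A ⥤ X.FullSubcategory) [r.Additive] (_ : X.ι ⊣ r)
        (ℓ : A ⥤ Y.FullSubcategory) [ℓ.Additive] (_ : ℓ ⊣ Y.ι) (s : Bound),
        ∃ (R : DStar A s ⥤ DStar X.FullSubcategory s) (_ : R.CommShift ℤ)
          (L : DStar A s ⥤ DStar Y.FullSubcategory s) (_ : L.CommShift ℤ),
          IsRightDerived r s R ∧ IsLeftDerived ℓ s L ∧
            Nonempty (LowerHalfRecollement (mapDStar X.ι s) R L (mapDStar Y.ι s)) := by
  refine ⟨hXY.isLeftAdjoint, hXY.isRightAdjoint, fun r _ adj ℓ _ adj' s => ?_⟩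
  obtain ⟨R, hR, L, hL, H, _, _⟩ := hXY.exists_lowerHalfRecollement s
  -- `R` and `L` come from the inclusions alone, so they serve as derived functors for every choice
  -- of `r` and `ℓ`.
  exact ⟨R, hR, L, hL, isRightDerived_of_adjunction adj H.adjRight,
    isLeftDerived_of_adjunction adj' H.adjLeft, ⟨H⟩⟩
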